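/- Setting. Let $n\ge 2$, $p\ge1$, $L\ge2$. Let $Y$ take values in the canonical basis $\{e_1,\dots,e_L\}$ of $\mathbb R^L$ with $\pi_\ell=\mathbb P\{Y=e_\ell\}$, and let $X\mid Y=e_\ell\sim\mathcal N_p(\mu_\ell,\Sigma_W)$ with $\Sigma_W$ positive definite and $\mathbb E(X)=0$. Write $M=(\mu_1,\dots,\mu_L)\in\mathbb R^{p\times L}$, $B^*=\Sigma_W^{-1}M$, $B=[\mathrm{Cov}(X)]^{-1}\mathrm{Cov}(X,Y)\in\mathbb R^{p\times L}$ and $r=\mathrm{rank}(B)$. The training data $\mathbf D=(\mathbf X,\mathbf Y)\in\mathbb R^{n\times p}\times\{0,1\}^{n\times L}$ consist of $n$ i.i.d. copies of $(X,Y)$ and are independent of $(X,Y)$. The Bayes rule is $g^*(x)\in\arg\min_\ell\{\mu_\ell^\top B^*_\ell-2x^\top B^*_\ell-2\log\pi_\ell\}$. Classifier. Let $\widehat B$ be any minimizer over $\mathbb R^{p\times L}$ of $\frac1n\|\mathbf Y-\mathbf XB'\|_F^2+\lambda\,\mathrm{rank}(B')$, and put $\widehat M=(\widehat\mu_1,\dots,\widehat\mu_L)=\mathbf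 X^\top\mathbf Y(\mathbf Y^\top\mathbf Y)^{-1}$, $\mathrm{diag}(\widehat\pi)=\frac1n\mathbf Y^\top\mathbf Y$, $\widehat H=\frac1n(\mathbf Y^\top\mathbf Y-\widehat B^\top\mathbf X^\top\mathbf X\widehat B)$, $\widehat B^*=\widehat B\widehat H^{+}$ (Moore–Penrose inverse), and $\widehat g(x)\in\arg\min_\ell\{\widehat\mu_\ell^\top\widehat B^*_\ell-2x^\top\widehat B^*_\ell-2\log\widehat\pi_\ell\}$. Minimizers are chosen arbitrarily (with $\widehat g$ jointly measurable in the data and $x$) when they are not unique, and $\widehat g$ is arbitrary when some class does not occur in the training data. Its excess risk is $\mathcal R(\widehat g)=\mathbb P\{Y\ne\widehat g(X)\mid\mathbf D\}-\mathbb P\{Y\ne g^*(X)\}$. Statement. For all constants $0<c\le C<\infty$ there exist $c_0>0$ and $K_0>0$ depending only on $c,C$ such that for every $K_1\ge K_0$ there is a constant $C'>0$ depending only on $c,C,K_1$ with the following property. Suppose that $c/L\le\pi_\ell\le C/L$ for all $\ell$; that for some $\Delta$ with $c\le\Delta\le C$ one has $c\Delta\le(\mu_k-\mu_\ell)^\top\Sigma_W^{-1}(\mu_k-\mu_\ell)\le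 C\Delta$ for all $k\ne\ell$; that all eigenvalues of $\Sigma_W$ lie in $[c,C]$; that $(p+L)\log n\le c_0n$; and that $$K_0\,\frac{(p+L)\log n}{nL}\le\lambda\le K_1\,\frac{(p+L)\log n}{nL}.$$ Then $$\mathbb E_{\mathbf D}[\mathcal R(\widehat g)]\le C'\min\Big\{\frac{(p+L)\,r\,L}{n}\log^2 n,\ 1\Big\}.$$ -/

import Mathlib

open MeasureTheory ProbabilityTheory Matrix

noncomputable section

namespace LDA

/-! ### The Moore–Penrose inverse of a real matrix -/

/-- The four Penrose equations. -/
structure IsMoorePenrose {m n : ℕ} (A : Matrix (Fin m) (Fin n) ℝ)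
    (X : Matrix (Fin n) (Fin m) ℝ) : Prop where
  mul_mul_self : A * X * A = A
  self_mul_mul : X * A * X = X
  symm_left : (A * X)ᵀ = A * X
  symm_right : (X * A)ᵀ = X * A

theorem IsMoorePenrose.unique {m n : ℕ} {A : Matrix (Fin m) (Fin n) ℝ}
    {X Z : Matrix (Fin n) (Fin m) ℝ} (hX : IsMoorePenrose A X) (hZ : IsMoorePenrose A Z) :
    X = Z := by
  have h1 : A * X = A * Z := by
    calc A * X = (A * X)ᵀ := hX.symm_left.symm
      _ = (A * Z * A * X)ᵀ := by rw [hZ.mul_mul_self]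
      _ = (A * X)ᵀ * (A * Z)ᵀ := by rw [← transpose_mul, ← Matrix.mul_assoc]
      _ = A * X * (A * Z) := by rw [hX.symm_left, hZ.symm_left]
      _ = A * X * A * Z := by rw [← Matrix.mul_assoc]
      _ = A * Z := by rw [hX.mul_mul_self]
  have h2 : X * A = Z * A := by
    calc X * A = (X * A)ᵀ := hX.symm_right.symm
      _ = (X * (A * Z * A))ᵀ := by rw [hZ.mul_mul_self]
      _ = (X * A * (Z * A))ᵀ := by simp only [Matrix.mul_assoc]
      _ = (Z * A)ᵀ * (X * A)ᵀ := by rw [← transpose_mul]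
      _ = Z * A * (X * A) := by rw [hX.symm_right, hZ.symm_right]
      _ = Z * (A * X * A) := by simp only [Matrix.mul_assoc]
      _ = Z * A := by rw [hX.mul_mul_self]
  calc X = X * A * X := hX.self_mul_mul.symm
    _ = Z * A * X := by rw [h2]
    _ = Z * (A * X) := by rw [Matrix.mul_assoc]
    _ = Z * (A * Z) := by rw [h1]
    _ = Z * A * Z := by rw [Matrix.mul_assoc]
    _ = Z := hZ.self_mul_mul

theorem exists_isMoorePenrose_of_symm {n : ℕ} (S : Matrix (Fin n) (Fin n) ℝ) (hS : Sᵀ = S) :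
    ∃ T, IsMoorePenrose S T ∧ Tᵀ = T := by
  have hH : S.IsHermitian := by
    rw [Matrix.IsHermitian, conjTranspose_eq_transpose_of_trivial, hS]
  set U : Matrix (Fin n) (Fin n) ℝ := hH.eigenvectorUnitary.1 with hU
  have hUU : Uᵀ * U = 1 := by
    have := Unitary.coe_star_mul_self hH.eigenvectorUnitary
    rwa [star_eq_conjTranspose, conjTranspose_eq_transpose_of_trivial] at this
  set d := hH.eigenvalues
  have hspec : S = U * diagonal d * Uᵀ := by
    have := hH.spectral_theorem
    rw [Unitary.conjStarAlgAut_apply, star_eq_conjTranspose,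
      conjTranspose_eq_transpose_of_trivial] at this
    simpa using this
  have key : ∀ a b : Fin n → ℝ, U * diagonal a * Uᵀ * (U * diagonal b * Uᵀ)
      = U * diagonal (fun i => a i * b i) * Uᵀ := by
    intro a b
    calc U * diagonal a * Uᵀ * (U * diagonal b * Uᵀ)
        = U * diagonal a * (Uᵀ * U) * diagonal b * Uᵀ := by simp only [Matrix.mul_assoc]
      _ = _ := by rw [hUU, Matrix.mul_one, Matrix.mul_assoc U, diagonal_mul_diagonal]
  have ksymm : ∀ a : Fin n → ℝ, (U * diagonal a * Uᵀ)ᵀ = U * diagonal a * Uᵀ := by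
    intro a
    simp [transpose_mul, Matrix.mul_assoc]
  refine ⟨U * diagonal (fun i => (d i)⁻¹) * Uᵀ, ⟨?_, ?_, ?_, ?_⟩, ksymm _⟩
  · rw [hspec, key, key]
    congr 3
    funext i
    exact mul_inv_mul_cancel (d i)
  · rw [hspec, key, key]
    congr 3
    funext i
    by_cases h : d i = 0 <;> simp [h]
  · rw [hspec, key, ksymm]
  · rw [hspec, key, ksymm]

theorem exists_isMoorePenrose {m n : ℕ} (A : Matrix (Fin m) (Fin n) ℝ) :
    ∃ X, IsMoorePenrose A X := by
  obtain ⟨T, hT, hTs⟩ := exists_isMoorePenrose_of_symm (Aᵀ * A) (by simp [transpose_mul])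
  have hA : A * (T * (Aᵀ * A)) = A := by
    have h0 : (A * (T * (Aᵀ * A)) - A)ᵀ * (A * (T * (Aᵀ * A)) - A) = 0 := by
      have h1 : Aᵀ * (A * (T * (Aᵀ * A)) - A) = 0 := by
        rw [Matrix.mul_sub, sub_eq_zero, ← Matrix.mul_assoc, ← Matrix.mul_assoc]
        exact hT.mul_mul_self
      have h2 : A * (T * (Aᵀ * A)) - A = A * (T * (Aᵀ * A) - 1) := by
        rw [Matrix.mul_sub, Matrix.mul_one]
      calc (A * (T * (Aᵀ * A)) - A)ᵀ * (A * (T * (Aᵀ * A)) - A)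
          = (T * (Aᵀ * A) - 1)ᵀ * (Aᵀ * (A * (T * (Aᵀ * A)) - A)) := by
            rw [← Matrix.mul_assoc (_)ᵀ, ← transpose_mul, ← h2]
        _ = 0 := by rw [h1, Matrix.mul_zero]
    rw [← conjTranspose_eq_transpose_of_trivial, conjTranspose_mul_self_eq_zero] at h0
    exact sub_eq_zero.mp h0
  refine ⟨T * Aᵀ, ⟨?_, ?_, ?_, ?_⟩⟩
  · simpa only [Matrix.mul_assoc] using hA
  · calc T * Aᵀ * A * (T * Aᵀ) = T * (Aᵀ * A) * T * Aᵀ := by simp only [Matrix.mul_assoc]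
      _ = T * Aᵀ := by rw [hT.self_mul_mul]
  · simp [transpose_mul, hTs, Matrix.mul_assoc]
  · simpa only [Matrix.mul_assoc] using hT.symm_right

/-- The Moore–Penrose inverse `A⁺`, the unique solution of the Penrose equations. -/
def pinv {m n : ℕ} (A : Matrix (Fin m) (Fin n) ℝ) : Matrix (Fin n) (Fin m) ℝ :=
  (exists_isMoorePenrose A).choose

theorem pinv_spec {m n : ℕ} (A : Matrix (Fin m) (Fin n) ℝ) : IsMoorePenrose A (pinv A) :=
  (exists_isMoorePenrose A).choose_spec

/-! ### The Gaussian mixture model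

A labelled observation is a pair `(x, ℓ)`; the label `ℓ : Fin L` stands for the canonical basis
vector `e_ℓ`. -/

/-- The law of `(X, Y)` with `P(Y = e_ℓ) = π_ℓ` and `X | Y = e_ℓ ∼ N(μ_ℓ, Σ_W)`, where `μ_ℓ` is the
`ℓ`-th column of `M`. -/
def law {p L : ℕ} (w : Fin L → ℝ) (M : Matrix (Fin p) (Fin L) ℝ) (SW : Matrix (Fin p) (Fin p) ℝ) :
    Measure (EuclideanSpace ℝ (Fin p) × Fin L) :=
  ∑ l, ENNReal.ofReal (w l) •
    (multivariateGaussian (WithLp.toLp 2 (M.col l)) SW).prod (Measure.dirac l)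

/-- The law of the training data: `n` independent copies of `(X, Y)`. -/
def dataLaw {p L : ℕ} (n : ℕ) (P : Measure (EuclideanSpace ℝ (Fin p) × Fin L)) :
    Measure (Fin n → EuclideanSpace ℝ (Fin p) × Fin L) :=
  Measure.pi fun _ => P

/-- The unconditional covariance matrix `Σ = Cov(X)`. -/
def covX {p L : ℕ} (P : Measure (EuclideanSpace ℝ (Fin p) × Fin L)) :
    Matrix (Fin p) (Fin p) ℝ :=
  Matrix.of fun i j => cov[fun z => z.1 i, fun z => z.1 j; P]

/-- The cross-covariance matrix `Cov(X, Y)`, with `Y` the indicator vector of the label. -/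
def covXY {p L : ℕ} (P : Measure (EuclideanSpace ℝ (Fin p) × Fin L)) :
    Matrix (Fin p) (Fin L) ℝ :=
  Matrix.of fun i l => cov[fun z => z.1 i, fun z => if z.2 = l then (1 : ℝ) else 0; P]

/-- The regression matrix `B = [Cov(X)]⁻¹ Cov(X, Y)`. -/
def regMatrix {p L : ℕ} (P : Measure (EuclideanSpace ℝ (Fin p) × Fin L)) :
    Matrix (Fin p) (Fin L) ℝ :=
  (covX P)⁻¹ * covXY P

/-- The squared Mahalanobis distance `(μ_k - μ_ℓ)ᵀ Σ_W⁻¹ (μ_k - μ_ℓ)`. -/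
def mahal {p L : ℕ} (M : Matrix (Fin p) (Fin L) ℝ) (SW : Matrix (Fin p) (Fin p) ℝ)
    (k l : Fin L) : ℝ :=
  (M.col k - M.col l) ⬝ᵥ (SW⁻¹ *ᵥ (M.col k - M.col l))

/-- The discriminant functions `μ_ℓᵀ b_ℓ - 2 xᵀ b_ℓ - 2 log π_ℓ` built from a mean matrix `M`, a
direction matrix `Bs = (b_1, …, b_L)` and class probabilities `w = π`. -/
def discr {p L : ℕ} (M Bs : Matrix (Fin p) (Fin L) ℝ) (w : Fin L → ℝ)
    (x : EuclideanSpace ℝ (Fin p)) (l : Fin L) : ℝ :=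
  M.col l ⬝ᵥ Bs.col l - 2 * (x.ofLp ⬝ᵥ Bs.col l) - 2 * Real.log (w l)

/-- `g` is a version of the Bayes rule: `g x` minimises the true discriminant functions, in which
`B* = Σ_W⁻¹ M`. -/
def IsBayesRule {p L : ℕ} (w : Fin L → ℝ) (M : Matrix (Fin p) (Fin L) ℝ)
    (SW : Matrix (Fin p) (Fin p) ℝ) (g : EuclideanSpace ℝ (Fin p) → Fin L) : Prop :=
  Measurable g ∧ ∀ x l, discr M (SW⁻¹ * M) w x (g x) ≤ discr M (SW⁻¹ * M) w x l

/-- The excess risk `P{Y ≠ g(X)} - P{Y ≠ g*(X)}` of a fixed classifier `g`. -/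
def excessRisk {p L : ℕ} (P : Measure (EuclideanSpace ℝ (Fin p) × Fin L))
    (gstar g : EuclideanSpace ℝ (Fin p) → Fin L) : ℝ :=
  P.real {z | z.2 ≠ g z.1} - P.real {z | z.2 ≠ gstar z.1}

/-! ### The estimators -/

/-- The `n × p` feature matrix. -/
def dataX {n p L : ℕ} (D : Fin n → EuclideanSpace ℝ (Fin p) × Fin L) : Matrix (Fin n) (Fin p) ℝ :=
  Matrix.of fun i j => (D i).1 j

/-- The `n × L` indicator matrix of the labels. -/
def dataY {n p L : ℕ} (D : Fin n → EuclideanSpace ℝ (Fin p) × Fin L) : Matrix (Fin n) (Fin L) ℝ :=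
  Matrix.of fun i l => if (D i).2 = l then 1 else 0

/-- The criterion `n⁻¹ ‖Y - X B‖_F² + lam * rank(B)`. -/
def rrCriterion {n p L : ℕ} (lam : ℝ) (D : Fin n → EuclideanSpace ℝ (Fin p) × Fin L)
    (B : Matrix (Fin p) (Fin L) ℝ) : ℝ :=
  (1 / (n : ℝ)) * (∑ i, ∑ l, (dataY D - dataX D * B) i l ^ 2) + lam * (B.rank : ℝ)

/-- `Bh` is a reduced-rank regression estimator of `B` (a global minimiser of the criterion). -/
def IsReducedRank {n p L : ℕ} (lam : ℝ) (D : Fin n → EuclideanSpace ℝ (Fin p) × Fin L)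
    (Bh : Matrix (Fin p) (Fin L) ℝ) : Prop :=
  ∀ B, rrCriterion lam D Bh ≤ rrCriterion lam D B

/-- `M̂ = Xᵀ Y (Yᵀ Y)⁻¹`. -/
def Mhat {n p L : ℕ} (D : Fin n → EuclideanSpace ℝ (Fin p) × Fin L) : Matrix (Fin p) (Fin L) ℝ :=
  (dataX D)ᵀ * dataY D * ((dataY D)ᵀ * dataY D)⁻¹

/-- `π̂`, the diagonal of `n⁻¹ Yᵀ Y`. -/
def pihat {n p L : ℕ} (D : Fin n → EuclideanSpace ℝ (Fin p) × Fin L) : Fin L → ℝ :=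
  ((1 / (n : ℝ)) • ((dataY D)ᵀ * dataY D)).diag

/-- `Ĥ = n⁻¹ (Yᵀ Y - B̂ᵀ Xᵀ X B̂)`. -/
def Hhat {n p L : ℕ} (D : Fin n → EuclideanSpace ℝ (Fin p) × Fin L)
    (Bh : Matrix (Fin p) (Fin L) ℝ) : Matrix (Fin L) (Fin L) ℝ :=
  (1 / (n : ℝ)) • ((dataY D)ᵀ * dataY D - Bhᵀ * (dataX D)ᵀ * dataX D * Bh)

/-- The estimated discriminant functions, with `B̂* = B̂ Ĥ⁺`. -/
def discrHat {n p L : ℕ} (D : Fin n → EuclideanSpace ℝ (Fin p) × Fin L)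
    (Bh : Matrix (Fin p) (Fin L) ℝ) : EuclideanSpace ℝ (Fin p) → Fin L → ℝ :=
  discr (Mhat D) (Bh * pinv (Hhat D Bh)) (pihat D)

/-- `gh` is a (jointly measurable) version of the classifier that uses reduced-rank regression with
tuning parameter `lam`: for training data `D` it minimises the estimated discriminant functions
built from some reduced-rank estimator. Minimisers are chosen arbitrarily when not unique. If some
class does not occur in `D`, the matrix `Yᵀ Y` is singular and `M̂`, `log π̂` do not exist; the value
of `gh D` is then left completely arbitrary. -/
def IsRRClassifier {n p L : ℕ} (lam : ℝ)
    (gh : (Fin n → EuclideanSpace ℝ (Fin p) × Fin L) → EuclideanSpace ℝ (Fin p) → Fin L) : Prop :=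
  Measurable (Function.uncurry gh) ∧
    ∀ D, (∀ l, ∃ i, (D i).2 = l) →
      ∃ Bh, IsReducedRank lam D Bh ∧ ∀ x l, discrHat D Bh x (gh D x) ≤ discrHat D Bh x l

end LDA

end

/-! Two facts produce the rate: the excess risk is quadratic in the errors of the discriminant
functions, and a rank oracle inequality for B carries over to the directions Σ_W⁻¹M.

Risk. Let h_l be the true discriminants and P_k the law of X in class k. By Cameron–Martin, w_l dP_l
= w_k exp(-(h_l - h_k)/2) dP_k, so the points where the Bayes rule says k and the classifier says l
cost w_k ∫ (1 - exp(-(h_l - h_k)/2)) dP_k. There h_l - h_k is nonnegative and at most the difference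
of the two estimation errors. That difference is an affine function of x, so under P_k it stays
below some t up to probability exp(-2T), with t² of order 1 + T times the squared errors. Class
separation bounds the variance of h_l - h_k from below, so h_l - h_k lies in [0, t] with probability
O(t), and the pair costs O(t²). Since w_k = O(1/L), the sum over pairs is O((1 + T) ∑ squared
errors) + L exp(-2T), which is `Regular.excessRisk_le`. The choice T = log n produces the second
logarithm.

Estimation. Put e² = (p + L) log n / n, f² = log n / n and r = rank B. Sample covariances deviate by
O(e) in operator norm. Moments involving a label deviate by a further factor 1/√L less, since a
class has probability O(1/L) (`Regular.measureReal_not_goodData_le`). By the normal equations the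
regression noise has operator norm O(e/√L). A penalty λ of order e²/L dominates its square, so ‖B̂ -
B‖_F = O(e√(r/L)) (`Regular.frob_error_le`). For H = diag(π) - BᵀΣB one has B = Σ_W⁻¹M H, and by
Woodbury H⁻¹ = diag(1/π) + MᵀΣ_W⁻¹M has norm O(L). As long as t = e√(rL) is small, Ĥ is invertible
too and the direction error is O(t) in Frobenius norm (`Regular.direction_error`). The intercepts
involve each class mean only along one fixed direction, up to a multiple of the direction error.
This costs f√L ≤ e per class, so the squares again sum to O(t²).

Conclusion. t² log n is the claimed rate. The bad event has probability at most 8/n, which is a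
multiple of the rate, and when the rate exceeds a constant the trivial bound 1 is enough
(`exists_risk_bound`). -/

noncomputable section

namespace LDA

/-! ### Linear algebra -/

section LinearAlgebra

attribute [local instance] Matrix.frobeniusNormedAddCommGroup Matrix.frobeniusNormedSpace

/-- The Euclidean norm of a coordinate vector. -/
abbrev l2 {d : ℕ} (v : Fin d → ℝ) : ℝ := ‖(WithLp.toLp 2 v : EuclideanSpace ℝ (Fin d))‖

theorem l2_sq {d : ℕ} (v : Fin d → ℝ) : l2 v ^ 2 = ∑ i, v i ^ 2 := by
  rw [EuclideanSpace.real_norm_sq_eq]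

theorem l2_sq_eq_dotProduct {d : ℕ} (v : Fin d → ℝ) : l2 v ^ 2 = v ⬝ᵥ v := by
  rw [l2_sq]; simp [dotProduct, sq]

theorem l2_nonneg {d : ℕ} (v : Fin d → ℝ) : 0 ≤ l2 v := norm_nonneg _

theorem l2_add_le {d : ℕ} (u v : Fin d → ℝ) : l2 (u + v) ≤ l2 u + l2 v := by
  simpa [l2] using norm_add_le (WithLp.toLp 2 u : EuclideanSpace ℝ (Fin d)) (WithLp.toLp 2 v)

theorem l2_sub_le {d : ℕ} (u v : Fin d → ℝ) : l2 (u - v) ≤ l2 u + l2 v := by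
  simpa [l2] using norm_sub_le (WithLp.toLp 2 u : EuclideanSpace ℝ (Fin d)) (WithLp.toLp 2 v)

theorem l2_smul {d : ℕ} (a : ℝ) (v : Fin d → ℝ) : l2 (a • v) = |a| * l2 v := by
  simp [l2, norm_smul]

theorem l2_eq_zero {d : ℕ} {v : Fin d → ℝ} (h : l2 v = 0) : v = 0 := by
  have := norm_eq_zero.mp h
  simpa using this

theorem inner_toLp {d : ℕ} (u v : Fin d → ℝ) :
    inner ℝ (WithLp.toLp 2 u : EuclideanSpace ℝ (Fin d)) (WithLp.toLp 2 v) = u ⬝ᵥ v := by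
  simp [PiLp.inner_apply, dotProduct, mul_comm]

theorem abs_dotProduct_le {d : ℕ} (u v : Fin d → ℝ) : |u ⬝ᵥ v| ≤ l2 u * l2 v := by
  rw [← inner_toLp]; exact abs_real_inner_le_norm _ _

theorem dotProduct_le {d : ℕ} (u v : Fin d → ℝ) : u ⬝ᵥ v ≤ l2 u * l2 v :=
  (le_abs_self _).trans (abs_dotProduct_le u v)

theorem frob_sq {a b : ℕ} (A : Matrix (Fin a) (Fin b) ℝ) : ‖A‖ ^ 2 = ∑ i, ∑ j, A i j ^ 2 := by
  rw [frobenius_norm_def, ← Real.sqrt_eq_rpow, Real.sq_sqrt]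
  · simp
  · positivity

theorem frob_sq_col {a b : ℕ} (A : Matrix (Fin a) (Fin b) ℝ) : ‖A‖ ^ 2 = ∑ j, l2 (A.col j) ^ 2 := by
  rw [frob_sq, Finset.sum_comm]
  simp [l2_sq, Matrix.col]

theorem frob_sq_row {a b : ℕ} (A : Matrix (Fin a) (Fin b) ℝ) : ‖A‖ ^ 2 = ∑ i, l2 (A.row i) ^ 2 := by
  rw [frob_sq]
  simp [l2_sq, Matrix.row]

theorem frob_le_of_col {a b : ℕ} (A : Matrix (Fin a) (Fin b) ℝ) {t : ℝ} (ht : 0 ≤ t)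
    (h : ∀ j, l2 (A.col j) ≤ t) : ‖A‖ ≤ Real.sqrt b * t := by
  refine le_of_sq_le_sq ?_ (by positivity)
  rw [frob_sq_col, mul_pow, Real.sq_sqrt (by positivity)]
  calc ∑ j, l2 (A.col j) ^ 2 ≤ ∑ _j : Fin b, t ^ 2 := by
        gcongr with j; exact h j
    _ = b * t ^ 2 := by simp

theorem l2_mulVec_le {a b : ℕ} (A : Matrix (Fin a) (Fin b) ℝ) (v : Fin b → ℝ) :
    l2 (A *ᵥ v) ≤ ‖A‖ * l2 v := by
  refine le_of_sq_le_sq ?_ (by positivity)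
  rw [mul_pow, l2_sq, frob_sq_row, Finset.sum_mul]
  gcongr with i
  have := abs_dotProduct_le (A.row i) v
  rw [← mul_pow, ← sq_abs]
  gcongr
  exact this

/-- The operator norm of `A` for the Euclidean norms is at most `t`. -/
structure OpBound {a b : ℕ} (A : Matrix (Fin a) (Fin b) ℝ) (t : ℝ) : Prop where
  nonneg : 0 ≤ t
  bilin : ∀ u v, |u ⬝ᵥ A *ᵥ v| ≤ t * l2 u * l2 v

theorem opBound_frob {a b : ℕ} (A : Matrix (Fin a) (Fin b) ℝ) : OpBound A ‖A‖ := by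
  refine ⟨norm_nonneg _, fun u v => ?_⟩
  refine (abs_dotProduct_le _ _).trans ?_
  rw [mul_comm ‖A‖, mul_assoc]
  gcongr
  exact LDA.l2_mulVec_le A v

theorem OpBound.add {a b : ℕ} {A B : Matrix (Fin a) (Fin b) ℝ} {s t : ℝ} (hA : OpBound A s)
    (hB : OpBound B t) : OpBound (A + B) (s + t) := by
  refine ⟨add_nonneg hA.nonneg hB.nonneg, fun u v => ?_⟩
  rw [add_mulVec, dotProduct_add]
  refine (abs_add_le _ _).trans ?_
  linarith [hA.bilin u v, hB.bilin u v]

theorem OpBound.neg {a b : ℕ} {A : Matrix (Fin a) (Fin b) ℝ} {s : ℝ} (hA : OpBound A s) :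
    OpBound (-A) s := by
  refine ⟨hA.nonneg, fun u v => ?_⟩
  rw [neg_mulVec, dotProduct_neg, abs_neg]
  exact hA.bilin u v

theorem OpBound.sub {a b : ℕ} {A B : Matrix (Fin a) (Fin b) ℝ} {s t : ℝ} (hA : OpBound A s)
    (hB : OpBound B t) : OpBound (A - B) (s + t) := by
  rw [sub_eq_add_neg]; exact hA.add hB.neg

theorem OpBound.mono {a b : ℕ} {A : Matrix (Fin a) (Fin b) ℝ} {s t : ℝ} (hA : OpBound A s)
    (h : s ≤ t) : OpBound A t :=
  ⟨hA.nonneg.trans h, fun u v => (hA.bilin u v).trans (by gcongr)⟩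

theorem OpBound.transpose {a b : ℕ} {A : Matrix (Fin a) (Fin b) ℝ} {s : ℝ} (hA : OpBound A s) :
    OpBound Aᵀ s := by
  refine ⟨hA.nonneg, fun u v => ?_⟩
  rw [dotProduct_mulVec, vecMul_transpose, dotProduct_comm]
  linarith [hA.bilin v u]

theorem OpBound.l2_mulVec_le {a b : ℕ} {A : Matrix (Fin a) (Fin b) ℝ} {t : ℝ} (hA : OpBound A t)
    (v : Fin b → ℝ) : l2 (A *ᵥ v) ≤ t * l2 v := by
  rcases (l2_nonneg (A *ᵥ v)).eq_or_lt with h | h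
  · rw [← h]; exact mul_nonneg hA.nonneg (l2_nonneg v)
  · have h1 := hA.bilin (A *ᵥ v) v
    rw [← l2_sq_eq_dotProduct, abs_of_nonneg (by positivity)] at h1
    nlinarith

theorem OpBound.mul {a b c : ℕ} {A : Matrix (Fin a) (Fin b) ℝ} {B : Matrix (Fin b) (Fin c) ℝ}
    {s t : ℝ} (hA : OpBound A s) (hB : OpBound B t) : OpBound (A * B) (s * t) := by
  refine ⟨mul_nonneg hA.nonneg hB.nonneg, fun u v => ?_⟩
  rw [← mulVec_mulVec]
  refine (hA.bilin _ _).trans ?_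
  have := mul_le_mul_of_nonneg_left (hB.l2_mulVec_le v) (mul_nonneg hA.nonneg (l2_nonneg u))
  linarith

theorem OpBound.frob_mul_le {a b c : ℕ} {A : Matrix (Fin a) (Fin b) ℝ} {t : ℝ} (hA : OpBound A t)
    (N : Matrix (Fin b) (Fin c) ℝ) : ‖A * N‖ ≤ t * ‖N‖ := by
  refine le_of_sq_le_sq ?_ (mul_nonneg hA.nonneg (norm_nonneg _))
  rw [mul_pow, frob_sq_col, frob_sq_col, Finset.mul_sum]
  gcongr with j
  rw [← mul_pow]
  gcongr
  exact hA.l2_mulVec_le (N.col j)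

theorem l2_mulVec_lower_frob {a b c : ℕ} {A : Matrix (Fin b) (Fin c) ℝ} {t : ℝ} (ht : 0 ≤ t)
    (h : ∀ v, t * l2 v ≤ l2 (A *ᵥ v)) (N : Matrix (Fin c) (Fin a) ℝ) : t * ‖N‖ ≤ ‖A * N‖ := by
  refine le_of_sq_le_sq ?_ (norm_nonneg _)
  rw [mul_pow, frob_sq_col, frob_sq_col, Finset.mul_sum]
  gcongr with j
  rw [← mul_pow]
  gcongr
  exact h (N.col j)

theorem rank_add_le {a b : ℕ} (A B : Matrix (Fin a) (Fin b) ℝ) :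
    (A + B).rank ≤ A.rank + B.rank := by
  unfold Matrix.rank
  rw [Matrix.mulVecLin_add]
  exact (Submodule.finrank_mono (LinearMap.range_add_le _ _)).trans
    (Submodule.finrank_add_le_finrank_add_finrank _ _)

theorem rank_neg {a b : ℕ} (A : Matrix (Fin a) (Fin b) ℝ) : (-A).rank = A.rank := by
  have h1 : ∀ A : Matrix (Fin a) (Fin b) ℝ, (-A).rank ≤ A.rank := fun A => by
    have := Matrix.rank_mul_le_left A (-1 : Matrix (Fin b) (Fin b) ℝ)
    simpa using this
  refine le_antisymm (h1 A) ?_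
  simpa using h1 (-A)

theorem rank_sub_le {a b : ℕ} (A B : Matrix (Fin a) (Fin b) ℝ) :
    (A - B).rank ≤ A.rank + B.rank := by
  rw [sub_eq_add_neg]
  exact (rank_add_le _ _).trans (by rw [rank_neg])

/-- Trace duality: `⟨A, D⟩ ≤ ‖A‖_op * √rank(D) * ‖D‖_F`. -/
theorem OpBound.sum_mul_le {a b : ℕ} {A D : Matrix (Fin a) (Fin b) ℝ} {t : ℝ} (hA : OpBound A t) :
    ∑ i, ∑ j, A i j * D i j ≤ t * Real.sqrt D.rank * ‖D‖ := by
  -- The columns of `D` are expanded in an orthonormal basis of its column space. Only `D.rank` unit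
  -- vectors `Q i` occur, each with |Aᵀ Q i| ≤ t, and Cauchy–Schwarz over the coefficients finishes.
  let E := EuclideanSpace ℝ (Fin a)
  let W : Submodule ℝ E := Submodule.span ℝ (Set.range fun j => (WithLp.toLp 2 (D.col j) : E))
  have hW : Module.finrank ℝ W = D.rank := by
    rw [Matrix.rank_eq_finrank_span_cols]
    have : W = (Submodule.span ℝ (Set.range D.col)).map
        (WithLp.linearEquiv 2 ℝ (Fin a → ℝ)).symm.toLinearMap := by
      rw [Submodule.map_span, ← Set.range_comp]
      rfl
    rw [this]
    exact LinearEquiv.finrank_map_eq _ _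
  let q := stdOrthonormalBasis ℝ W
  let d := fun j : Fin b => (⟨WithLp.toLp 2 (D.col j), Submodule.subset_span ⟨j, rfl⟩⟩ : W)
  let Q := fun i => ((q i : E)).ofLp
  have hexp : ∀ j, D.col j = ∑ i, (q.repr (d j) i) • Q i := by
    intro j
    have h := q.sum_repr (d j)
    have h2 := congrArg (fun w : W => (w : E).ofLp) h
    simp only [Submodule.coe_sum, Submodule.coe_smul] at h2
    refine h2.symm.trans ?_
    rw [WithLp.ofLp_sum]
    rfl
  have hQ : ∀ i, l2 (Q i) = 1 := fun i => by
    have : ‖q i‖ = 1 := q.orthonormal.1 i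
    exact this
  have hD : ‖D‖ ^ 2 = ∑ i, ∑ j, (q.repr (d j) i) ^ 2 := by
    rw [frob_sq_col, Finset.sum_comm]
    refine Finset.sum_congr rfl fun j _ => ?_
    have : l2 (D.col j) = ‖d j‖ := rfl
    rw [this, ← q.repr.norm_map (d j), EuclideanSpace.real_norm_sq_eq]
  have hA2 : ∑ i, ∑ j, (A.col j ⬝ᵥ Q i) ^ 2 ≤ t ^ 2 * D.rank := by
    calc ∑ i, ∑ j, (A.col j ⬝ᵥ Q i) ^ 2 = ∑ i, l2 (Aᵀ *ᵥ Q i) ^ 2 := by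
          refine Finset.sum_congr rfl fun i _ => ?_
          rw [l2_sq]; rfl
      _ ≤ ∑ _i : Fin (Module.finrank ℝ W), t ^ 2 := by
          gcongr with i
          have := hA.transpose.l2_mulVec_le (Q i)
          rwa [hQ, mul_one] at this
      _ = t ^ 2 * D.rank := by simp [hW, mul_comm]
  have hip : ∑ i, ∑ j, A i j * D i j = ∑ i, ∑ j, q.repr (d j) i * (A.col j ⬝ᵥ Q i) := by
    rw [Finset.sum_comm, Finset.sum_comm (s := Finset.univ (α := Fin (Module.finrank ℝ W)))]
    refine Finset.sum_congr rfl fun j _ => ?_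
    have : ∑ i, A i j * D i j = A.col j ⬝ᵥ D.col j := rfl
    rw [this, hexp j, dotProduct_sum]
    simp
  rw [hip]
  refine le_of_sq_le_sq ?_ (mul_nonneg (mul_nonneg hA.nonneg (Real.sqrt_nonneg _)) (norm_nonneg _))
  rw [mul_pow, mul_pow, Real.sq_sqrt (by positivity), hD]
  simp_rw [← Finset.sum_product'] at hA2 ⊢
  refine (Finset.sum_mul_sq_le_sq_mul_sq _ _ _).trans ?_
  rw [mul_comm]
  gcongr

theorem isUnit_of_lower {d : ℕ} {H : Matrix (Fin d) (Fin d) ℝ} {t : ℝ} (ht : 0 < t)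
    (h : ∀ v, t * l2 v ≤ l2 (H *ᵥ v)) : IsUnit H := by
  rw [← Matrix.mulVec_injective_iff_isUnit]
  intro u v huv
  have h1 := h (u - v)
  have : H *ᵥ (u - v) = 0 := by rw [mulVec_sub, sub_eq_zero]; exact huv
  rw [this] at h1
  have h0 : l2 (0 : Fin d → ℝ) = 0 := by simp [l2]
  have h2 : l2 (u - v) = 0 := by
    rw [h0] at h1
    have := l2_nonneg (u - v)
    nlinarith
  exact sub_eq_zero.mp (l2_eq_zero h2)

/-- On the good event Ĥ is invertible, and this is the only property of the pseudo-inverse that the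
argument uses. -/
theorem pinv_mul_self {d : ℕ} {H : Matrix (Fin d) (Fin d) ℝ} (hH : IsUnit H) : pinv H * H = 1 := by
  have h := (pinv_spec H).mul_mul_self
  rw [Matrix.mul_assoc] at h
  exact hH.mul_left_cancel (by rw [h, mul_one])

theorem mulVec_lower_of_quad {d : ℕ} {S : Matrix (Fin d) (Fin d) ℝ} {t : ℝ}
    (h : ∀ v, t * l2 v ^ 2 ≤ v ⬝ᵥ S *ᵥ v) (v : Fin d → ℝ) : t * l2 v ≤ l2 (S *ᵥ v) := by
  rcases (l2_nonneg v).eq_or_lt with h0 | h0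
  · rw [← h0]; simp
  · have h1 := (h v).trans (dotProduct_le _ _)
    nlinarith

/-- Cauchy–Schwarz for a positive semidefinite symmetric matrix. -/
theorem sq_dotProduct_mulVec_le {d : ℕ} {S : Matrix (Fin d) (Fin d) ℝ} (hs : Sᵀ = S)
    (hp : ∀ v, 0 ≤ v ⬝ᵥ S *ᵥ v) (u v : Fin d → ℝ) :
    (u ⬝ᵥ S *ᵥ v) ^ 2 ≤ (u ⬝ᵥ S *ᵥ u) * (v ⬝ᵥ S *ᵥ v) := by
  have hsym : v ⬝ᵥ S *ᵥ u = u ⬝ᵥ S *ᵥ v := by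
    rw [dotProduct_mulVec, ← mulVec_transpose, hs, dotProduct_comm]
  have key : ∀ x : ℝ, 0 ≤ (v ⬝ᵥ S *ᵥ v) * (x * x) + 2 * (u ⬝ᵥ S *ᵥ v) * x + u ⬝ᵥ S *ᵥ u := by
    intro x
    have := hp (u + x • v)
    simp only [mulVec_add, mulVec_smul, dotProduct_add, add_dotProduct, dotProduct_smul,
      smul_dotProduct, smul_eq_mul, hsym] at this
    linarith
  have := discrim_le_zero key
  rw [discrim] at this
  linarith

end LinearAlgebra

/-! ### Nets of the Euclidean ball -/

section Nets

attribute [local instance] Matrix.frobeniusNormedAddCommGroup Matrix.frobeniusNormedSpace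

/-- A finite `1/4`-net of the Euclidean unit ball. -/
theorem exists_net (n d : ℕ) (hn : 1 ≤ n) (hd : d ≤ n) :
    ∃ N : Finset (Fin d → ℝ), N.card ≤ (8 * n + 1) ^ d ∧ (∀ u ∈ N, l2 u ≤ 1) ∧
      ∀ u, l2 u ≤ 1 → ∃ u' ∈ N, l2 (u - u') ≤ 1 / 4 := by
  classical
  let h : ℝ := 1 / (4 * n)
  have hn0 : (1 : ℝ) ≤ n := by exact_mod_cast hn
  have hh : 0 < h := by positivity
  -- A grid of mesh 1/(4n) on [-1, 1]^d, the index `z i` standing for the integer `z i - 4n`. Such a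
  -- crude net costs d log n in the exponent, which the rate already contains.
  let pt : (Fin d → Fin (8 * n + 1)) → Fin d → ℝ := fun z i => (((z i : ℕ) : ℝ) - 4 * n) * h
  refine ⟨(Finset.univ.image pt).filter fun u => l2 u ≤ 1, ?_, ?_, ?_⟩
  · refine (Finset.card_filter_le _ _).trans (Finset.card_image_le.trans ?_)
    simp
  · intro u hu
    exact (Finset.mem_filter.mp hu).2
  · intro u hu
    have hcoord : ∀ i, |u i| ≤ 1 := by
      intro i
      have h1 : u i ^ 2 ≤ ∑ i, u i ^ 2 :=
        Finset.single_le_sum (f := fun i => u i ^ 2) (fun i _ => sq_nonneg _) (Finset.mem_univ i)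
      rw [← l2_sq] at h1
      have h2 : l2 u ^ 2 ≤ 1 := pow_le_one₀ (l2_nonneg u) hu
      exact abs_le_one_iff_mul_self_le_one.mpr (by nlinarith)
    -- Rounding towards zero does not increase the norm, so the rounded point stays in the ball.
    -- Since d ≤ n, the total error √d/(4n) is at most 1/4.
    have hround : ∀ x : ℝ, |x| ≤ 1 → ∃ k : Fin (8 * n + 1),
        |(((k : ℕ) : ℝ) - 4 * n) * h| ≤ |x| ∧ |x - (((k : ℕ) : ℝ) - 4 * n) * h| ≤ h := by
      intro x hx
      obtain ⟨m, hm1, hm2⟩ : ∃ m : ℕ, (m : ℝ) * h ≤ |x| ∧ |x| ≤ (m + 1) * h := by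
        refine ⟨⌊|x| / h⌋₊, ?_, ?_⟩
        · rw [← le_div_iff₀ hh]; exact Nat.floor_le (by positivity)
        · rw [← div_le_iff₀ hh]; exact (Nat.lt_floor_add_one _).le
      have hm : m ≤ 4 * n := by
        have h1 : (m : ℝ) * h ≤ 1 := hm1.trans hx
        have h2 : (m : ℝ) ≤ 4 * n := by
          rw [← le_div_iff₀ hh] at h1
          simpa [h] using h1
        exact_mod_cast h2
      rcases le_total 0 x with h0 | h0
      · refine ⟨⟨4 * n + m, by omega⟩, ?_, ?_⟩
        · push_cast
          rw [add_sub_cancel_left, abs_of_nonneg (by positivity)]; exact hm1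
        · push_cast
          rw [abs_of_nonneg h0] at hm1 hm2
          rw [add_sub_cancel_left, abs_le]
          constructor <;> linarith
      · refine ⟨⟨4 * n - m, by omega⟩, ?_, ?_⟩
        · rw [Nat.cast_sub hm]
          push_cast
          rw [sub_sub_cancel_left, neg_mul, abs_neg, abs_of_nonneg (by positivity)]; exact hm1
        · rw [Nat.cast_sub hm]
          push_cast
          rw [abs_of_nonpos h0] at hm1 hm2
          rw [sub_sub_cancel_left, abs_le]
          constructor <;> linarith
    choose k hk1 hk2 using fun i => hround (u i) (hcoord i)
    refine ⟨pt k, Finset.mem_filter.mpr ⟨Finset.mem_image_of_mem _ (Finset.mem_univ _), ?_⟩, ?_⟩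
    · refine le_trans (le_of_sq_le_sq ?_ (l2_nonneg u)) hu
      rw [l2_sq, l2_sq]
      exact Finset.sum_le_sum fun i _ => sq_le_sq.mpr (hk1 i)
    · refine le_of_sq_le_sq ?_ (by norm_num)
      rw [l2_sq]
      calc ∑ i, (u - pt k) i ^ 2 ≤ ∑ _i : Fin d, h ^ 2 := by
            exact Finset.sum_le_sum fun i _ => sq_le_sq.mpr ((hk2 i).trans (le_abs_self h))
        _ = d * h ^ 2 := by simp
        _ ≤ n * h ^ 2 := by gcongr
        _ = 1 / (16 * n) := by simp only [h]; field_simp; norm_num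
        _ ≤ (1 / 4) ^ 2 := by
            rw [div_le_iff₀ (by positivity)]; nlinarith

theorem OpBound.of_forall_unit {a b : ℕ} {A : Matrix (Fin a) (Fin b) ℝ} {t : ℝ} (ht : 0 ≤ t)
    (h : ∀ u v, l2 u ≤ 1 → l2 v ≤ 1 → |u ⬝ᵥ A *ᵥ v| ≤ t) : OpBound A t := by
  refine ⟨ht, fun u v => ?_⟩
  rcases (l2_nonneg u).eq_or_lt with hu | hu
  · rw [l2_eq_zero hu.symm]; simp [l2]
  rcases (l2_nonneg v).eq_or_lt with hv | hv
  · rw [l2_eq_zero hv.symm]; simp [l2]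
  have h1 := h ((l2 u)⁻¹ • u) ((l2 v)⁻¹ • v)
    (by rw [l2_smul, abs_of_pos (by positivity), inv_mul_cancel₀ hu.ne'])
    (by rw [l2_smul, abs_of_pos (by positivity), inv_mul_cancel₀ hv.ne'])
  rw [mulVec_smul, dotProduct_smul, smul_dotProduct, smul_eq_mul, smul_eq_mul, abs_mul, abs_mul,
    abs_of_pos (inv_pos.mpr hu), abs_of_pos (inv_pos.mpr hv)] at h1
  rw [mul_assoc, mul_comm (l2 u), ← mul_assoc]
  rw [← mul_assoc, ← mul_inv, inv_mul_le_iff₀ (by positivity)] at h1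
  linarith

/-- An operator norm bound needs to be checked on `1/4`-nets only, at the price of a factor `2`. -/
theorem OpBound.of_net {a b : ℕ} {A : Matrix (Fin a) (Fin b) ℝ} {t : ℝ} (ht : 0 ≤ t)
    (Na : Set (Fin a → ℝ)) (Nb : Set (Fin b → ℝ)) (hNa : ∀ u ∈ Na, l2 u ≤ 1)
    (hna : ∀ u, l2 u ≤ 1 → ∃ u' ∈ Na, l2 (u - u') ≤ 1 / 4)
    (hnb : ∀ u, l2 u ≤ 1 → ∃ u' ∈ Nb, l2 (u - u') ≤ 1 / 4)
    (h : ∀ u ∈ Na, ∀ v ∈ Nb, |u ⬝ᵥ A *ᵥ v| ≤ t) : OpBound A (2 * t) := by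
  -- Moving `u` and `v` to net points costs s/4 each. The map s ↦ t + s/2 has fixed point 2t, which
  -- is reached by iteration from the Frobenius norm.
  have step : ∀ s, OpBound A s → OpBound A (t + s / 2) := by
    intro s hs
    refine OpBound.of_forall_unit (by linarith [hs.nonneg]) fun u v hu hv => ?_
    obtain ⟨u', hu', huu⟩ := hna u hu
    obtain ⟨v', hv', hvv⟩ := hnb v hv
    have e : u ⬝ᵥ A *ᵥ v = u' ⬝ᵥ A *ᵥ v' + (u - u') ⬝ᵥ A *ᵥ v + u' ⬝ᵥ A *ᵥ (v - v') := by
      rw [mulVec_sub, dotProduct_sub, sub_dotProduct]; ring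
    have h1 := hs.bilin (u - u') v
    have h2 := hs.bilin u' (v - v')
    have h3 : s * l2 (u - u') * l2 v ≤ s * (1 / 4) * 1 := by
      have := hs.nonneg
      gcongr
    have h4 : s * l2 u' * l2 (v - v') ≤ s * 1 * (1 / 4) := by
      have := hs.nonneg
      have := hNa u' hu'
      gcongr
    rw [e]
    refine (abs_add_le _ _).trans ?_
    have := abs_add_le (u' ⬝ᵥ A *ᵥ v') ((u - u') ⬝ᵥ A *ᵥ v)
    have := h u' hu' v' hv'
    linarith
  have iter : ∀ k : ℕ, OpBound A (2 * t + ‖A‖ / 2 ^ k) := by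
    intro k
    induction k with
    | zero => exact (opBound_frob A).mono (by simp; linarith)
    | succ k ih => exact (step _ ih).mono (by rw [pow_succ]; apply le_of_eq; field_simp; ring)
  refine ⟨by linarith, fun u v => ?_⟩
  have hlim : Filter.Tendsto (fun k : ℕ => (2 * t + ‖A‖ / 2 ^ k) * l2 u * l2 v) Filter.atTop
      (nhds ((2 * t + 0) * l2 u * l2 v)) := by
    refine ((tendsto_const_nhds.add ?_).mul_const _).mul_const _
    have := (tendsto_pow_atTop_nhds_zero_of_lt_one (r := (1 / 2 : ℝ)) (by norm_num)
      (by norm_num)).const_mul ‖A‖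
    simpa [div_eq_mul_inv] using this
  rw [add_zero] at hlim
  exact ge_of_tendsto' hlim fun k => (iter k).bilin u v

end Nets

/-! ### Bernstein's inequality -/

section Concentration

/-- The second-order Taylor remainder of exp, in a form that is symmetric in the sign of x and so
serves both tails. -/
theorem exp_le_one_add_add_sq (x : ℝ) : Real.exp x ≤ 1 + x + x ^ 2 * Real.exp |x| := by
  have h := Complex.norm_exp_sub_sum_le_norm_mul_exp (x : ℂ) 2
  simp only [Finset.sum_range_succ, Finset.sum_range_zero, zero_add, pow_zero, pow_one,
    Nat.factorial, Nat.cast_one, div_one, mul_one, Nat.succ_eq_add_one] at h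
  rw [← Complex.ofReal_exp, ← Complex.ofReal_one, ← Complex.ofReal_add, ← Complex.ofReal_sub,
    Complex.norm_real, Complex.norm_real, Real.norm_eq_abs, Real.norm_eq_abs, sq_abs] at h
  linarith [(abs_le.mp h).2]

section Bernstein

variable {Ω : Type*} [MeasurableSpace Ω] {P : Measure Ω} {f : Ω → ℝ} {s₀ v : ℝ}

theorem integrable_of_exp_moment [IsProbabilityMeasure P] (hf : Measurable f) (hs : 0 ≤ s₀)
    (hi : Integrable (fun z => f z ^ 2 * Real.exp (s₀ * |f z|)) P) : Integrable f P := by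
  refine ((integrable_const (1 : ℝ)).add hi).mono' hf.aestronglyMeasurable (.of_forall fun z => ?_)
  have h1 : 1 ≤ Real.exp (s₀ * |f z|) := Real.one_le_exp (by positivity)
  have h2 : f z ^ 2 ≤ f z ^ 2 * Real.exp (s₀ * |f z|) := le_mul_of_one_le_right (sq_nonneg _) h1
  simp only [Pi.add_apply, Real.norm_eq_abs]
  rw [← sq_abs] at h2 ⊢
  nlinarith [sq_nonneg (|f z| - 1), abs_nonneg (f z)]

theorem exp_mul_le {s y : ℝ} (hs : |s| ≤ s₀) :
    Real.exp (s * y) ≤ 1 + s * y + s ^ 2 * (y ^ 2 * Real.exp (s₀ * |y|)) := by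
  refine (exp_le_one_add_add_sq _).trans ?_
  rw [mul_pow, mul_assoc, abs_mul]
  gcongr

theorem integrable_exp_mul [IsProbabilityMeasure P] (hf : Measurable f)
    (hi : Integrable (fun z => f z ^ 2 * Real.exp (s₀ * |f z|)) P) {s : ℝ} (hs : |s| ≤ s₀) :
    Integrable (fun z => Real.exp (s * f z)) P := by
  have hint := integrable_of_exp_moment hf ((abs_nonneg s).trans hs) hi
  refine (((integrable_const (1 : ℝ)).add (hint.const_mul s)).add (hi.const_mul (s ^ 2))).mono'
    (by fun_prop) (.of_forall fun z => ?_)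
  rw [Real.norm_eq_abs, Real.abs_exp]
  exact exp_mul_le hs

/-- A single tilted second moment E f² exp(s₀|f|) ≤ v controls the Taylor remainder for all |s| ≤
s₀, and 1 + y ≤ exp y turns this into a bound on the moment generating function. -/
theorem integral_exp_mul_le [IsProbabilityMeasure P] (hf : Measurable f)
    (hi : Integrable (fun z => f z ^ 2 * Real.exp (s₀ * |f z|)) P)
    (hv : ∫ z, f z ^ 2 * Real.exp (s₀ * |f z|) ∂P ≤ v) {s : ℝ} (hs : |s| ≤ s₀) :
    ∫ z, Real.exp (s * f z) ∂P ≤ Real.exp (s * ∫ z, f z ∂P + s ^ 2 * v) := by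
  have hint := integrable_of_exp_moment hf ((abs_nonneg s).trans hs) hi
  calc ∫ z, Real.exp (s * f z) ∂P
      ≤ ∫ z, (1 + s * f z + s ^ 2 * (f z ^ 2 * Real.exp (s₀ * |f z|))) ∂P := by
        refine integral_mono (integrable_exp_mul hf hi hs)
          (((integrable_const (1 : ℝ)).add (hint.const_mul s)).add (hi.const_mul (s ^ 2)))
          fun z => exp_mul_le hs
    _ = 1 + s * ∫ z, f z ∂P + s ^ 2 * ∫ z, f z ^ 2 * Real.exp (s₀ * |f z|) ∂P := by
        have e1 := integral_add ((integrable_const (μ := P) (1 : ℝ)).add (hint.const_mul s))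
          (hi.const_mul (s ^ 2))
        have e2 := integral_add (integrable_const (μ := P) (1 : ℝ)) (hint.const_mul s)
        simp only [Pi.add_apply, integral_const_mul, integral_const, probReal_univ,
          one_smul] at e1 e2
        rw [e1, e2]
    _ ≤ 1 + (s * ∫ z, f z ∂P + s ^ 2 * v) := by
        nlinarith [mul_le_mul_of_nonneg_left hv (sq_nonneg s)]
    _ ≤ _ := by rw [add_comm]; exact Real.add_one_le_exp _

/-- Chernoff's bound for the product measure. The parameter `s` stays free, to be taken proportional
to the deviation when the bound is applied. -/
theorem upper_tail_avg_le [IsProbabilityMeasure P] (n : ℕ) (hn : 0 < n) (hf : Measurable f)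
    (hi : Integrable (fun z => f z ^ 2 * Real.exp (s₀ * |f z|)) P)
    (hv : ∫ z, f z ^ 2 * Real.exp (s₀ * |f z|) ∂P ≤ v) {s : ℝ} (hs0 : 0 ≤ s) (hs : s ≤ s₀)
    (t : ℝ) :
    (Measure.pi fun _ : Fin n => P).real {D | t ≤ (1 / n) * ∑ i, f (D i) - ∫ z, f z ∂P} ≤
      Real.exp (-(n * (s * t - s ^ 2 * v))) := by
  have hs' : |s| ≤ s₀ := by rwa [abs_of_nonneg hs0]
  have hn' : (0 : ℝ) < n := by exact_mod_cast hn
  have hprod : ∀ D : Fin n → Ω, Real.exp (s * ∑ i, f (D i)) = ∏ i, Real.exp (s * f (D i)) := by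
    intro D; rw [Finset.mul_sum, Real.exp_sum]
  have hset : {D : Fin n → Ω | t ≤ (1 / n) * ∑ i, f (D i) - ∫ z, f z ∂P} =
      {D | n * (t + ∫ z, f z ∂P) ≤ ∑ i, f (D i)} := by
    ext D
    simp only [Set.mem_ofPred_eq]
    rw [le_sub_iff_add_le, one_div, ← div_eq_inv_mul, le_div_iff₀ hn', mul_comm]
  rw [hset]
  refine (measure_ge_le_exp_mul_mgf (X := fun D : Fin n → Ω => ∑ i, f (D i)) _ hs0 ?_).trans ?_
  · simp_rw [hprod]
    exact Integrable.fintype_prod (fun i => integrable_exp_mul hf hi hs')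
  · have hm : mgf (fun D : Fin n → Ω => ∑ i, f (D i)) (Measure.pi fun _ : Fin n => P) s =
        (∫ z, Real.exp (s * f z) ∂P) ^ n := by
      simp_rw [mgf, hprod]
      rw [integral_fintype_prod_eq_pow (ι := Fin n) (fun z => Real.exp (s * f z)),
        Fintype.card_fin]
    rw [hm]
    calc _ ≤ Real.exp (-s * (n * (t + ∫ z, f z ∂P))) *
          (Real.exp (s * ∫ z, f z ∂P + s ^ 2 * v)) ^ n := by
          have h0 : 0 ≤ ∫ z, Real.exp (s * f z) ∂P :=
            integral_nonneg_of_ae (.of_forall fun z => (Real.exp_pos _).le)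
          have := integral_exp_mul_le hf hi hv hs'
          gcongr
      _ = _ := by
          rw [← Real.exp_nat_mul, ← Real.exp_add]
          congr 1; ring

/-- Bernstein's inequality for the average of `n` independent copies of `f`. -/
theorem tail_avg_le [IsProbabilityMeasure P] (n : ℕ) (hn : 0 < n) (hf : Measurable f)
    (hi : Integrable (fun z => f z ^ 2 * Real.exp (s₀ * |f z|)) P)
    (hv : ∫ z, f z ^ 2 * Real.exp (s₀ * |f z|) ∂P ≤ v) {s : ℝ} (hs0 : 0 ≤ s) (hs : s ≤ s₀)
    (t : ℝ) :
    (Measure.pi fun _ : Fin n => P).real {D | t ≤ |(1 / n) * ∑ i, f (D i) - ∫ z, f z ∂P|} ≤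
      2 * Real.exp (-(n * (s * t - s ^ 2 * v))) := by
  have h1 := upper_tail_avg_le n hn hf hi hv hs0 hs t
  have h2 := upper_tail_avg_le (f := fun z => - f z) n hn hf.neg (by simpa using hi)
    (by simpa using hv) hs0 hs t
  have hsub : {D : Fin n → Ω | t ≤ |(1 / n) * ∑ i, f (D i) - ∫ z, f z ∂P|} ⊆
      {D | t ≤ (1 / n) * ∑ i, f (D i) - ∫ z, f z ∂P} ∪
      {D | t ≤ (1 / n) * ∑ i, - f (D i) - ∫ z, - f z ∂P} := by
    intro D hD
    rcases le_abs.mp (Set.mem_ofPred_eq ▸ hD) with h | h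
    · exact Or.inl h
    · right
      simp only [Set.mem_ofPred_eq, Finset.sum_neg_distrib, integral_neg]
      linarith
  refine (measureReal_mono hsub (measure_ne_top _ _)).trans ((measureReal_union_le _ _).trans ?_)
  linarith

end Bernstein

end Concentration

/-! ### Gaussian measures -/

section GaussianMeasures

/-! ### Estimates for one-dimensional Gaussians. -/

section Real

theorem integrable_exp_sq_stdGaussian :
    Integrable (fun x => Real.exp (x ^ 2 / 4)) (gaussianReal 0 1) := by
  rw [gaussianReal_of_var_ne_zero _ one_ne_zero,
    integrable_withDensity_iff (measurable_gaussianPDF _ _) (.of_forall fun _ => gaussianPDF_lt_top)]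
  have h := (integrable_exp_neg_mul_sq (b := 1 / 4) (by norm_num)).const_mul (√(2 * Real.pi))⁻¹
  refine h.congr (.of_forall fun x => ?_)
  simp only [toReal_gaussianPDF, gaussianPDFReal, NNReal.coe_one, mul_one, sub_zero]
  rw [mul_left_comm, ← Real.exp_add]
  congr 2; ring

theorem integral_exp_sq_stdGaussian :
    ∫ x, Real.exp (x ^ 2 / 4) ∂(gaussianReal 0 1) ≤ 2 := by
  rw [integral_gaussianReal_eq_integral_smul one_ne_zero]
  have h : ∀ x : ℝ, gaussianPDFReal 0 1 x • Real.exp (x ^ 2 / 4) =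
      (√(2 * Real.pi))⁻¹ * Real.exp (-(1 / 4) * x ^ 2) := by
    intro x
    simp only [gaussianPDFReal, NNReal.coe_one, mul_one, sub_zero, smul_eq_mul]
    rw [mul_assoc, ← Real.exp_add]
    congr 2; ring
  simp_rw [h]
  rw [integral_const_mul, integral_gaussian, ← Real.sqrt_inv, ← Real.sqrt_mul (by positivity),
    Real.sqrt_le_left (by norm_num)]
  have := Real.pi_pos
  field_simp
  norm_num

theorem gaussianReal_eq_map (m : ℝ) (v : NNReal) :
    gaussianReal m v = (gaussianReal 0 1).map (fun x => m + √(v : ℝ) * x) := by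
  have : (fun x => m + √(v : ℝ) * x) = (fun y => m + y) ∘ fun x => √(v : ℝ) * x := rfl
  rw [this, ← Measure.map_map (by fun_prop) (by fun_prop), gaussianReal_map_const_mul,
    gaussianReal_map_const_add]
  congr 1
  · simp
  · ext; simp

/-- From (m + √v x)² ≤ 2m² + 2vx², the hypotheses bound the exponent by 1 + x²/4 with x standard
normal, and 2 exp(1) ≤ 6. -/
theorem exp_sq_gaussianReal {m : ℝ} {v : NNReal} {s : ℝ} (hs : 0 ≤ s) (hm : 2 * s * m ^ 2 ≤ 1)
    (hv : 8 * s * v ≤ 1) :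
    Integrable (fun x => Real.exp (s * x ^ 2)) (gaussianReal m v) ∧
      ∫ x, Real.exp (s * x ^ 2) ∂(gaussianReal m v) ≤ 6 := by
  have hle : ∀ x : ℝ, Real.exp (s * (m + √(v : ℝ) * x) ^ 2) ≤
      Real.exp 1 * Real.exp (x ^ 2 / 4) := by
    intro x
    rw [← Real.exp_add, Real.exp_le_exp]
    have h1 : (m + √(v : ℝ) * x) ^ 2 ≤ 2 * m ^ 2 + 2 * v * x ^ 2 := by
      have := sq_nonneg (m - √(v : ℝ) * x)
      have h2 : (√(v : ℝ) * x) ^ 2 = v * x ^ 2 := by rw [mul_pow, Real.sq_sqrt v.coe_nonneg]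
      nlinarith
    have h3 := mul_le_mul_of_nonneg_left h1 hs
    nlinarith [sq_nonneg x, mul_le_mul_of_nonneg_right hv (sq_nonneg x)]
  have hI : Integrable (fun x => Real.exp (s * (m + √(v : ℝ) * x) ^ 2)) (gaussianReal 0 1) := by
    refine (integrable_exp_sq_stdGaussian.const_mul (Real.exp 1)).mono' (by fun_prop)
      (.of_forall fun x => ?_)
    rw [Real.norm_eq_abs, Real.abs_exp]; exact hle x
  rw [gaussianReal_eq_map, integrable_map_measure (by fun_prop) (by fun_prop),
    integral_map (by fun_prop) (by fun_prop)]
  refine ⟨hI, (integral_mono hI (integrable_exp_sq_stdGaussian.const_mul (Real.exp 1)) hle).trans ?_⟩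
  rw [integral_const_mul]
  have h1 := Real.exp_one_lt_d9
  have h2 := integral_exp_sq_stdGaussian
  have h3 := Real.exp_pos 1
  nlinarith

/-- The density never exceeds 1/√κ. Applied to a difference of two discriminants, this is the margin
condition. -/
theorem gaussianReal_Icc_le {m : ℝ} {v : NNReal} {κ t : ℝ} (hκ : 0 < κ) (hv : κ ≤ v) (ht : 0 ≤ t) :
    (gaussianReal m v).real (Set.Icc 0 t) ≤ t / √κ := by
  have hv0 : v ≠ 0 := by
    rintro rfl
    exact absurd hv (not_le.mpr (by simpa using hκ))
  rw [measureReal_def, gaussianReal_apply_eq_integral _ hv0, ENNReal.toReal_ofReal]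
  · have hle : ∀ x, gaussianPDFReal m v x ≤ 1 / √κ := by
      intro x
      rw [gaussianPDFReal, one_div]
      refine (mul_le_of_le_one_right (by positivity) ?_).trans ?_
      · rw [Real.exp_le_one_iff]
        rw [neg_div]
        exact neg_nonpos.mpr (by positivity)
      · gcongr
        nlinarith [Real.pi_gt_three, hκ]
    calc ∫ x in Set.Icc 0 t, gaussianPDFReal m v x ≤ ∫ _x in Set.Icc 0 t, 1 / √κ := by
          refine integral_mono (integrable_gaussianPDFReal m v).integrableOn ?_ hle
          exact integrable_const _
      _ = t / √κ := by
          simp [ht]; ring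
  · exact integral_nonneg fun x => gaussianPDFReal_nonneg m v x

/-- Chernoff's bound with parameter t/ρ. Counting the threshold from |m| makes the bound uniform in
the sign of the mean. -/
theorem gaussianReal_tail_le {m : ℝ} {v : NNReal} {ρ t : ℝ} (hρ : 0 < ρ) (hv : v ≤ ρ)
    (ht : 0 ≤ t) :
    (gaussianReal m v).real {x | |m| + t ≤ x} ≤ Real.exp (-(t ^ 2 / (2 * ρ))) := by
  refine (measure_ge_le_exp_mul_mgf (X := id) (|m| + t) (t := t / ρ) (by positivity)
    (integrable_exp_mul_gaussianReal _)).trans ?_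
  rw [mgf_id_gaussianReal, ← Real.exp_add, Real.exp_le_exp]
  have h1 : m * (t / ρ) ≤ |m| * (t / ρ) := by gcongr; exact le_abs_self m
  have h2 : v * (t / ρ) ^ 2 / 2 ≤ ρ * (t / ρ) ^ 2 / 2 := by gcongr
  have h3 : ρ * (t / ρ) ^ 2 / 2 = t ^ 2 / (2 * ρ) := by field_simp
  have h4 : t / ρ * t = 2 * (t ^ 2 / (2 * ρ)) := by field_simp
  nlinarith

end Real

/-! ### Linear functionals and tilts of multivariate Gaussians. -/

section Multivariate

variable {p : ℕ} {m : EuclideanSpace ℝ (Fin p)} {S : Matrix (Fin p) (Fin p) ℝ}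

theorem measurable_dotProduct (u : Fin p → ℝ) :
    Measurable fun x : EuclideanSpace ℝ (Fin p) => x.ofLp ⬝ᵥ u := by
  unfold dotProduct; fun_prop

/-- Linear functionals reduce every later tail, density and moment estimate to the one-dimensional
case. -/
theorem map_dotProduct (hS : S.PosSemidef) (u : Fin p → ℝ) :
    (multivariateGaussian m S).map (fun x => x.ofLp ⬝ᵥ u) =
      gaussianReal (m.ofLp ⬝ᵥ u) (u ⬝ᵥ S *ᵥ u).toNNReal := by
  have hu : (fun x : EuclideanSpace ℝ (Fin p) => x.ofLp ⬝ᵥ u) =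
      innerSL ℝ (WithLp.toLp 2 u : EuclideanSpace ℝ (Fin p)) := by
    ext x
    simp only [innerSL_apply_apply]
    exact (dotProduct_comm _ _).trans (inner_toLp u x.ofLp).symm
  have hI : (multivariateGaussian m S)[innerSL ℝ (WithLp.toLp 2 u : EuclideanSpace ℝ (Fin p))] =
      m.ofLp ⬝ᵥ u := by
    rw [ContinuousLinearMap.integral_comp_id_comm IsGaussian.integrable_id,
      integral_id_multivariateGaussian]
    exact (congrFun hu m).symm
  have hV : Var[innerSL ℝ (WithLp.toLp 2 u : EuclideanSpace ℝ (Fin p)); multivariateGaussian m S] =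
      u ⬝ᵥ S *ᵥ u := by
    rw [← covariance_self (by fun_prop)]
    have := covarianceBilin_apply_eq_cov (μ := multivariateGaussian m S) IsGaussian.memLp_two_id
      (WithLp.toLp 2 u) (WithLp.toLp 2 u)
    rw [covarianceBilin_multivariateGaussian hS] at this
    exact this.symm
  rw [hu, IsGaussian.map_eq_gaussianReal, hI, hV]

theorem integrable_exp_dotProduct (hS : S.PosSemidef) (u : Fin p → ℝ) :
    Integrable (fun x => Real.exp (x.ofLp ⬝ᵥ u)) (multivariateGaussian m S) := by
  have := integrable_exp_mul_gaussianReal (μ := m.ofLp ⬝ᵥ u) (v := (u ⬝ᵥ S *ᵥ u).toNNReal) 1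
  rw [← map_dotProduct hS, integrable_map_measure (by fun_prop)
    (measurable_dotProduct u).aemeasurable] at this
  simpa [Function.comp_def] using this

theorem integral_exp_dotProduct (hS : S.PosSemidef) (u : Fin p → ℝ) :
    ∫ x, Real.exp (x.ofLp ⬝ᵥ u) ∂(multivariateGaussian m S) =
      Real.exp (m.ofLp ⬝ᵥ u + u ⬝ᵥ S *ᵥ u / 2) := by
  have := congrFun (mgf_id_gaussianReal (μ := m.ofLp ⬝ᵥ u) (v := (u ⬝ᵥ S *ᵥ u).toNNReal)) 1
  rw [mgf, ← map_dotProduct hS, integral_map (measurable_dotProduct u).aemeasurable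
    (by fun_prop)] at this
  have h0 : 0 ≤ u ⬝ᵥ S *ᵥ u := by simpa using hS.dotProduct_mulVec_nonneg u
  simpa [Real.coe_toNNReal _ h0] using this

theorem exp_sq_dotProduct (hS : S.PosSemidef) {u : Fin p → ℝ} {s : ℝ} (hs : 0 ≤ s)
    (hm : 2 * s * (m.ofLp ⬝ᵥ u) ^ 2 ≤ 1) (hv : 8 * s * (u ⬝ᵥ S *ᵥ u) ≤ 1) :
    Integrable (fun x => Real.exp (s * (x.ofLp ⬝ᵥ u) ^ 2)) (multivariateGaussian m S) ∧
      ∫ x, Real.exp (s * (x.ofLp ⬝ᵥ u) ^ 2) ∂(multivariateGaussian m S) ≤ 6 := by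
  have h0 : 0 ≤ u ⬝ᵥ S *ᵥ u := by simpa using hS.dotProduct_mulVec_nonneg u
  have := exp_sq_gaussianReal (m := m.ofLp ⬝ᵥ u) (v := (u ⬝ᵥ S *ᵥ u).toNNReal) hs hm
    (by rwa [Real.coe_toNNReal _ h0])
  rwa [← map_dotProduct hS, integrable_map_measure (by fun_prop)
    (measurable_dotProduct u).aemeasurable, integral_map (measurable_dotProduct u).aemeasurable
    (by fun_prop)] at this

/-- The Cameron–Martin formula: shifting the mean by `S u` is an exponential tilt. -/
theorem multivariateGaussian_tilted (hS : S.PosSemidef) (u : Fin p → ℝ) :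
    (multivariateGaussian m S).tilted (fun x => x.ofLp ⬝ᵥ u) =
      multivariateGaussian (m + WithLp.toLp 2 (S *ᵥ u)) S := by
  have hint := integrable_exp_dotProduct (m := m) hS u
  have : IsProbabilityMeasure ((multivariateGaussian m S).tilted (fun x => x.ofLp ⬝ᵥ u)) :=
    isProbabilityMeasure_tilted hint
  have hsym : Sᵀ = S := by
    have := hS.isHermitian
    rwa [Matrix.IsHermitian, conjTranspose_eq_transpose_of_trivial] at this
  refine Measure.ext_of_charFun ?_
  ext b'
  let b : Fin p → ℝ := b'.ofLp
  -- Along each direction `b` the two laws have the same moment generating function. It is finite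
  -- everywhere, so analytic continuation to the imaginary unit identifies the characteristic
  -- functions.
  have hmgf : mgf (fun x => x.ofLp ⬝ᵥ b) (multivariateGaussian (m + WithLp.toLp 2 (S *ᵥ u)) S) =
      mgf (fun x => x.ofLp ⬝ᵥ b) ((multivariateGaussian m S).tilted fun x => x.ofLp ⬝ᵥ u) := by
    symm
    ext t
    have e1 : ∀ x : EuclideanSpace ℝ (Fin p), t * (x.ofLp ⬝ᵥ b) = x.ofLp ⬝ᵥ (t • b) := by
      intro x; rw [dotProduct_smul, smul_eq_mul]
    simp only [mgf, e1]
    rw [integral_exp_tilted, integral_exp_dotProduct hS, integral_exp_dotProduct hS]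
    have e2 : ∀ x : EuclideanSpace ℝ (Fin p), ((fun x : EuclideanSpace ℝ (Fin p) => x.ofLp ⬝ᵥ u) +
        fun x : EuclideanSpace ℝ (Fin p) => x.ofLp ⬝ᵥ (t • b)) x = x.ofLp ⬝ᵥ (u + t • b) := by
      intro x; simp [dotProduct_add]
    simp only [e2]
    rw [integral_exp_dotProduct hS, ← Real.exp_sub]
    congr 1
    have e3 : u ⬝ᵥ S *ᵥ b = b ⬝ᵥ S *ᵥ u := by
      rw [dotProduct_mulVec, ← mulVec_transpose, hsym, dotProduct_comm]
    simp only [WithLp.ofLp_add, mulVec_add, mulVec_smul, dotProduct_add, add_dotProduct,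
      dotProduct_smul, smul_dotProduct, smul_eq_mul, e3]
    rw [dotProduct_comm (S *ᵥ u) b]
    ring
  have huniv : integrableExpSet (fun x : EuclideanSpace ℝ (Fin p) => x.ofLp ⬝ᵥ b)
      (multivariateGaussian (m + WithLp.toLp 2 (S *ᵥ u)) S) = Set.univ := by
    ext t
    simp only [integrableExpSet, Set.mem_ofPred_eq, Set.mem_univ, iff_true]
    simpa [dotProduct_smul] using integrable_exp_dotProduct
      (m := m + WithLp.toLp 2 (S *ᵥ u)) hS (t • b)
  have h := eqOn_complexMGF_of_mgf hmgf (x := Complex.I) (by simp [huniv])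
  have e : ∀ x : EuclideanSpace ℝ (Fin p), (inner ℝ x b' : ℝ) = x.ofLp ⬝ᵥ b := fun x =>
    inner_toLp x.ofLp b
  rw [charFun_apply, charFun_apply]
  simp only [e]
  simpa [complexMGF, mul_comm] using h.symm

end Multivariate

end GaussianMeasures

/-! ### The population -/

section PopulationModel

/-! ### Integration against the mixture and its second moments. -/

section Law

variable {p L : ℕ} {w : Fin L → ℝ} {M : Matrix (Fin p) (Fin L) ℝ} {SW : Matrix (Fin p) (Fin p) ℝ}

/-- The conditional law of the features given the label. -/
abbrev cond (M : Matrix (Fin p) (Fin L) ℝ) (SW : Matrix (Fin p) (Fin p) ℝ) (l : Fin L) :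
    Measure (EuclideanSpace ℝ (Fin p)) :=
  multivariateGaussian (WithLp.toLp 2 (M.col l)) SW

theorem law_eq : law w M SW = ∑ l, ENNReal.ofReal (w l) • (cond M SW l).map fun x => (x, l) := by
  simp only [law, Measure.prod_dirac]

theorem isProbabilityMeasure_law (hw : ∀ l, 0 ≤ w l) (h1 : ∑ l, w l = 1) :
    IsProbabilityMeasure (law w M SW) := by
  constructor
  simp only [law, Measure.coe_finsetSum, Finset.sum_apply, Measure.smul_apply, measure_univ,
    smul_eq_mul, mul_one]
  rw [← ENNReal.ofReal_sum_of_nonneg fun l _ => hw l, h1, ENNReal.ofReal_one]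

theorem integrable_law {f : EuclideanSpace ℝ (Fin p) × Fin L → ℝ} (hf : Measurable f)
    (hi : ∀ l, Integrable (fun x => f (x, l)) (cond M SW l)) : Integrable f (law w M SW) := by
  rw [law_eq, integrable_finsetSum_measure]
  intro l _
  refine Integrable.smul_measure ?_ ENNReal.ofReal_ne_top
  rw [integrable_map_measure hf.aestronglyMeasurable (by fun_prop)]
  exact hi l

theorem integral_law (hw : ∀ l, 0 ≤ w l) {f : EuclideanSpace ℝ (Fin p) × Fin L → ℝ}
    (hf : Measurable f) (hi : ∀ l, Integrable (fun x => f (x, l)) (cond M SW l)) :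
    ∫ z, f z ∂(law w M SW) = ∑ l, w l * ∫ x, f (x, l) ∂(cond M SW l) := by
  have hi' : ∀ l, Integrable f ((cond M SW l).map fun x => (x, l)) := fun l => by
    rw [integrable_map_measure hf.aestronglyMeasurable (by fun_prop)]
    exact hi l
  rw [law_eq, integral_finsetSum_measure fun l _ =>
    (hi' l).smul_measure ENNReal.ofReal_ne_top]
  refine Finset.sum_congr rfl fun l _ => ?_
  rw [integral_smul_measure, ENNReal.toReal_ofReal (hw l), smul_eq_mul,
    integral_map (by fun_prop) hf.aestronglyMeasurable]

theorem measureReal_law (hw : ∀ l, 0 ≤ w l) {s : Set (EuclideanSpace ℝ (Fin p) × Fin L)}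
    (hs : MeasurableSet s) :
    (law w M SW).real s = ∑ l, w l * (cond M SW l).real {x | (x, l) ∈ s} := by
  rw [law_eq, measureReal_def]
  simp only [Measure.coe_finsetSum, Finset.sum_apply, Measure.smul_apply, smul_eq_mul]
  rw [ENNReal.toReal_sum fun l _ => ENNReal.mul_ne_top ENNReal.ofReal_ne_top (measure_ne_top _ _)]
  refine Finset.sum_congr rfl fun l _ => ?_
  rw [ENNReal.toReal_mul, ENNReal.toReal_ofReal (hw l), Measure.map_apply (by fun_prop) hs]
  rfl

theorem memLp_coord (m : EuclideanSpace ℝ (Fin p)) (i : Fin p) :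
    MemLp (fun x : EuclideanSpace ℝ (Fin p) => x i) 2 (multivariateGaussian m SW) := by
  have := IsGaussian.memLp_dual (multivariateGaussian m SW) (EuclideanSpace.proj i) 2 (by simp)
  exact this

theorem integral_coord (m : EuclideanSpace ℝ (Fin p)) (i : Fin p) :
    ∫ x, x i ∂(multivariateGaussian m SW) = m i := by
  have := ContinuousLinearMap.integral_comp_id_comm (μ := multivariateGaussian m SW)
    (L := (EuclideanSpace.proj i : EuclideanSpace ℝ (Fin p) →L[ℝ] ℝ)) IsGaussian.integrable_id
  rw [integral_id_multivariateGaussian] at this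
  exact this

theorem integral_coord_mul (hS : SW.PosSemidef) (m : EuclideanSpace ℝ (Fin p)) (i j : Fin p) :
    ∫ x, x i * x j ∂(multivariateGaussian m SW) = SW i j + m i * m j := by
  have h := covariance_eval_multivariateGaussian (μ := m) hS i j
  rw [covariance_eq_sub (memLp_coord m i) (memLp_coord m j), integral_coord, integral_coord] at h
  have h2 : ∫ x, x i * x j ∂(multivariateGaussian m SW) =
    ∫ x, ((fun x : EuclideanSpace ℝ (Fin p) => x i) * fun x : EuclideanSpace ℝ (Fin p) => x j) x
      ∂(multivariateGaussian m SW) := rfl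
  rw [h2]
  linarith

theorem memLp_law_coord (i : Fin p) :
    MemLp (fun z : EuclideanSpace ℝ (Fin p) × Fin L => z.1 i) 2 (law w M SW) := by
  rw [memLp_two_iff_integrable_sq (by fun_prop)]
  exact integrable_law (by fun_prop) fun l => (memLp_coord _ i).integrable_sq

theorem measurable_label (l : Fin L) :
    Measurable fun z : EuclideanSpace ℝ (Fin p) × Fin L => if z.2 = l then (1 : ℝ) else 0 :=
  Measurable.ite (measurable_snd (measurableSet_singleton l)) measurable_const measurable_const

theorem integral_law_coord (hw : ∀ l, 0 ≤ w l) (hc : ∑ l, w l • M.col l = 0) (i : Fin p) :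
    ∫ z, z.1 i ∂(law w M SW) = 0 := by
  rw [integral_law hw (by fun_prop) fun l => (memLp_coord _ i).integrable (by norm_num)]
  simp only [integral_coord]
  simpa using congrFun hc i

theorem covX_law (hS : SW.PosSemidef) (hw : ∀ l, 0 ≤ w l) (h1 : ∑ l, w l = 1)
    (hc : ∑ l, w l • M.col l = 0) :
    covX (law w M SW) = SW + M * diagonal w * Mᵀ := by
  have := isProbabilityMeasure_law (M := M) (SW := SW) hw h1
  ext i j
  rw [covX, of_apply, covariance_eq_sub (memLp_law_coord i) (memLp_law_coord j),
    integral_law_coord hw hc, zero_mul, sub_zero]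
  have : ∫ z, ((fun z : EuclideanSpace ℝ (Fin p) × Fin L => z.1 i) *
      fun z : EuclideanSpace ℝ (Fin p) × Fin L => z.1 j) z
      ∂(law w M SW) = ∫ z, z.1 i * z.1 j ∂(law w M SW) := rfl
  rw [this, integral_law hw (by fun_prop) fun l => (memLp_coord _ i).integrable_mul (memLp_coord _ j)]
  simp only [integral_coord_mul hS, mul_add, Finset.sum_add_distrib, ← Finset.sum_mul, h1, one_mul,
    col_apply]
  rw [Matrix.add_apply, Matrix.mul_apply]
  congr 1
  refine Finset.sum_congr rfl fun l _ => ?_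
  rw [mul_diagonal, transpose_apply]
  ring

theorem covXY_law (hw : ∀ l, 0 ≤ w l) (h1 : ∑ l, w l = 1)
    (hc : ∑ l, w l • M.col l = 0) :
    covXY (law w M SW) = M * diagonal w := by
  have := isProbabilityMeasure_law (M := M) (SW := SW) hw h1
  ext i l
  have hL : MemLp (fun z : EuclideanSpace ℝ (Fin p) × Fin L => if z.2 = l then (1 : ℝ) else 0) 2
      (law w M SW) := by
    refine MemLp.of_bound (measurable_label l).aestronglyMeasurable 1 (.of_forall fun z => ?_)
    split_ifs <;> simp
  rw [covXY, of_apply, covariance_eq_sub (memLp_law_coord i) hL,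
    integral_law_coord hw hc, zero_mul, sub_zero]
  have : ∫ z, ((fun z : EuclideanSpace ℝ (Fin p) × Fin L => z.1 i) *
      fun z : EuclideanSpace ℝ (Fin p) × Fin L => if z.2 = l then (1 : ℝ) else 0) z ∂(law w M SW) =
      ∫ z, z.1 i * (if z.2 = l then (1 : ℝ) else 0) ∂(law w M SW) := rfl
  have hm : Measurable fun z : EuclideanSpace ℝ (Fin p) × Fin L =>
      z.1 i * (if z.2 = l then (1 : ℝ) else 0) :=
    Measurable.mul (by fun_prop) (measurable_label l)
  rw [this, integral_law hw hm
    fun k => ((memLp_coord (WithLp.toLp 2 (M.col k)) i).integrable (by norm_num)).mul_const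
      (if k = l then (1 : ℝ) else 0)]
  have hk : ∀ k, ∫ x, x i * (if k = l then (1 : ℝ) else 0) ∂(cond M SW k) =
      M i k * (if k = l then (1 : ℝ) else 0) := fun k => by
    rw [integral_mul_const, integral_coord]; rfl
  rw [Finset.sum_congr rfl fun k _ => congrArg (w k * ·) (hk k), mul_diagonal]
  simp [mul_comm]

end Law

/-- The standing assumptions on the mixture, with a single constant `A`. -/
structure Regular {p L : ℕ} (A : ℝ) (w : Fin L → ℝ) (M : Matrix (Fin p) (Fin L) ℝ)
    (SW : Matrix (Fin p) (Fin p) ℝ) : Prop where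
  one_le : 1 ≤ A
  two_le : 2 ≤ L
  posDef : SW.PosDef
  sum_one : ∑ l, w l = 1
  weight_lower : ∀ l, 1 ≤ A * L * w l
  weight_upper : ∀ l, L * w l ≤ A
  centered : ∑ l, w l • M.col l = 0
  mahal_lower : ∀ k l, k ≠ l → 1 ≤ A * mahal M SW k l
  mahal_upper : ∀ k l, mahal M SW k l ≤ A
  quad_lower : ∀ v, l2 v ^ 2 ≤ A * (v ⬝ᵥ SW *ᵥ v)
  quad_upper : ∀ v, v ⬝ᵥ SW *ᵥ v ≤ A * l2 v ^ 2

/-! ### Size of the population quantities, with their dependence on L. -/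

section Population

attribute [local instance] Matrix.frobeniusNormedAddCommGroup Matrix.frobeniusNormedSpace

variable {p L : ℕ} {A : ℝ} {w : Fin L → ℝ} {M : Matrix (Fin p) (Fin L) ℝ}
  {SW : Matrix (Fin p) (Fin p) ℝ}

namespace Regular

theorem card_pos (h : Regular A w M SW) : (0 : ℝ) < L := by
  have := h.two_le
  exact_mod_cast (by omega : 0 < L)

theorem weight_pos (h : Regular A w M SW) (l : Fin L) : 0 < w l := by
  have h1 := h.weight_lower l
  have h2 := h.card_pos
  have h3 := h.one_le
  by_contra! hneg
  have : A * L * w l ≤ 0 := mul_nonpos_of_nonneg_of_nonpos (by positivity) hneg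
  linarith

theorem weight_nonneg (h : Regular A w M SW) (l : Fin L) : 0 ≤ w l := (h.weight_pos l).le

theorem prob (h : Regular A w M SW) : IsProbabilityMeasure (law w M SW) :=
  isProbabilityMeasure_law h.weight_nonneg h.sum_one

theorem symm (h : Regular A w M SW) : SWᵀ = SW := by
  have := h.posDef.isHermitian
  rwa [Matrix.IsHermitian, conjTranspose_eq_transpose_of_trivial] at this

theorem isUnit_det (h : Regular A w M SW) : IsUnit SW.det :=
  isUnit_iff_ne_zero.mpr h.posDef.det_pos.ne'

theorem mul_inv (h : Regular A w M SW) : SW * SW⁻¹ = 1 := mul_nonsing_inv _ h.isUnit_det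

theorem inv_mul (h : Regular A w M SW) : SW⁻¹ * SW = 1 := nonsing_inv_mul _ h.isUnit_det

theorem inv_symm (h : Regular A w M SW) : (SW⁻¹)ᵀ = SW⁻¹ := by
  rw [transpose_nonsing_inv, h.symm]

theorem quad_nonneg (h : Regular A w M SW) (v : Fin p → ℝ) : 0 ≤ v ⬝ᵥ SW *ᵥ v := by
  simpa using h.posDef.posSemidef.dotProduct_mulVec_nonneg v

/-- `v ⬝ᵥ SW⁻¹ *ᵥ v = u ⬝ᵥ SW *ᵥ u` for `u = SW⁻¹ *ᵥ v`. -/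
theorem quad_inv (h : Regular A w M SW) (v : Fin p → ℝ) :
    (SW⁻¹ *ᵥ v) ⬝ᵥ SW *ᵥ (SW⁻¹ *ᵥ v) = v ⬝ᵥ SW⁻¹ *ᵥ v := by
  rw [mulVec_mulVec, h.mul_inv, one_mulVec, dotProduct_comm]

theorem l2_inv_mulVec_le (h : Regular A w M SW) (v : Fin p → ℝ) :
    l2 (SW⁻¹ *ᵥ v) ≤ A * l2 v := by
  have hA : 0 < A := by linarith [h.one_le]
  have h1 : ∀ u, A⁻¹ * l2 u ^ 2 ≤ u ⬝ᵥ SW *ᵥ u := fun u => by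
    rw [inv_mul_le_iff₀ hA]; exact h.quad_lower u
  have h2 := mulVec_lower_of_quad h1 (SW⁻¹ *ᵥ v)
  rw [mulVec_mulVec, h.mul_inv, one_mulVec, inv_mul_le_iff₀ hA] at h2
  exact h2

/-- Cauchy–Schwarz in the Σ_W form for v and Σ_W⁻¹v gives |v|⁴ ≤ (vᵀΣ_W v)(vᵀΣ_W⁻¹v), and the last
factor is the Mahalanobis distance. -/
theorem l2_sub_col_le (h : Regular A w M SW) (k l : Fin L) : l2 (M.col k - M.col l) ≤ A := by
  set v := M.col k - M.col l with hv
  have hA := h.one_le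
  have h1 := sq_dotProduct_mulVec_le h.symm h.quad_nonneg v (SW⁻¹ *ᵥ v)
  rw [h.quad_inv, mulVec_mulVec, h.mul_inv, one_mulVec, ← l2_sq_eq_dotProduct] at h1
  have h2 : v ⬝ᵥ SW⁻¹ *ᵥ v ≤ A := h.mahal_upper k l
  have h3 := h.quad_upper v
  have h4 : (l2 v ^ 2) ^ 2 ≤ A * l2 v ^ 2 * A := h1.trans
    (mul_le_mul h3 h2 (by rw [← h.quad_inv]; exact h.quad_nonneg _) (by positivity))
  rcases (l2_nonneg v).eq_or_lt with h0 | h0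
  · rw [← h0]; linarith
  · have h5 : 0 < l2 v ^ 2 := by positivity
    refine le_of_sq_le_sq ?_ (by linarith)
    nlinarith

/-- Centring makes each mean an average of differences of means, so bounded separation bounds the
means themselves. -/
theorem l2_col_le (h : Regular A w M SW) (l : Fin L) : l2 (M.col l) ≤ A := by
  have e : M.col l = ∑ k, w k • (M.col l - M.col k) := by
    simp only [smul_sub, Finset.sum_sub_distrib, h.centered, sub_zero, ← Finset.sum_smul,
      h.sum_one, one_smul]
  have hsum : ∀ (s : Finset (Fin L)) (f : Fin L → Fin p → ℝ), l2 (∑ k ∈ s, f k) ≤ ∑ k ∈ s, l2 (f k) := by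
    intro s f
    simpa [l2, WithLp.toLp_sum] using norm_sum_le s fun k =>
      (WithLp.toLp 2 (f k) : EuclideanSpace ℝ (Fin p))
  calc l2 (M.col l) ≤ ∑ k, l2 (w k • (M.col l - M.col k)) := by
        conv_lhs => rw [e]
        exact hsum _ _
    _ ≤ ∑ k, w k * A := by
        gcongr with k
        rw [l2_smul, abs_of_pos (h.weight_pos k)]
        exact mul_le_mul_of_nonneg_left (h.l2_sub_col_le l k) (h.weight_nonneg k)
    _ = A := by rw [← Finset.sum_mul, h.sum_one, one_mul]

theorem frob_mean_le (h : Regular A w M SW) : ‖M‖ ≤ √L * A :=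
  frob_le_of_col M (by linarith [h.one_le]) h.l2_col_le

theorem l2_direction_le (h : Regular A w M SW) (l : Fin L) : l2 ((SW⁻¹ * M).col l) ≤ A ^ 2 := by
  have : (SW⁻¹ * M).col l = SW⁻¹ *ᵥ M.col l := rfl
  rw [this, sq]
  refine (h.l2_inv_mulVec_le _).trans ?_
  have := h.one_le
  have := h.l2_col_le l
  gcongr

theorem frob_direction_le (h : Regular A w M SW) : ‖SW⁻¹ * M‖ ≤ √L * A ^ 2 :=
  frob_le_of_col _ (by positivity) h.l2_direction_le

/-- The quadratic form of `Cov(X)` dominates that of `Σ_W`. -/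
theorem quad_cov_lower (h : Regular A w M SW) (v : Fin p → ℝ) :
    A⁻¹ * l2 v ^ 2 ≤ v ⬝ᵥ (SW + M * diagonal w * Mᵀ) *ᵥ v := by
  have hA : 0 < A := by linarith [h.one_le]
  have h1 : A⁻¹ * l2 v ^ 2 ≤ v ⬝ᵥ SW *ᵥ v := by
    rw [inv_mul_le_iff₀ hA]; exact h.quad_lower v
  have h2 : 0 ≤ v ⬝ᵥ (M * diagonal w * Mᵀ) *ᵥ v := by
    rw [← mulVec_mulVec, ← mulVec_mulVec, dotProduct_mulVec, ← mulVec_transpose]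
    simp only [dotProduct, mulVec_diagonal]
    exact Finset.sum_nonneg fun l _ => by
      have := h.weight_nonneg l
      nlinarith [mul_nonneg this (mul_self_nonneg ((Mᵀ *ᵥ v) l))]
  rw [add_mulVec, dotProduct_add]
  linarith

/-- In the between-class term, `M * diagonal w` is of order 1/√L and `Mᵀ` of order √L in Frobenius
norm, so the number of classes cancels. -/
theorem opBound_cov (h : Regular A w M SW) :
    OpBound (SW + M * diagonal w * Mᵀ) (2 * A ^ 3) := by
  have hA := h.one_le
  have h1 : OpBound SW A := by
    refine ⟨by linarith, fun u v => ?_⟩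
    have h2 := sq_dotProduct_mulVec_le h.symm h.quad_nonneg u v
    refine abs_le_of_sq_le_sq ?_ (by have := l2_nonneg u; have := l2_nonneg v; positivity)
    refine h2.trans ?_
    calc _ ≤ (A * l2 u ^ 2) * (A * l2 v ^ 2) :=
          mul_le_mul (h.quad_upper u) (h.quad_upper v) (h.quad_nonneg v) (by positivity)
      _ = _ := by ring
  have hL := h.card_pos
  have h3 : OpBound (M * diagonal w) (A ^ 2 / √L) := by
    refine (opBound_frob _).mono ((frob_le_of_col _ (t := A / L * A) (by positivity) fun l => ?_).trans ?_)
    · have : (M * diagonal w).col l = w l • M.col l := by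
        ext i; simp [mul_comm]
      rw [this, l2_smul, abs_of_pos (h.weight_pos l)]
      have h4 := h.l2_col_le l
      have h5 : w l ≤ A / L := by rw [le_div_iff₀ hL, mul_comm]; exact h.weight_upper l
      gcongr
    · have : √(L : ℝ) * √L = L := Real.mul_self_sqrt hL.le
      have h0 : 0 < √(L : ℝ) := Real.sqrt_pos.mpr hL
      rw [le_div_iff₀ h0]
      apply le_of_eq
      calc √(L : ℝ) * (A / L * A) * √L = (√(L : ℝ) * √L) * (A / L * A) := by ring
        _ = A ^ 2 := by rw [this]; field_simp
  have h6 := h1.add (h3.mul ((opBound_frob M).mono h.frob_mean_le).transpose)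
  refine h6.mono ?_
  have h0 : 0 < √(L : ℝ) := Real.sqrt_pos.mpr hL
  have : A ^ 2 / √L * (√L * A) = A ^ 3 := by field_simp
  rw [this]
  have : A ≤ A ^ 3 := le_self_pow₀ hA (by norm_num)
  linarith

end Regular

/-- A matrix `B` solving the population normal equations, with the bounds it satisfies. -/
theorem Regular.normal_equations (h : Regular A w M SW) :
    (SW + M * diagonal w * Mᵀ) * regMatrix (law w M SW) = M * diagonal w := by
  rw [regMatrix, covX_law h.posDef.posSemidef h.weight_nonneg h.sum_one h.centered,
    covXY_law h.weight_nonneg h.sum_one h.centered, ← Matrix.mul_assoc, mul_nonsing_inv, Matrix.one_mul]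
  rw [← Matrix.isUnit_iff_isUnit_det]
  have hA : 0 < A := by linarith [h.one_le]
  exact isUnit_of_lower (inv_pos.mpr hA) (mulVec_lower_of_quad h.quad_cov_lower)

/-- Each column solves a well-conditioned system whose right-hand side has size O(1/L). The factor
1/√L keeps the contribution of B to the regression noise at order e/√L. -/
theorem Regular.frob_regMatrix_le (h : Regular A w M SW) :
    ‖regMatrix (law w M SW)‖ ≤ A ^ 3 / √L := by
  have hA : 0 < A := by linarith [h.one_le]
  have hL := h.card_pos
  have h0 : 0 < √(L : ℝ) := Real.sqrt_pos.mpr hL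
  refine (frob_le_of_col _ (t := A ^ 3 / L) (by positivity) fun l => ?_).trans ?_
  · have h1 := mulVec_lower_of_quad h.quad_cov_lower ((regMatrix (law w M SW)).col l)
    have e : (SW + M * diagonal w * Mᵀ) *ᵥ (regMatrix (law w M SW)).col l =
        ((SW + M * diagonal w * Mᵀ) * regMatrix (law w M SW)).col l := rfl
    have e2 : (M * diagonal w).col l = w l • M.col l := by
      ext i; simp [mul_comm]
    rw [e, h.normal_equations, e2, l2_smul, abs_of_pos (h.weight_pos l), inv_mul_le_iff₀ hA] at h1
    refine h1.trans ?_
    have h4 := h.l2_col_le l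
    have h5 : w l ≤ A / L := by rw [le_div_iff₀ hL, mul_comm]; exact h.weight_upper l
    calc A * (w l * l2 (M.col l)) ≤ A * (A / L * A) := by gcongr
      _ = A ^ 3 / L := by ring
  · apply le_of_eq
    have : √(L : ℝ) * √L = L := Real.mul_self_sqrt hL.le
    field_simp
    nlinarith

/-- If B vanished, the normal equations would force M = 0, against the separation of two distinct
classes. The bound lets e be absorbed into e√r. -/
theorem Regular.one_le_rank (h : Regular A w M SW) : 1 ≤ (regMatrix (law w M SW)).rank := by
  by_contra! h0
  have h1 : regMatrix (law w M SW) = 0 := by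
    have : (regMatrix (law w M SW)).rank = 0 := by omega
    rw [Matrix.rank, Submodule.finrank_eq_zero, LinearMap.range_eq_bot] at this
    ext i j
    simpa using congrFun (LinearMap.congr_fun this (Pi.single j 1)) i
  have h2 := h.normal_equations
  rw [h1, Matrix.mul_zero] at h2
  have hM : M = 0 := by
    ext i l
    have := congrFun (congrFun h2 i) l
    simp only [Matrix.zero_apply, mul_diagonal] at this
    exact (mul_eq_zero.mp this.symm).resolve_right (h.weight_pos l).ne'
  have h2l := h.two_le
  have := h.mahal_lower ⟨0, by omega⟩ ⟨1, by omega⟩ (by simp)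
  have e : (0 : Matrix (Fin p) (Fin L) ℝ).col = 0 := rfl
  rw [hM, mahal, e] at this
  norm_num at this

end Population

end PopulationModel

/-! ### Rank-penalised least squares -/

section ReducedRank

attribute [local instance] Matrix.frobeniusNormedAddCommGroup Matrix.frobeniusNormedSpace

theorem opBound_diagonal {d : ℕ} {x : Fin d → ℝ} {t : ℝ} (ht : 0 ≤ t) (h : ∀ i, |x i| ≤ t) :
    OpBound (diagonal x) t := by
  refine ⟨ht, fun u v => ?_⟩
  refine (abs_dotProduct_le _ _).trans ?_
  have : l2 (diagonal x *ᵥ v) ≤ t * l2 v := by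
    refine le_of_sq_le_sq ?_ (mul_nonneg ht (l2_nonneg v))
    rw [mul_pow, l2_sq, l2_sq, Finset.mul_sum]
    refine Finset.sum_le_sum fun i _ => ?_
    rw [mulVec_diagonal, mul_pow]
    exact mul_le_mul_of_nonneg_right (sq_le_sq.mpr ((h i).trans (le_abs_self t))) (sq_nonneg _)
  have := mul_le_mul_of_nonneg_left this (l2_nonneg u)
  linarith

theorem OpBound.frob_mul_le' {a b c : ℕ} {A : Matrix (Fin b) (Fin c) ℝ} {t : ℝ} (hA : OpBound A t)
    (N : Matrix (Fin a) (Fin b) ℝ) : ‖N * A‖ ≤ ‖N‖ * t := by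
  have := hA.transpose.frob_mul_le Nᵀ
  rwa [← transpose_mul, frobenius_norm_transpose, frobenius_norm_transpose, mul_comm] at this

theorem frob_sq_eq_trace {a b : ℕ} (A : Matrix (Fin a) (Fin b) ℝ) : ‖A‖ ^ 2 = (Aᵀ * A).trace := by
  rw [frob_sq, Finset.sum_comm]
  simp [Matrix.trace, Matrix.mul_apply, sq]

theorem sum_mul_eq_trace {a b : ℕ} (A B : Matrix (Fin a) (Fin b) ℝ) :
    ∑ i, ∑ j, A i j * B i j = (Aᵀ * B).trace := by
  rw [Finset.sum_comm]
  simp [Matrix.trace, Matrix.mul_apply]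

/-! ### Sample moments and the basic inequality. -/

section Data

variable {n p L : ℕ}

/-- The sample second moment matrix `n⁻¹ Xᵀ X`. -/
def sampleCov (D : Fin n → EuclideanSpace ℝ (Fin p) × Fin L) : Matrix (Fin p) (Fin p) ℝ :=
  (1 / (n : ℝ)) • ((dataX D)ᵀ * dataX D)

/-- The sample cross moment matrix `n⁻¹ Xᵀ Y`. -/
def sampleCross (D : Fin n → EuclideanSpace ℝ (Fin p) × Fin L) : Matrix (Fin p) (Fin L) ℝ :=
  (1 / (n : ℝ)) • ((dataX D)ᵀ * dataY D)

variable (D : Fin n → EuclideanSpace ℝ (Fin p) × Fin L)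

theorem dataY_gram : (1 / (n : ℝ)) • ((dataY D)ᵀ * dataY D) = diagonal (pihat D) := by
  ext k l
  rcases eq_or_ne k l with rfl | hkl
  · rw [diagonal_apply_eq]; rfl
  · rw [diagonal_apply_ne _ hkl, Matrix.smul_apply, Matrix.mul_apply]
    rw [Finset.sum_eq_zero, smul_zero]
    intro i _
    simp only [transpose_apply, dataY, of_apply]
    split_ifs with h1 h2
    · exact absurd (h1.symm.trans h2) hkl
    all_goals simp

theorem pihat_eq (l : Fin L) :
    pihat D l = (1 / (n : ℝ)) * ∑ i, if (D i).2 = l then (1 : ℝ) else 0 := by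
  simp only [pihat, diag_apply, Matrix.smul_apply, Matrix.mul_apply, smul_eq_mul, transpose_apply,
    dataY, of_apply]
  congr 1
  refine Finset.sum_congr rfl fun i _ => ?_
  split_ifs <;> simp

theorem exists_label_of_pihat_pos {l : Fin L} (h : 0 < pihat D l) : ∃ i, (D i).2 = l := by
  by_contra! hne
  rw [pihat_eq, Finset.sum_eq_zero fun i _ => if_neg (hne i), mul_zero] at h
  exact lt_irrefl _ h

theorem Hhat_eq (Bh : Matrix (Fin p) (Fin L) ℝ) :
    Hhat D Bh = diagonal (pihat D) - Bhᵀ * sampleCov D * Bh := by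
  rw [← dataY_gram, Hhat, smul_sub, sampleCov, Matrix.mul_smul, Matrix.smul_mul]
  simp only [Matrix.mul_assoc]

/-- This ties the empirical class means to the cross moments, whose deviations concentrate. -/
theorem pihat_smul_Mhat_col (hn : 0 < n) (h : ∀ l, 0 < pihat D l) (l : Fin L) :
    pihat D l • (Mhat D).col l = (sampleCross D).col l := by
  have hn' : (n : ℝ) ≠ 0 := by exact_mod_cast hn.ne'
  have hY : (dataY D)ᵀ * dataY D = diagonal (fun l => n * pihat D l) := by
    have := congrArg ((n : ℝ) • ·) (dataY_gram D)
    simp only [smul_smul, mul_one_div_cancel hn', one_smul] at this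
    rw [this, ← diagonal_smul]; rfl
  have hinv : ((dataY D)ᵀ * dataY D)⁻¹ = diagonal (fun l => (n * pihat D l)⁻¹) := by
    rw [hY]
    refine Matrix.inv_eq_right_inv ?_
    rw [diagonal_mul_diagonal, ← diagonal_one]
    congr 1
    funext k
    exact mul_inv_cancel₀ (mul_ne_zero hn' (h k).ne')
  ext j
  simp only [Pi.smul_apply, col_apply, smul_eq_mul, Mhat, hinv, mul_diagonal, sampleCross,
    Matrix.smul_apply]
  have := (h l).ne'
  field_simp

/-- The basic inequality for a minimiser of the penalised criterion. -/
theorem IsReducedRank.basic_inequality {lam : ℝ} {D : Fin n → EuclideanSpace ℝ (Fin p) × Fin L}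
    {Bh : Matrix (Fin p) (Fin L) ℝ} (h : IsReducedRank lam D Bh) (hn : 0 < n)
    (B : Matrix (Fin p) (Fin L) ℝ) :
    ((Bh - B)ᵀ * (sampleCov D * (Bh - B))).trace ≤
      2 * ∑ i, ∑ j, (sampleCross D - sampleCov D * B) i j * (Bh - B) i j +
        lam * (B.rank - Bh.rank) := by
  have hn' : (n : ℝ) ≠ 0 := by exact_mod_cast hn.ne'
  have h1 := h B
  unfold rrCriterion at h1
  rw [← frob_sq, ← frob_sq, frob_sq_eq_trace, frob_sq_eq_trace] at h1
  set Δ := Bh - B with hΔ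
  set X := dataX D
  set Y := dataY D
  have e1 : Y - X * Bh = (Y - X * B) - X * Δ := by
    rw [hΔ, Matrix.mul_sub]; abel
  have e2 : ((Y - X * Bh)ᵀ * (Y - X * Bh)).trace =
      ((Y - X * B)ᵀ * (Y - X * B)).trace - 2 * ((Y - X * B)ᵀ * (X * Δ)).trace +
        ((X * Δ)ᵀ * (X * Δ)).trace := by
    have : ((X * Δ)ᵀ * (Y - X * B)).trace = ((Y - X * B)ᵀ * (X * Δ)).trace := by
      rw [← trace_transpose, transpose_mul, transpose_transpose]
    rw [e1]
    generalize Y - X * B = R at this ⊢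
    generalize X * Δ = T at this ⊢
    rw [transpose_sub, Matrix.sub_mul, Matrix.mul_sub, Matrix.mul_sub, trace_sub,
      trace_sub, trace_sub, this]
    ring
  have e3 : (Δᵀ * (sampleCov D * Δ)).trace = 1 / n * ((X * Δ)ᵀ * (X * Δ)).trace := by
    rw [sampleCov, Matrix.smul_mul, Matrix.mul_smul, trace_smul, smul_eq_mul, transpose_mul]
    simp only [Matrix.mul_assoc]
    rfl
  have e4 : ∑ i, ∑ j, (sampleCross D - sampleCov D * B) i j * Δ i j =
      1 / n * ((Y - X * B)ᵀ * (X * Δ)).trace := by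
    rw [sum_mul_eq_trace, sampleCross, sampleCov, Matrix.smul_mul, ← smul_sub, transpose_smul, Matrix.smul_mul,
      trace_smul, smul_eq_mul]
    congr 2
    have : (X)ᵀ * Y - Xᵀ * X * B = Xᵀ * (Y - X * B) := by
      rw [Matrix.mul_sub, Matrix.mul_assoc]
    rw [← Matrix.mul_assoc (Y - X * B)ᵀ, ← transpose_transpose ((Y - X * B)ᵀ * X), transpose_mul,
      transpose_transpose, ← this]
  rw [e2] at h1
  rw [e3, e4]
  linarith

end Data

/-- Oracle inequality for rank-penalised least squares, in deterministic form. -/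
theorem sq_frob_le_of_basic_inequality {p L : ℕ} {S : Matrix (Fin p) (Fin p) ℝ}
    {F B Bh : Matrix (Fin p) (Fin L) ℝ} {κ f lam : ℝ} (hκ : 0 < κ)
    (hS : ∀ v, κ * l2 v ^ 2 ≤ v ⬝ᵥ S *ᵥ v) (hF : OpBound F f) (hlam : 2 * f ^ 2 ≤ κ * lam)
    (h : ((Bh - B)ᵀ * (S * (Bh - B))).trace ≤
      2 * ∑ i, ∑ j, F i j * (Bh - B) i j + lam * (B.rank - Bh.rank)) :
    κ * ‖Bh - B‖ ^ 2 ≤ 4 * lam * B.rank := by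
  set Δ := Bh - B with hΔ
  have h1 : κ * ‖Δ‖ ^ 2 ≤ (Δᵀ * (S * Δ)).trace := by
    rw [frob_sq_col, Finset.mul_sum]
    refine Finset.sum_le_sum fun j _ => ?_
    exact hS (Δ.col j)
  have h2 := hF.sum_mul_le (D := Δ)
  have hrank : (Δ.rank : ℝ) ≤ Bh.rank + B.rank := by exact_mod_cast rank_sub_le Bh B
  have h3 : √(Δ.rank : ℝ) ^ 2 = Δ.rank := Real.sq_sqrt (by positivity)
  have hf := hF.nonneg
  set ρ := √(Δ.rank : ℝ)
  -- Young's inequality: half of κ‖Δ‖² is given up, and the rest of the noise is at most lam · rank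
  -- Δ. As rank Δ ≤ rank Bh + rank B, the term in rank Bh cancels against the penalty and 2 · lam ·
  -- rank B remains.
  have h4 : κ * (2 * (f * ρ * ‖Δ‖)) ≤ κ * (κ / 2 * ‖Δ‖ ^ 2 + lam * Δ.rank) := by
    have h5 : 2 * f ^ 2 * ρ ^ 2 ≤ κ * lam * ρ ^ 2 := by gcongr
    rw [h3] at h5
    nlinarith [sq_nonneg (κ * ‖Δ‖ - 2 * f * ρ)]
  have h5 := le_of_mul_le_mul_left h4 hκ
  have hlam0 : 0 ≤ lam := by
    have : 0 ≤ κ * lam := (by positivity : 0 ≤ 2 * f ^ 2).trans hlam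
    exact nonneg_of_mul_nonneg_right this hκ
  have h6 := mul_le_mul_of_nonneg_left hrank hlam0
  nlinarith

end ReducedRank

/-! ### Estimated directions -/

section DirectionPerturbation

attribute [local instance] Matrix.frobeniusNormedAddCommGroup Matrix.frobeniusNormedSpace

section Direction

variable {p L : ℕ} {A : ℝ} {w : Fin L → ℝ} {M : Matrix (Fin p) (Fin L) ℝ}
  {SW : Matrix (Fin p) (Fin p) ℝ}

/-- `(Σ_W⁻¹ M) H = B` for the residual second moment matrix `H = diag(w) - Bᵀ Σ B`. -/
theorem Regular.direction_mul_residual (h : Regular A w M SW) {B : Matrix (Fin p) (Fin L) ℝ}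
    (hB : (SW + M * diagonal w * Mᵀ) * B = M * diagonal w) :
    SW⁻¹ * M * (diagonal w - Bᵀ * (SW + M * diagonal w * Mᵀ) * B) = B := by
  have h1 : Bᵀ * (SW + M * diagonal w * Mᵀ) = diagonal w * Mᵀ := by
    have := congrArg transpose hB
    simpa [transpose_mul, h.symm, Matrix.mul_assoc] using this
  have h2 : M * diagonal w - M * diagonal w * Mᵀ * B = SW * B := by
    rw [← hB, Matrix.add_mul]
    conv_rhs => rw [← add_sub_cancel_right (SW * B) (M * diagonal w * Mᵀ * B)]
    rw [← Matrix.add_mul, hB]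
  rw [h1, Matrix.mul_assoc, Matrix.mul_sub, ← Matrix.mul_assoc M, ← Matrix.mul_assoc M, h2,
    ← Matrix.mul_assoc, h.inv_mul, Matrix.one_mul]

/-- By the Woodbury identity the inverse of the residual matrix is diag(1/w) + MᵀΣ_W⁻¹M (`hone`
below), whose operator norm is at most (A + A³)L. -/
theorem Regular.residual_lower (h : Regular A w M SW) {B : Matrix (Fin p) (Fin L) ℝ}
    (hB : (SW + M * diagonal w * Mᵀ) * B = M * diagonal w) (v : Fin L → ℝ) :
    l2 v ≤ 2 * A ^ 3 * L *
      l2 ((diagonal w - Bᵀ * (SW + M * diagonal w * Mᵀ) * B) *ᵥ v) := by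
  set H := diagonal w - Bᵀ * (SW + M * diagonal w * Mᵀ) * B with hH
  have hA := h.one_le
  have hL := h.card_pos
  have h1 : Bᵀ * (SW + M * diagonal w * Mᵀ) = diagonal w * Mᵀ := by
    have := congrArg transpose hB
    simpa [transpose_mul, h.symm, Matrix.mul_assoc] using this
  have hone : diagonal (fun l => (w l)⁻¹) * H + Mᵀ * (SW⁻¹ * M * H) = 1 := by
    rw [h.direction_mul_residual hB, hH, h1, Matrix.mul_sub, diagonal_mul_diagonal,
      Matrix.mul_assoc (diagonal w), ← Matrix.mul_assoc (diagonal fun l => (w l)⁻¹),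
      diagonal_mul_diagonal]
    have : (fun i => (w i)⁻¹ * w i) = fun _ => 1 := by
      funext i; exact inv_mul_cancel₀ (h.weight_pos i).ne'
    rw [this, diagonal_one, Matrix.one_mul, sub_add_cancel]
  have hv : v = diagonal (fun l => (w l)⁻¹) *ᵥ (H *ᵥ v) + Mᵀ *ᵥ ((SW⁻¹ * M) *ᵥ (H *ᵥ v)) := by
    conv_lhs => rw [← one_mulVec v, ← hone]
    simp only [add_mulVec, mulVec_mulVec, Matrix.mul_assoc]
  have hd : OpBound (diagonal fun l => (w l)⁻¹) (A * L) := by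
    refine opBound_diagonal (by positivity) fun l => ?_
    have := h.weight_pos l
    rw [abs_of_pos (inv_pos.mpr this), inv_le_iff_one_le_mul₀ this]
    exact h.weight_lower l
  have hm := (((opBound_frob M).mono h.frob_mean_le).transpose).mul
    ((opBound_frob (SW⁻¹ * M)).mono h.frob_direction_le)
  calc l2 v ≤ l2 (diagonal (fun l => (w l)⁻¹) *ᵥ (H *ᵥ v)) +
        l2 ((Mᵀ * (SW⁻¹ * M)) *ᵥ (H *ᵥ v)) := by
        conv_lhs => rw [hv]
        rw [mulVec_mulVec (H *ᵥ v) Mᵀ]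
        exact l2_add_le _ _
    _ ≤ A * L * l2 (H *ᵥ v) + √L * A * (√L * A ^ 2) * l2 (H *ᵥ v) :=
        add_le_add (hd.l2_mulVec_le _) (hm.l2_mulVec_le _)
    _ = (A + A ^ 3) * L * l2 (H *ᵥ v) := by
        have : √(L : ℝ) * √L = L := Real.mul_self_sqrt hL.le
        linear_combination (A ^ 3 * l2 (H *ᵥ v)) * this
    _ ≤ 2 * A ^ 3 * L * l2 (H *ᵥ v) := by
        have : A ≤ A ^ 3 := le_self_pow₀ hA (by norm_num)
        gcongr
        linarith

/-- Perturbation bound for the estimated residual matrix `Ĥ` around `H`, and for the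
directions `B̂ Ĥ⁺` around `B H⁻¹ = Σ_W⁻¹ M`. Here `s² = L`. -/
theorem Regular.direction_error (h : Regular A w M SW) {B Bh : Matrix (Fin p) (Fin L) ℝ}
    (hB : (SW + M * diagonal w * Mᵀ) * B = M * diagonal w)
    {S : Matrix (Fin p) (Fin p) ℝ} {wh : Fin L → ℝ} {a q δ : ℝ} (ha : 0 ≤ a) (hq : 0 ≤ q)
    (hSs : Sᵀ = S)
    (hδ : 0 ≤ δ) (hδ1 : δ ≤ 1) (haδ : a * δ ≤ 1)
    (hBn : ‖B‖ ≤ A ^ 3 / √L)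
    (hS : OpBound (S - (SW + M * diagonal w * Mᵀ)) (a * δ))
    (hw : OpBound (diagonal w - diagonal wh) (a * δ / L))
    (hw' : ‖diagonal w - diagonal wh‖ ≤ a * δ / √L)
    (hBh : ‖Bh - B‖ ≤ q * δ / √L)
    {Q : ℝ} (hQ : Q = a * A ^ 6 + q * (2 * A ^ 3 + 1) * (2 * A ^ 3 + q) + a)
    (hsmall : 4 * A ^ 3 * Q * (δ * √L) ≤ 1) :
    ‖Bh * pinv (diagonal wh - Bhᵀ * S * Bh) - SW⁻¹ * M‖ ≤
      4 * A ^ 3 * (q + A ^ 2 * a + A ^ 2 * Q) * (δ * √L) := by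
  have hA := h.one_le
  have hL := h.card_pos
  have hL1 : (1 : ℝ) ≤ L := by have := h.two_le; exact_mod_cast (by omega : 1 ≤ L)
  set s := √(L : ℝ) with hs
  have hs2 : s * s = L := Real.mul_self_sqrt hL.le
  have hs0 : 0 < s := Real.sqrt_pos.mpr hL
  have hs1 : 1 ≤ s := Real.one_le_sqrt.mpr hL1
  set Sx := SW + M * diagonal w * Mᵀ with hSx
  set Δ := Bh - B with hΔ
  set σ := 2 * A ^ 3 + 1 with hσ
  have haδ0 : 0 ≤ a * δ := hS.nonneg
  have hSσ : OpBound S σ := by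
    have := hS.add h.opBound_cov
    rw [sub_add_cancel] at this
    exact this.mono (by linarith)
  have hσ0 : 0 ≤ σ := hSσ.nonneg
  -- Each term has two factors of order 1/√L, coming from B or Δ, hence the order δ/L. The constants
  -- add up to Q - a, with δ ≤ 1 used in the term quadratic in Δ.
  have hT : ‖Bhᵀ * S * Bh - Bᵀ * Sx * B‖ ≤ (Q - a) * δ / L := by
    have e : Bhᵀ * S * Bh - Bᵀ * Sx * B =
        Bᵀ * ((S - Sx) * B) + (Δᵀ * (S * B) + Δᵀ * (S * Δ)) + Bᵀ * (S * Δ) := by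
      have : Bh = B + Δ := by rw [hΔ]; abel
      rw [this, transpose_add]
      simp only [Matrix.add_mul, Matrix.mul_add, Matrix.sub_mul, Matrix.mul_sub, Matrix.mul_assoc]
      abel
    have n1 : ‖Bᵀ * ((S - Sx) * B)‖ ≤ A ^ 3 / s * (a * δ * (A ^ 3 / s)) := by
      refine (frobenius_norm_mul _ _).trans ?_
      rw [frobenius_norm_transpose]
      refine mul_le_mul hBn ((hS.frob_mul_le _).trans ?_) (norm_nonneg _) (by positivity)
      gcongr
    have n2 : ‖Δᵀ * (S * B)‖ ≤ q * δ / s * (σ * (A ^ 3 / s)) := by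
      refine (frobenius_norm_mul _ _).trans ?_
      rw [frobenius_norm_transpose]
      refine mul_le_mul hBh ((hSσ.frob_mul_le _).trans ?_) (norm_nonneg _) (by positivity)
      gcongr
    have n3 : ‖Δᵀ * (S * Δ)‖ ≤ q * δ / s * (σ * (q * δ / s)) := by
      refine (frobenius_norm_mul _ _).trans ?_
      rw [frobenius_norm_transpose]
      refine mul_le_mul hBh ((hSσ.frob_mul_le _).trans ?_) (norm_nonneg _) (by positivity)
      gcongr
    have n4 : ‖Bᵀ * (S * Δ)‖ ≤ A ^ 3 / s * (σ * (q * δ / s)) := by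
      refine (frobenius_norm_mul _ _).trans ?_
      rw [frobenius_norm_transpose]
      refine mul_le_mul hBn ((hSσ.frob_mul_le _).trans ?_) (norm_nonneg _) (by positivity)
      gcongr
    have n3' : q * δ / s * (σ * (q * δ / s)) ≤ q * δ / s * (σ * (q / s)) := by
      have : q * δ / s ≤ q / s := by
        gcongr
        exact mul_le_of_le_one_right hq hδ1
      gcongr
    rw [e]
    refine (norm_add_le _ _).trans ?_
    have t1 := norm_add_le (Bᵀ * ((S - Sx) * B)) (Δᵀ * (S * B) + Δᵀ * (S * Δ))
    have t2 := norm_add_le (Δᵀ * (S * B)) (Δᵀ * (S * Δ))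
    have hsum : A ^ 3 / s * (a * δ * (A ^ 3 / s)) + (q * δ / s * (σ * (A ^ 3 / s)) +
        q * δ / s * (σ * (q / s))) + A ^ 3 / s * (σ * (q * δ / s)) = (Q - a) * δ / L := by
      rw [hQ, ← hs2]
      field_simp
      ring
    linarith
  set H := diagonal w - Bᵀ * Sx * B with hH
  set Hh := diagonal wh - Bhᵀ * S * Bh with hHh
  have hdiff : H - Hh = (diagonal w - diagonal wh) + (Bhᵀ * S * Bh - Bᵀ * Sx * B) := by
    rw [hH, hHh]; abel
  have hQa : 0 ≤ (Q - a) * δ / L := (norm_nonneg _).trans hT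
  have hHH : ‖H - Hh‖ ≤ Q * (δ * s) / L := by
    rw [hdiff]
    refine (norm_add_le _ _).trans ((add_le_add hw' hT).trans ?_)
    have : (Q - a) * δ / L ≤ (Q - a) * δ / L * s := le_mul_of_one_le_right hQa hs1
    have e : a * δ / s = a * δ * s / L := by rw [← hs2]; field_simp
    rw [e]
    calc a * δ * s / L + (Q - a) * δ / L ≤ a * δ * s / L + (Q - a) * δ / L * s := by linarith
      _ = _ := by ring
  -- Under `hsmall` the perturbation consumes at most half of the lower bound for `H`.
  have hlow : ∀ v, 1 / (4 * A ^ 3 * L) * l2 v ≤ l2 (Hh *ᵥ v) := by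
    intro v
    have h1 : l2 v ≤ 2 * A ^ 3 * L * l2 (H *ᵥ v) := h.residual_lower hB v
    have h2 : l2 (H *ᵥ v) ≤ l2 (Hh *ᵥ v) + Q * (δ * s) / L * l2 v := by
      have e : H *ᵥ v = Hh *ᵥ v + (H - Hh) *ᵥ v := by rw [← add_mulVec, add_sub_cancel]
      rw [e]
      refine (l2_add_le _ _).trans (add_le_add le_rfl ((l2_mulVec_le _ _).trans ?_))
      gcongr
    have h3 : l2 v ≤ 2 * A ^ 3 * L * (l2 (Hh *ᵥ v) + Q * (δ * s) / L * l2 v) :=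
      h1.trans (by gcongr)
    have h4 : 2 * A ^ 3 * L * (Q * (δ * s) / L * l2 v) = (4 * A ^ 3 * Q * (δ * s)) * l2 v / 2 := by
      field_simp; ring
    have h5 : (4 * A ^ 3 * Q * (δ * s)) * l2 v ≤ 1 * l2 v := by gcongr
    rw [one_div, inv_mul_le_iff₀ (by positivity)]
    nlinarith
  have hunit : IsUnit Hh := isUnit_of_lower (by positivity) hlow
  set Z := Bh * pinv Hh - SW⁻¹ * M with hZ
  -- Multiplication by `Hh` removes the inverse and leaves an expression linear in the two errors,
  -- since Σ_W⁻¹M H = B.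
  have hZH : Z * Hh = Δ + SW⁻¹ * M * (H - Hh) := by
    have hdm : SW⁻¹ * M * H = B := h.direction_mul_residual hB
    rw [hZ, Matrix.sub_mul, Matrix.mul_assoc, pinv_mul_self hunit, Matrix.mul_one,
      Matrix.mul_sub (SW⁻¹ * M) H Hh, hdm, hΔ]
    abel
  have hQ0 : 0 ≤ Q - a := by
    rw [hQ]
    have : 0 ≤ a * A ^ 6 + q * (2 * A ^ 3 + 1) * (2 * A ^ 3 + q) := by positivity
    linarith
  have hN : ‖Z * Hh‖ ≤ (q + A ^ 2 * a + A ^ 2 * Q) * δ / s := by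
    rw [hZH, hdiff, Matrix.mul_add]
    have hdir := h.frob_direction_le
    have t1 := norm_add_le Δ (SW⁻¹ * M * (diagonal w - diagonal wh) +
      SW⁻¹ * M * (Bhᵀ * S * Bh - Bᵀ * Sx * B))
    have t2 := norm_add_le (SW⁻¹ * M * (diagonal w - diagonal wh))
      (SW⁻¹ * M * (Bhᵀ * S * Bh - Bᵀ * Sx * B))
    -- The operator norm of the diagonal is needed here. Its Frobenius bound `hw'` would lose a
    -- factor √L.
    have t3 : ‖SW⁻¹ * M * (diagonal w - diagonal wh)‖ ≤ s * A ^ 2 * (a * δ / L) := by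
      refine (hw.frob_mul_le' _).trans ?_
      gcongr
    have t4 : ‖SW⁻¹ * M * (Bhᵀ * S * Bh - Bᵀ * Sx * B)‖ ≤ s * A ^ 2 * (Q * δ / L) := by
      refine (frobenius_norm_mul _ _).trans ?_
      refine mul_le_mul hdir (hT.trans ?_) (norm_nonneg _) (by positivity)
      gcongr
      linarith
    have e : q * δ / s + (s * A ^ 2 * (a * δ / L) + s * A ^ 2 * (Q * δ / L)) =
        (q + A ^ 2 * a + A ^ 2 * Q) * δ / s := by
      rw [← hs2]; field_simp; ring
    linarith
  have hsymm : Hhᵀ = Hh := by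
    rw [hHh, transpose_sub, diagonal_transpose, transpose_mul, transpose_mul, transpose_transpose,
      hSs, Matrix.mul_assoc]
  -- The lower bound acts on columns, so it is applied to `Zᵀ`, using that `Hh` is symmetric.
  have hfin := l2_mulVec_lower_frob (by positivity) hlow Zᵀ
  rw [← hsymm, ← transpose_mul, frobenius_norm_transpose, frobenius_norm_transpose, one_div,
    inv_mul_le_iff₀ (by positivity)] at hfin
  calc ‖Z‖ ≤ 4 * A ^ 3 * L * ‖Z * Hh‖ := hfin
    _ ≤ 4 * A ^ 3 * L * ((q + A ^ 2 * a + A ^ 2 * Q) * δ / s) := by gcongr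
    _ = _ := by rw [← hs2]; field_simp

end Direction

end DirectionPerturbation

/-! ### Estimated discriminant functions -/

section Discriminants

attribute [local instance] Matrix.frobeniusNormedAddCommGroup Matrix.frobeniusNormedSpace

/-- The event on which the sample moments are close to the population moments. -/
structure GoodData {n p L : ℕ} (a e f : ℝ) (w : Fin L → ℝ) (M : Matrix (Fin p) (Fin L) ℝ)
    (SW : Matrix (Fin p) (Fin p) ℝ) (D : Fin n → EuclideanSpace ℝ (Fin p) × Fin L) : Prop where
  cov : OpBound (sampleCov D - (SW + M * diagonal w * Mᵀ)) (a * e)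
  cross : OpBound (sampleCross D - M * diagonal w) (a * e / √L)
  weight : ∀ l, |pihat D l - w l| ≤ a * f / √L
  proj : ∀ l, |(sampleCross D - M * diagonal w).col l ⬝ᵥ (SW⁻¹ * M).col l| ≤ a * f / √L

/-- Error of the estimated directions. -/
def dirError {n p L : ℕ} (M : Matrix (Fin p) (Fin L) ℝ) (SW : Matrix (Fin p) (Fin p) ℝ)
    (D : Fin n → EuclideanSpace ℝ (Fin p) × Fin L) (Bh : Matrix (Fin p) (Fin L) ℝ) :
    Matrix (Fin p) (Fin L) ℝ :=
  Bh * pinv (Hhat D Bh) - SW⁻¹ * M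

/-- Error of the estimated intercepts. -/
def interceptError {n p L : ℕ} (w : Fin L → ℝ) (M : Matrix (Fin p) (Fin L) ℝ)
    (SW : Matrix (Fin p) (Fin p) ℝ) (D : Fin n → EuclideanSpace ℝ (Fin p) × Fin L)
    (Bh : Matrix (Fin p) (Fin L) ℝ) (l : Fin L) : ℝ :=
  (Mhat D).col l ⬝ᵥ (Bh * pinv (Hhat D Bh)).col l - M.col l ⬝ᵥ (SW⁻¹ * M).col l -
    2 * (Real.log (pihat D l) - Real.log (w l))

/-- The perturbation is affine in x, hence Gaussian given the class, which is the form that the risk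
bound takes as input. -/
theorem discrHat_sub_discr {n p L : ℕ} (w : Fin L → ℝ) (M : Matrix (Fin p) (Fin L) ℝ)
    (SW : Matrix (Fin p) (Fin p) ℝ) (D : Fin n → EuclideanSpace ℝ (Fin p) × Fin L)
    (Bh : Matrix (Fin p) (Fin L) ℝ) (x : EuclideanSpace ℝ (Fin p)) (l : Fin L) :
    discrHat D Bh x l - discr M (SW⁻¹ * M) w x l =
      interceptError w M SW D Bh l - 2 * (x.ofLp ⬝ᵥ (dirError M SW D Bh).col l) := by
  have : (dirError M SW D Bh).col l =
      (Bh * pinv (Hhat D Bh)).col l - (SW⁻¹ * M).col l := rfl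
  rw [discrHat, discr, discr, interceptError, this, dotProduct_sub]
  ring

theorem sampleCov_transpose {n p L : ℕ} (D : Fin n → EuclideanSpace ℝ (Fin p) × Fin L) :
    (sampleCov D)ᵀ = sampleCov D := by
  rw [sampleCov, transpose_smul, transpose_mul, transpose_transpose]

/-- The inequality log z ≤ z - 1 at z = x/y and z = y/x gives the two sides. The hypothesis keeps x
above y/2. -/
theorem abs_log_sub_log_le {x y : ℝ} (hy : 0 < y) (h : |x - y| ≤ y / 2) :
    |Real.log x - Real.log y| ≤ 2 * |x - y| / y := by
  have hx : y / 2 ≤ x := by linarith [(abs_le.mp h).1]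
  have hx0 : 0 < x := by linarith
  rw [abs_le]
  constructor
  · have h1 := Real.log_le_sub_one_of_pos (div_pos hy hx0)
    rw [Real.log_div hy.ne' hx0.ne'] at h1
    have h2 : y / x - 1 ≤ 2 * |x - y| / y := by
      have : y / x - 1 = (y - x) / x := by field_simp
      rw [this, div_le_div_iff₀ hx0 hy]
      have h3 : y - x ≤ |x - y| := by rw [abs_sub_comm]; exact le_abs_self _
      nlinarith [abs_nonneg (x - y)]
    linarith
  · have h1 := Real.log_le_sub_one_of_pos (div_pos hx0 hy)
    rw [Real.log_div hx0.ne' hy.ne'] at h1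
    have h2 : x / y - 1 ≤ 2 * |x - y| / y := by
      have : x / y - 1 = (x - y) / y := by field_simp
      rw [this]
      gcongr
      linarith [le_abs_self (x - y), abs_nonneg (x - y)]
    linarith

variable {n p L : ℕ} {A : ℝ} {w : Fin L → ℝ} {M : Matrix (Fin p) (Fin L) ℝ}
  {SW : Matrix (Fin p) (Fin p) ℝ}

theorem mul_diagonal_col (M : Matrix (Fin p) (Fin L) ℝ) (w : Fin L → ℝ) (l : Fin L) :
    (M * diagonal w).col l = w l • M.col l := by
  ext i; simp [mul_comm]

/-- The normal equations write the noise as the cross deviation minus the covariance deviation times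
B, of order e/√L. `hae` leaves the sample covariance half of its lower eigenvalue bound, so the
oracle inequality applies with κ = 1/(2A), and `hl` is its requirement that the penalty dominate the
squared noise. -/
theorem Regular.frob_error_le (h : Regular A w M SW)
    {D : Fin n → EuclideanSpace ℝ (Fin p) × Fin L} {Bh : Matrix (Fin p) (Fin L) ℝ}
    {a e f lam K₁ : ℝ} (hn : 0 < n) (he : 0 ≤ e) (hK : 0 ≤ K₁)
    (hD : GoodData a e f w M SW D) (hae : 2 * A * (a * e) ≤ 1)
    (hl : 4 * A * (a * (1 + A ^ 3)) ^ 2 * (e ^ 2 / L) ≤ lam) (hu : lam ≤ K₁ * (e ^ 2 / L))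
    (hBh : IsReducedRank lam D Bh) :
    ‖Bh - regMatrix (law w M SW)‖ ≤
      √(8 * A * K₁) * (e * √((regMatrix (law w M SW)).rank : ℝ)) / √L := by
  set B := regMatrix (law w M SW)
  have hA := h.one_le
  have hL := h.card_pos
  have hb := hBh.basic_inequality hn B
  have hF : OpBound (sampleCross D - sampleCov D * B) (a * (1 + A ^ 3) * e / √L) := by
    have e1 : sampleCross D - sampleCov D * B = (sampleCross D - M * diagonal w) -
        (sampleCov D - (SW + M * diagonal w * Mᵀ)) * B := by
      rw [Matrix.sub_mul, h.normal_equations]; abel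
    rw [e1]
    refine (hD.cross.sub (hD.cov.mul ((opBound_frob B).mono h.frob_regMatrix_le))).mono ?_
    apply le_of_eq; ring
  have hS : ∀ v, (2 * A)⁻¹ * l2 v ^ 2 ≤ v ⬝ᵥ sampleCov D *ᵥ v := by
    intro v
    have h1 := h.quad_cov_lower v
    have h2 := hD.cov.bilin v v
    rw [sub_mulVec, dotProduct_sub] at h2
    have h3 := (abs_le.mp h2).1
    have h4 : a * e ≤ (2 * A)⁻¹ := by rw [← one_div, le_div_iff₀ (by positivity)]; linarith
    have h5 : a * e * l2 v * l2 v ≤ (2 * A)⁻¹ * l2 v ^ 2 := by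
      rw [mul_assoc, ← sq]; gcongr
    have h6 : A⁻¹ = 2 * (2 * A)⁻¹ := by field_simp
    rw [h6] at h1
    linarith
  have hlam : 2 * (a * (1 + A ^ 3) * e / √L) ^ 2 ≤ (2 * A)⁻¹ * lam := by
    rw [div_pow, Real.sq_sqrt hL.le, le_inv_mul_iff₀ (by positivity)]
    refine le_trans (le_of_eq ?_) hl
    ring
  have hfin := sq_frob_le_of_basic_inequality (by positivity) hS hF hlam hb
  rw [inv_mul_le_iff₀ (by positivity)] at hfin
  have h7 : ‖Bh - B‖ ^ 2 ≤ 8 * A * K₁ * (e * √(B.rank : ℝ)) ^ 2 / L := by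
    refine hfin.trans ?_
    rw [mul_pow, Real.sq_sqrt (by positivity)]
    calc 2 * A * (4 * lam * B.rank) ≤ 2 * A * (4 * (K₁ * (e ^ 2 / L)) * B.rank) := by gcongr
      _ = _ := by ring
  have h8 : 8 * A * K₁ * (e * √(B.rank : ℝ)) ^ 2 / L ≤
      (√(8 * A * K₁) * (e * √(B.rank : ℝ)) / √L) ^ 2 := by
    rw [div_pow, mul_pow (√(8 * A * K₁)), Real.sq_sqrt hL.le, Real.sq_sqrt (by positivity)]
  exact le_of_sq_le_sq (h7.trans h8) (by positivity)

/-- Bound on the error of the estimated intercepts. -/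
theorem Regular.intercept_le (h : Regular A w M SW)
    {D : Fin n → EuclideanSpace ℝ (Fin p) × Fin L} {Bh : Matrix (Fin p) (Fin L) ℝ}
    {a e f : ℝ} (hn : 0 < n) (ha : 0 ≤ a) (hf : 0 ≤ f) (hD : GoodData a e f w M SW D)
    (h1 : 2 * A * a * (f * √L) ≤ 1) (h2 : a * e * √L ≤ 1) (l : Fin L) :
    0 < pihat D l ∧ |interceptError w M SW D Bh l| ≤
      (2 * A * a * (1 + A ^ 3) + 4 * A * a) * (f * √L) +
        2 * A * (A ^ 2 + 1) * l2 ((dirError M SW D Bh).col l) := by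
  have hA := h.one_le
  have hL := h.card_pos
  set s := √(L : ℝ) with hs
  have hs2 : s * s = L := Real.mul_self_sqrt hL.le
  have hs0 : 0 < s := Real.sqrt_pos.mpr hL
  have hwl : ∀ l, 1 / (A * L) ≤ w l := fun l => by
    rw [div_le_iff₀ (by positivity), mul_comm]; exact h.weight_lower l
  have hfs : ∀ l, a * f / s ≤ w l / 2 := by
    intro l
    have : a * f / s ≤ 1 / (A * L) / 2 := by
      rw [← hs2, div_le_div_iff₀ hs0 (by norm_num), one_div, mul_comm _ s, ← div_eq_mul_inv,
        le_div_iff₀ (by positivity)]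
      calc a * f * 2 * (A * (s * s)) = (2 * A * a * (f * s)) * s := by ring
        _ ≤ 1 * s := by gcongr
        _ = s := one_mul s
    linarith [hwl l]
  have hdev : ∀ l, |pihat D l - w l| ≤ w l / 2 := fun l => (hD.weight l).trans (hfs l)
  have hpi : ∀ l, 1 / (2 * A * L) ≤ pihat D l := by
    intro l
    have h3 := (abs_le.mp (hdev l)).1
    have h4 := hwl l
    have : 1 / (2 * A * L) = 1 / (A * L) / 2 := by field_simp
    linarith
  have hpos : ∀ l, 0 < pihat D l := fun l => lt_of_lt_of_le (by positivity) (hpi l)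
  refine ⟨hpos l, ?_⟩
  have hcol := pihat_smul_Mhat_col D hn hpos l
  have hinv : ∀ x y : ℝ, pihat D l * x ≤ y → 0 ≤ y → x ≤ 2 * A * L * y := by
    intro x y hxy hy
    have : x ≤ y / pihat D l := by rw [le_div_iff₀ (hpos l), mul_comm]; exact hxy
    refine this.trans ?_
    rw [div_le_iff₀ (hpos l)]
    have h5 := hpi l
    rw [div_le_iff₀ (by positivity)] at h5
    nlinarith
  have hlog : |Real.log (pihat D l) - Real.log (w l)| ≤ 2 * A * a * (f * s) := by
    refine (abs_log_sub_log_le (h.weight_pos l) (hdev l)).trans ?_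
    rw [div_le_iff₀ (h.weight_pos l)]
    have h3 := hD.weight l
    have h4 := hwl l
    calc 2 * |pihat D l - w l| ≤ 2 * (a * f / s) := by gcongr
      _ = 2 * A * a * (f * s) * (1 / (A * L)) := by rw [← hs2]; field_simp
      _ ≤ _ := by gcongr
  -- The class mean matters only along the fixed direction Σ_W⁻¹μ_l, so the scalar bound `proj`
  -- gives order f√L. The norm of the whole mean error would cost e√L per class. What remains pairs
  -- the bounded vector μ̂_l with the direction error.
  have hb1 : |((Mhat D).col l - M.col l) ⬝ᵥ (SW⁻¹ * M).col l| ≤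
      2 * A * a * (1 + A ^ 3) * (f * s) := by
    have e1 : pihat D l * (((Mhat D).col l - M.col l) ⬝ᵥ (SW⁻¹ * M).col l) =
        (sampleCross D - M * diagonal w).col l ⬝ᵥ (SW⁻¹ * M).col l -
          (pihat D l - w l) * (M.col l ⬝ᵥ (SW⁻¹ * M).col l) := by
      have : (sampleCross D - M * diagonal w).col l =
        (sampleCross D).col l - (M * diagonal w).col l := rfl
      rw [this, ← hcol, mul_diagonal_col]
      simp only [sub_dotProduct, smul_dotProduct, smul_eq_mul]
      ring
    have h5 : |M.col l ⬝ᵥ (SW⁻¹ * M).col l| ≤ A ^ 3 := by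
      refine (abs_dotProduct_le _ _).trans ?_
      have := mul_le_mul (h.l2_col_le l) (h.l2_direction_le l) (l2_nonneg _) (by positivity)
      linarith
    have h6 : pihat D l * |((Mhat D).col l - M.col l) ⬝ᵥ (SW⁻¹ * M).col l| ≤
        a * f / s * (1 + A ^ 3) := by
      rw [← abs_of_pos (hpos l), ← abs_mul, e1]
      refine (abs_sub _ _).trans ?_
      rw [abs_mul]
      have := mul_le_mul (hD.weight l) h5 (abs_nonneg _) (by positivity)
      linarith [hD.proj l]
    refine (hinv _ _ h6 (by positivity)).trans (le_of_eq ?_)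
    rw [← hs2]; field_simp
  have hb2 : l2 ((Mhat D).col l) ≤ 2 * A * (A ^ 2 + 1) := by
    have h5 : l2 ((sampleCross D - M * diagonal w).col l) ≤ a * e / s := by
      have := hD.cross.l2_mulVec_le (Pi.single l 1)
      rw [mulVec_single_one] at this
      have hsing : l2 (Pi.single l (1 : ℝ)) = 1 := by simp [l2]
      rwa [hsing, mul_one] at this
    have e1 : pihat D l • (Mhat D).col l =
        (sampleCross D - M * diagonal w).col l + w l • M.col l := by
      rw [hcol, ← mul_diagonal_col]
      ext i; simp
    have h6 : pihat D l * l2 ((Mhat D).col l) ≤ (A ^ 2 + 1) / L := by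
      rw [← abs_of_pos (hpos l), ← l2_smul, e1]
      refine (l2_add_le _ _).trans ?_
      rw [l2_smul, abs_of_pos (h.weight_pos l)]
      have h7 : w l ≤ A / L := by rw [le_div_iff₀ hL, mul_comm]; exact h.weight_upper l
      have h8 : w l * l2 (M.col l) ≤ A / L * A := by
        have := h.l2_col_le l
        gcongr
      have h9 : a * e / s ≤ 1 / L := by
        rw [← hs2, div_le_div_iff₀ hs0 (by positivity)]
        nlinarith
      have : (A ^ 2 + 1) / L = 1 / L + A / L * A := by ring
      linarith
    refine (hinv _ _ h6 (by positivity)).trans (le_of_eq ?_)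
    field_simp
  have e2 : interceptError w M SW D Bh l = ((Mhat D).col l - M.col l) ⬝ᵥ (SW⁻¹ * M).col l +
      (Mhat D).col l ⬝ᵥ (dirError M SW D Bh).col l -
      2 * (Real.log (pihat D l) - Real.log (w l)) := by
    have : (dirError M SW D Bh).col l =
      (Bh * pinv (Hhat D Bh)).col l - (SW⁻¹ * M).col l := rfl
    rw [interceptError, this, dotProduct_sub, sub_dotProduct]
    ring
  have hb3 : |(Mhat D).col l ⬝ᵥ (dirError M SW D Bh).col l| ≤
      2 * A * (A ^ 2 + 1) * l2 ((dirError M SW D Bh).col l) := by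
    refine (abs_dotProduct_le _ _).trans ?_
    gcongr
  rw [e2]
  refine (abs_sub _ _).trans ?_
  rw [abs_mul, abs_two]
  have := abs_add_le (((Mhat D).col l - M.col l) ⬝ᵥ (SW⁻¹ * M).col l)
    ((Mhat D).col l ⬝ᵥ (dirError M SW D Bh).col l)
  linarith

theorem sum_sq_le_of_abs_le {α z : Fin L → ℝ} (c₁ c₂ x : ℝ) (h : ∀ l, |α l| ≤ c₁ * x + c₂ * z l) :
    ∑ l, α l ^ 2 ≤ 2 * c₁ ^ 2 * (L * x ^ 2) + 2 * c₂ ^ 2 * ∑ l, z l ^ 2 := by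
  calc ∑ l, α l ^ 2 ≤ ∑ l, (2 * c₁ ^ 2 * x ^ 2 + 2 * c₂ ^ 2 * z l ^ 2) := by
        refine Finset.sum_le_sum fun l _ => ?_
        rw [← sq_abs]
        refine (pow_le_pow_left₀ (abs_nonneg _) (h l) 2).trans ?_
        nlinarith [sq_nonneg (c₁ * x - c₂ * z l)]
    _ = _ := by
        rw [Finset.sum_add_distrib, Finset.sum_const, Finset.card_univ, Fintype.card_fin,
          nsmul_eq_mul, ← Finset.mul_sum]
        ring

set_option maxHeartbeats 1000000 in
/-- Deterministic error bound for the estimated discriminant functions on the good event. -/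
theorem exists_discriminant_error_bound (A a K₁ : ℝ) (hA : 1 ≤ A) (ha : 0 ≤ a) (hK : 0 ≤ K₁) :
    ∃ ε Q : ℝ, 0 < ε ∧ 0 < Q ∧ ∀ (n p L : ℕ) (w : Fin L → ℝ) (M : Matrix (Fin p) (Fin L) ℝ)
      (SW : Matrix (Fin p) (Fin p) ℝ) (D : Fin n → EuclideanSpace ℝ (Fin p) × Fin L)
      (lam e f t : ℝ), 0 < n → Regular A w M SW →
      0 ≤ e → 0 ≤ f → f * √L ≤ e →
      t = e * √((regMatrix (law w M SW)).rank : ℝ) * √L → t ≤ ε →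
      4 * A * (a * (1 + A ^ 3)) ^ 2 * (e ^ 2 / L) ≤ lam → lam ≤ K₁ * (e ^ 2 / L) →
      GoodData a e f w M SW D →
      (∀ l, 0 < pihat D l) ∧ ∀ Bh, IsReducedRank lam D Bh →
        ∑ l, (interceptError w M SW D Bh l ^ 2 + l2 ((dirError M SW D Bh).col l) ^ 2) ≤
          Q * t ^ 2 := by
  set q := √(8 * A * K₁) with hq
  set Q₀ := a * A ^ 6 + q * (2 * A ^ 3 + 1) * (2 * A ^ 3 + q) + a with hQ₀
  have hQ₀0 : 0 ≤ Q₀ := by positivity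
  -- The single inequality E t ≤ 1 implies all the smallness conditions needed: δ ≤ 1, 2Aat ≤ 1 and
  -- 4A³Q₀t ≤ 1.
  set E := 1 + 2 * A * a + 4 * A ^ 3 * Q₀ with hE
  have hE1 : 1 ≤ E := by
    have : 0 ≤ 2 * A * a + 4 * A ^ 3 * Q₀ := by positivity
    linarith
  set c₁ := 2 * A * a * (1 + A ^ 3) + 4 * A * a with hc₁
  set c₂ := 2 * A * (A ^ 2 + 1) with hc₂
  set c₃ := 4 * A ^ 3 * (q + A ^ 2 * a + A ^ 2 * Q₀) with hc₃
  have hc₁0 : 0 ≤ c₁ := by positivity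
  have hc₂0 : 0 ≤ c₂ := by positivity
  have hc₃0 : 0 ≤ c₃ := by positivity
  refine ⟨1 / E, 2 * c₁ ^ 2 + (2 * c₂ ^ 2 + 1) * c₃ ^ 2 + 1, by positivity, by positivity, ?_⟩
  intro n p L w M SW D lam e f t hn h he hf hfe ht htε hl hu hD
  have hL := h.card_pos
  have hL1 : (1 : ℝ) ≤ L := by have := h.two_le; exact_mod_cast (by omega : 1 ≤ L)
  have hs1 : 1 ≤ √(L : ℝ) := Real.one_le_sqrt.mpr hL1
  set r := (regMatrix (law w M SW)).rank
  have hr1 : 1 ≤ √(r : ℝ) := Real.one_le_sqrt.mpr (by exact_mod_cast h.one_le_rank)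
  set δ := e * √(r : ℝ) with hδ
  have hδ0 : 0 ≤ δ := by positivity
  have heδ : e ≤ δ := le_mul_of_one_le_right he hr1
  have hδt : δ ≤ t := by rw [ht]; exact le_mul_of_one_le_right hδ0 hs1
  have ht0 : 0 ≤ t := hδ0.trans hδt
  have hEt : E * t ≤ 1 := by rwa [le_div_iff₀ (by linarith), mul_comm] at htε
  have hsplit : t + 2 * A * a * t + 4 * A ^ 3 * Q₀ * t ≤ 1 := by
    calc _ = E * t := by rw [hE]; ring
      _ ≤ 1 := hEt
  have hp1 : 0 ≤ 2 * A * a * t := by positivity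
  have hp2 : 0 ≤ 4 * A ^ 3 * Q₀ * t := by positivity
  have hAa : a ≤ 2 * A * a := by nlinarith
  have hat : a * t ≤ 1 := by linarith [mul_le_mul_of_nonneg_right hAa ht0]
  have haδ : a * δ ≤ 1 := (mul_le_mul_of_nonneg_left hδt ha).trans hat
  have hes : e * √L ≤ t := by rw [ht]; gcongr
  have hkey := fun Bh => h.intercept_le (Bh := Bh) hn ha hf hD
    (by
      calc 2 * A * a * (f * √L) ≤ 2 * A * a * t := by
            gcongr; exact hfe.trans (heδ.trans hδt)
        _ ≤ 1 := by linarith)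
    (by rw [mul_assoc]; exact (mul_le_mul_of_nonneg_left hes ha).trans hat)
  -- Positivity of π̂ does not involve the estimator, so any matrix, here 0, gives it.
  refine ⟨fun l => (hkey 0 l).1, fun Bh hBh => ?_⟩
  replace hkey := hkey Bh
  have hBhn : ‖Bh - regMatrix (law w M SW)‖ ≤ q * δ / √L :=
    h.frob_error_le hn he hK hD
      (by
        calc 2 * A * (a * e) ≤ 2 * A * (a * t) := by gcongr; exact heδ.trans hδt
          _ ≤ 1 := by linarith) hl hu hBh
  have hfL : a * f / √L ≤ a * δ / L := by
    have hs2 : √(L : ℝ) * √L = L := Real.mul_self_sqrt hL.le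
    have e1 : a * f / √L = a * (f * √L) / L := by
      rw [div_eq_div_iff (by positivity) hL.ne']
      linear_combination (-(a * f)) * hs2
    rw [e1]
    gcongr
    exact hfe.trans heδ
  have hZ : ‖dirError M SW D Bh‖ ≤ c₃ * t := by
    have hwdiag : diagonal w - diagonal (pihat D) = diagonal (fun l => w l - pihat D l) := by
      rw [diagonal_sub]
    have := h.direction_error (Bh := Bh) (S := sampleCov D) (wh := pihat D) (a := a) (q := q)
      (δ := δ) h.normal_equations ha (by positivity) (sampleCov_transpose D) hδ0
      (by linarith) haδ h.frob_regMatrix_le (hD.cov.mono (by gcongr))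
      (by
        rw [hwdiag]
        refine opBound_diagonal (by positivity) fun l => ?_
        rw [abs_sub_comm]
        exact (hD.weight l).trans hfL)
      (by
        rw [hwdiag]
        refine (frob_le_of_col _ (t := a * f / √L) (by positivity) fun l => ?_).trans ?_
        · have : (diagonal fun l => w l - pihat D l).col l = Pi.single l (w l - pihat D l) := by
            ext i
            rw [col_apply, diagonal_apply, Pi.single_apply]
            by_cases hil : i = l <;> simp [hil]
          have h2 : l2 (Pi.single l (w l - pihat D l)) = |w l - pihat D l| := by simp [l2]
          rw [this, h2, abs_sub_comm]
          exact hD.weight l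
        · rw [mul_div_cancel₀ _ (by positivity), le_div_iff₀ (by positivity), mul_assoc]
          gcongr
          exact hfe.trans heδ)
      hBhn rfl
      (by
        have : δ * √L = t := ht.symm
        rw [this]; linarith)
    rw [← Hhat_eq, ← ht] at this
    exact this
  rw [Finset.sum_add_distrib, ← frob_sq_col]
  have hZ2 : ‖dirError M SW D Bh‖ ^ 2 ≤ c₃ ^ 2 * t ^ 2 := by
    rw [← mul_pow]; gcongr
  -- Summing (f√L)² over the L classes gives at most L e² ≤ t², because f√L ≤ e.
  have hα : ∑ l, interceptError w M SW D Bh l ^ 2 ≤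
      2 * c₁ ^ 2 * t ^ 2 + 2 * c₂ ^ 2 * ‖dirError M SW D Bh‖ ^ 2 := by
    refine (sum_sq_le_of_abs_le c₁ c₂ (f * √L) fun l => (hkey l).2).trans ?_
    rw [← frob_sq_col]
    gcongr
    have : (f * √L) ^ 2 ≤ e ^ 2 := by gcongr
    calc L * (f * √L) ^ 2 ≤ L * e ^ 2 := by gcongr
      _ = (e * √L) ^ 2 := by rw [mul_pow, Real.sq_sqrt hL.le]; ring
      _ ≤ t ^ 2 := by gcongr
  have h9 := mul_le_mul_of_nonneg_left hZ2 (by positivity : 0 ≤ 2 * c₂ ^ 2 + 1)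
  linarith [sq_nonneg t]

end Discriminants

/-! ### Excess risk under perturbed discriminant functions -/

section Risk

attribute [local instance] Matrix.frobeniusNormedAddCommGroup Matrix.frobeniusNormedSpace

variable {p L : ℕ} {A : ℝ} {w : Fin L → ℝ} {M : Matrix (Fin p) (Fin L) ℝ}
  {SW : Matrix (Fin p) (Fin p) ℝ}

theorem map_affine {m : EuclideanSpace ℝ (Fin p)} (hS : SW.PosSemidef) (c : ℝ) (u : Fin p → ℝ) :
    (multivariateGaussian m SW).map (fun x => c + x.ofLp ⬝ᵥ u) =
      gaussianReal (c + m.ofLp ⬝ᵥ u) (u ⬝ᵥ SW *ᵥ u).toNNReal := by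
  have : (fun x : EuclideanSpace ℝ (Fin p) => c + x.ofLp ⬝ᵥ u) =
    (fun y => c + y) ∘ fun x => x.ofLp ⬝ᵥ u := rfl
  rw [this, ← Measure.map_map (by fun_prop) (measurable_dotProduct u), map_dotProduct hS,
    gaussianReal_map_const_add, add_comm]

/-- Splitting both success probabilities according to the pair of decisions attaches to each cell
the cost of deciding l instead of k. -/
theorem excessRisk_eq_sum (hw : ∀ l, 0 ≤ w l) {gs g : EuclideanSpace ℝ (Fin p) → Fin L}
    (hgs : Measurable gs) (hg : Measurable g) :
    excessRisk (law w M SW) gs g = ∑ k, ∑ l,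
      (w k * (cond M SW k).real {x | gs x = k ∧ g x = l} -
        w l * (cond M SW l).real {x | gs x = k ∧ g x = l}) := by
  have hset : ∀ (f : EuclideanSpace ℝ (Fin p) → Fin L), Measurable f → ∀ k,
      MeasurableSet {x | f x = k} := fun f hf k => hf (measurableSet_singleton k)
  have herr : ∀ f : EuclideanSpace ℝ (Fin p) → Fin L, Measurable f →
      (law w M SW).real {z | z.2 ≠ f z.1} =
        ∑ k, w k * (1 - (cond M SW k).real {x | f x = k}) := by
    intro f hf
    have hm : MeasurableSet {z : EuclideanSpace ℝ (Fin p) × Fin L | z.2 ≠ f z.1} :=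
      (measurableSet_eq_fun measurable_snd (hf.comp measurable_fst)).compl
    rw [measureReal_law hw hm]
    refine Finset.sum_congr rfl fun k _ => ?_
    rw [← probReal_compl_eq_one_sub (hset f hf k)]
    congr 2
    ext x
    simp [eq_comm]
  have h1 : ∀ k, (cond M SW k).real {x | gs x = k} =
      ∑ l, (cond M SW k).real {x | gs x = k ∧ g x = l} := by
    intro k
    rw [← measureReal_biUnion_finset]
    · congr 1; ext x; simp
    · intro l _ l' _ hll
      refine Set.disjoint_left.mpr fun x hx hx' => hll ?_
      exact hx.2.symm.trans hx'.2
    · exact fun l _ => (hset gs hgs k).inter (hset g hg l)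
  have h2 : ∀ l, (cond M SW l).real {x | g x = l} =
      ∑ k, (cond M SW l).real {x | gs x = k ∧ g x = l} := by
    intro l
    rw [← measureReal_biUnion_finset]
    · congr 1; ext x; simp
    · intro k _ k' _ hkk
      refine Set.disjoint_left.mpr fun x hx hx' => hkk ?_
      exact hx.1.symm.trans hx'.1
    · exact fun k _ => (hset gs hgs k).inter (hset g hg l)
  rw [excessRisk, herr g hg, herr gs hgs, ← Finset.sum_sub_distrib]
  simp only [Finset.sum_sub_distrib]
  rw [Finset.sum_comm (f := fun k l => w l * (cond M SW l).real {x | gs x = k ∧ g x = l})]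
  simp only [← Finset.mul_sum, ← h1, ← h2]
  rw [← Finset.sum_sub_distrib, ← Finset.sum_sub_distrib]
  exact Finset.sum_congr rfl fun k _ => by ring

theorem Regular.symm_form (h : Regular A w M SW) (k l : Fin L) :
    M.col k ⬝ᵥ (SW⁻¹ * M).col l = M.col l ⬝ᵥ (SW⁻¹ * M).col k := by
  have e : ∀ l, (SW⁻¹ * M).col l = SW⁻¹ *ᵥ M.col l := fun l => rfl
  rw [e, e, dotProduct_mulVec, ← mulVec_transpose, h.inv_symm, dotProduct_comm]

/-- The density of the joint law of `(X, Y = l)` relative to that of `(X, Y = k)`. -/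
theorem Regular.weight_mul_cond (h : Regular A w M SW) (k l : Fin L)
    {s : Set (EuclideanSpace ℝ (Fin p))} (hs : MeasurableSet s) :
    IntegrableOn (fun x => Real.exp (-(discr M (SW⁻¹ * M) w x l - discr M (SW⁻¹ * M) w x k) / 2)) s
      (cond M SW k) ∧
    w l * (cond M SW l).real s = w k * ∫ x in s,
      Real.exp (-(discr M (SW⁻¹ * M) w x l - discr M (SW⁻¹ * M) w x k) / 2) ∂(cond M SW k) := by
  have hS := h.posDef.posSemidef
  -- The tilt by this direction moves the mean μ_k to μ_l. Its normalising constant and the ratio of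
  -- weights complete the difference of discriminants.
  set u := (SW⁻¹ * M).col l - (SW⁻¹ * M).col k with hu
  have hu2 : SW *ᵥ u = M.col l - M.col k := by
    have e : ∀ l, (SW⁻¹ * M).col l = SW⁻¹ *ᵥ M.col l := fun l => rfl
    rw [hu, e, e, ← mulVec_sub, mulVec_mulVec, h.mul_inv, one_mulVec]
  have hmean : (WithLp.toLp 2 (M.col k) : EuclideanSpace ℝ (Fin p)) + WithLp.toLp 2 (SW *ᵥ u) =
      WithLp.toLp 2 (M.col l) := by
    rw [hu2, ← WithLp.toLp_add, add_sub_cancel]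
  have htilt := multivariateGaussian_tilted (m := WithLp.toLp 2 (M.col k)) hS u
  rw [hmean] at htilt
  have hint := integrable_exp_dotProduct (m := WithLp.toLp 2 (M.col k)) hS u
  have hE := integral_exp_dotProduct (m := WithLp.toLp 2 (M.col k)) hS u
  have hwk := h.weight_pos k
  have hwl := h.weight_pos l
  have hdens : ∀ x : EuclideanSpace ℝ (Fin p),
      Real.exp (-(discr M (SW⁻¹ * M) w x l - discr M (SW⁻¹ * M) w x k) / 2) =
      w l / w k * (Real.exp (x.ofLp ⬝ᵥ u) / ∫ x, Real.exp (x.ofLp ⬝ᵥ u) ∂(cond M SW k)) := by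
    intro x
    rw [hE, ← Real.exp_sub, ← Real.exp_log (div_pos hwl hwk), ← Real.exp_add,
      Real.log_div hwl.ne' hwk.ne']
    congr 1
    have e1 : u ⬝ᵥ SW *ᵥ u = u ⬝ᵥ (M.col l - M.col k) := by rw [hu2]
    have e2 := h.symm_form k l
    rw [e1, discr, discr, hu]
    simp only [sub_dotProduct, dotProduct_sub, dotProduct_comm ((SW⁻¹ * M).col l),
      dotProduct_comm ((SW⁻¹ * M).col k)]
    rw [e2]
    ring
  refine ⟨?_, ?_⟩
  · simp only [hdens]
    exact ((hint.div_const _).const_mul _).integrableOn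
  · simp only [hdens]
    rw [integral_const_mul, ← mul_assoc, mul_div_cancel₀ _ hwk.ne']
    congr 1
    rw [measureReal_def, cond, ← htilt, tilted_apply_eq_ofReal_integral' _ hs,
      ENNReal.toReal_ofReal]
    exact integral_nonneg fun x => div_nonneg (Real.exp_pos _).le
      (integral_nonneg fun x => (Real.exp_pos _).le)

theorem measurable_discr (Bs : Matrix (Fin p) (Fin L) ℝ) (l : Fin L) :
    Measurable fun x => discr M Bs w x l := by
  unfold discr
  have := measurable_dotProduct (p := p) (Bs.col l)
  fun_prop

/-- Contribution of one pair of classes to the excess risk. -/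
theorem Regular.pair_le (h : Regular A w M SW) {k l : Fin L} (hkl : k ≠ l)
    {s : Set (EuclideanSpace ℝ (Fin p))} (hs : MeasurableSet s) (c : ℝ) (v : Fin p → ℝ)
    (hs0 : ∀ x ∈ s, discr M (SW⁻¹ * M) w x k ≤ discr M (SW⁻¹ * M) w x l)
    (hs1 : ∀ x ∈ s, discr M (SW⁻¹ * M) w x l - discr M (SW⁻¹ * M) w x k ≤ c + x.ofLp ⬝ᵥ v)
    {ρ T : ℝ} (hρ : 0 < ρ) (hT : 0 ≤ T) (hv : v ⬝ᵥ SW *ᵥ v ≤ ρ) :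
    w k * (cond M SW k).real s - w l * (cond M SW l).real s ≤
      w k * (A * (|c + M.col k ⬝ᵥ v| + 2 * √(ρ * T)) ^ 2 + Real.exp (-(2 * T))) := by
  have hS := h.posDef.posSemidef
  have hA := h.one_le
  obtain ⟨hI, hl⟩ := h.weight_mul_cond k l hs
  rw [hl, ← mul_sub]
  refine mul_le_mul_of_nonneg_left ?_ (h.weight_nonneg k)
  set P := cond M SW k with hP
  set H := fun x => discr M (SW⁻¹ * M) w x l - discr M (SW⁻¹ * M) w x k with hH
  -- The size of the mean plus a Gaussian deviation, chosen so that the affine perturbation exceeds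
  -- t with probability at most exp(-2T).
  set t := |c + M.col k ⬝ᵥ v| + 2 * √(ρ * T) with ht
  have ht0 : 0 ≤ t := by positivity
  have hHm : Measurable H := (measurable_discr _ l).sub (measurable_discr _ k)
  set s1 := {x | H x ∈ Set.Icc 0 t} with hs1'
  set s2 := {x : EuclideanSpace ℝ (Fin p) | t ≤ c + x.ofLp ⬝ᵥ v} with hs2'
  have hs1m : MeasurableSet s1 := hHm measurableSet_Icc
  have hs2m : MeasurableSet s2 :=
    measurableSet_le measurable_const ((measurable_dotProduct v).const_add c)
  -- the two probabilities
  have hp1 : P.real s1 ≤ t * A := by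
    set u := (SW⁻¹ * M).col l - (SW⁻¹ * M).col k with hu
    have e : ∃ b : ℝ, H = fun x => b + x.ofLp ⬝ᵥ ((-2 : ℝ) • u) := by
      refine ⟨M.col l ⬝ᵥ (SW⁻¹ * M).col l - M.col k ⬝ᵥ (SW⁻¹ * M).col k - 2 * Real.log (w l) +
        2 * Real.log (w k), ?_⟩
      funext x
      simp only [hH, discr, hu, dotProduct_smul, dotProduct_sub, smul_eq_mul]
      ring
    obtain ⟨b, hb⟩ := e
    -- Separation of the classes enters here: the variance of `H` is four times the Mahalanobis
    -- distance.
    have hvar : 4 / A ≤ ((-2 : ℝ) • u) ⬝ᵥ SW *ᵥ ((-2 : ℝ) • u) := by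
      have e1 : u ⬝ᵥ SW *ᵥ u = mahal M SW l k := by
        have e : ∀ l, (SW⁻¹ * M).col l = SW⁻¹ *ᵥ M.col l := fun l => rfl
        rw [hu, e, e, ← mulVec_sub, h.quad_inv]
        rfl
      rw [mulVec_smul, dotProduct_smul, smul_dotProduct, e1, smul_eq_mul, smul_eq_mul,
        div_le_iff₀ (by linarith)]
      linarith [h.mahal_lower l k hkl.symm]
    have h2 := gaussianReal_Icc_le (m := b + M.col k ⬝ᵥ ((-2 : ℝ) • u))
      (v := (((-2 : ℝ) • u) ⬝ᵥ SW *ᵥ ((-2 : ℝ) • u)).toNNReal) (κ := 4 / A) (by positivity)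
      (by rw [Real.coe_toNNReal _ (le_trans (by positivity) hvar)]; exact hvar) ht0
    have h3 : P.real s1 = (gaussianReal (b + M.col k ⬝ᵥ ((-2 : ℝ) • u))
        (((-2 : ℝ) • u) ⬝ᵥ SW *ᵥ ((-2 : ℝ) • u)).toNNReal).real (Set.Icc 0 t) := by
      have := map_affine (m := WithLp.toLp 2 (M.col k)) hS b ((-2 : ℝ) • u)
      rw [← hb] at this
      rw [← this, map_measureReal_apply hHm measurableSet_Icc]
      rfl
    rw [h3]
    refine h2.trans ?_
    rw [div_le_iff₀ (by positivity)]
    have : 1 ≤ A * √(4 / A) := by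
      have h5 : √(4 / A) ^ 2 = 4 / A := Real.sq_sqrt (by positivity)
      have h6 : (A * √(4 / A)) ^ 2 = 4 * A := by rw [mul_pow, h5]; field_simp
      exact one_le_sq_iff₀ (by positivity) |>.mp (by rw [h6]; linarith)
    nlinarith
  have hp2 : P.real s2 ≤ Real.exp (-(2 * T)) := by
    have h2 := gaussianReal_tail_le (m := c + M.col k ⬝ᵥ v) (v := (v ⬝ᵥ SW *ᵥ v).toNNReal)
      (ρ := ρ) (t := 2 * √(ρ * T)) hρ
      (by rw [Real.coe_toNNReal _ (h.quad_nonneg v)]; exact hv) (by positivity)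
    have e : (2 * √(ρ * T)) ^ 2 / (2 * ρ) = 2 * T := by
      rw [mul_pow, Real.sq_sqrt (by positivity)]; field_simp
    rw [e] at h2
    refine le_trans (le_of_eq ?_) h2
    rw [← map_affine (m := WithLp.toLp 2 (M.col k)) hS c v]
    exact (map_measureReal_apply ((measurable_dotProduct v).const_add c) measurableSet_Ici).symm
  -- The integrand is at most H/2 ≤ t/2 when H ≤ t, and at most 1 otherwise. The first case has
  -- probability at most t A, so its contribution is quadratic in t.
  have hkey : ∫ x in s, (1 - Real.exp (-(H x) / 2)) ∂P ≤
      ∫ x, (s1.indicator (fun _ => t / 2) x + s2.indicator (fun _ => (1 : ℝ)) x) ∂P := by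
    rw [← integral_indicator hs]
    refine integral_mono (IntegrableOn.integrable_indicator ((integrable_const _).sub hI) hs)
      (((integrable_const _).indicator hs1m).add ((integrable_const _).indicator hs2m)) fun x => ?_
    by_cases hx : x ∈ s
    · rw [Set.indicator_of_mem hx]
      have a1 : 0 ≤ H x := sub_nonneg.mpr (hs0 x hx)
      by_cases hx2 : x ∈ s2
      · have i1 : 0 ≤ s1.indicator (fun _ => t / 2) x :=
          Set.indicator_nonneg (fun _ _ => by positivity) x
        simp only [Set.indicator_of_mem hx2]
        linarith [Real.exp_pos (-(H x) / 2)]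
      · have a2 : H x ≤ t := (hs1 x hx).trans (not_le.mp hx2).le
        have a3 : x ∈ s1 := ⟨a1, a2⟩
        simp only [Set.indicator_of_mem a3, Set.indicator_of_notMem hx2]
        linarith [Real.add_one_le_exp (-(H x) / 2)]
    · rw [Set.indicator_of_notMem hx]
      have i1 : 0 ≤ s1.indicator (fun _ => t / 2) x :=
        Set.indicator_nonneg (fun _ _ => by positivity) x
      have i2 : 0 ≤ s2.indicator (fun _ => (1 : ℝ)) x :=
        Set.indicator_nonneg (fun _ _ => by positivity) x
      exact add_nonneg i1 i2
  have hleft : ∫ x in s, (1 - Real.exp (-(H x) / 2)) ∂P =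
      P.real s - ∫ x in s, Real.exp (-(H x) / 2) ∂P := by
    rw [integral_sub (integrable_const _) hI]
    congr 1
    simp
  have hright : ∫ x, (s1.indicator (fun _ => t / 2) x + s2.indicator (fun _ => (1 : ℝ)) x) ∂P =
      P.real s1 * (t / 2) + P.real s2 := by
    rw [integral_add ((integrable_const _).indicator hs1m) ((integrable_const _).indicator hs2m),
      integral_indicator hs1m, integral_indicator hs2m]
    simp
  rw [hleft, hright] at hkey
  refine hkey.trans ?_
  have : P.real s1 * (t / 2) ≤ A * t ^ 2 := by
    have := mul_le_mul_of_nonneg_right hp1 (by positivity : 0 ≤ t / 2)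
    nlinarith [mul_nonneg (by linarith : 0 ≤ A) (sq_nonneg t)]
  linarith

theorem add_sq_le_two (a b : ℝ) : (a + 2 * b) ^ 2 ≤ 2 * a ^ 2 + 8 * b ^ 2 := by
  nlinarith [sq_nonneg (a - 2 * b)]

set_option maxHeartbeats 1000000 in
/-- Fast-rate bound on the excess risk of a classifier that minimises perturbed discriminant
functions, in terms of the sum of the squared perturbations. -/
theorem Regular.excessRisk_le (h : Regular A w M SW) {gs g : EuclideanSpace ℝ (Fin p) → Fin L}
    (hgs : IsBayesRule w M SW gs) (hg : Measurable g) (α : Fin L → ℝ)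
    (Z : Matrix (Fin p) (Fin L) ℝ)
    (hmin : ∀ x l, discr M (SW⁻¹ * M) w x (g x) + (α (g x) - 2 * (x.ofLp ⬝ᵥ Z.col (g x))) ≤
      discr M (SW⁻¹ * M) w x l + (α l - 2 * (x.ofLp ⬝ᵥ Z.col l)))
    {T : ℝ} (hT : 0 ≤ T) :
    excessRisk (law w M SW) gs g ≤
      128 * A ^ 4 * (1 + T) * ∑ l, (α l ^ 2 + l2 (Z.col l) ^ 2) + L * Real.exp (-(2 * T)) := by
  have hA := h.one_le
  have hL := h.card_pos
  set S := fun l => α l ^ 2 + l2 (Z.col l) ^ 2 with hSdef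
  have hS0 : ∀ l, 0 ≤ S l := fun l => by positivity
  refine le_of_forall_pos_le_add fun ε hε => ?_
  -- `pair_le` needs a positive variance bound, while `v` may vanish. The variance is enlarged by ν,
  -- whose total effect is at most the arbitrary ε.
  obtain ⟨ν, hν, hνε⟩ : ∃ ν : ℝ, 0 < ν ∧ 8 * A ^ 2 * T * L * ν ≤ ε := by
    have hc : 0 ≤ 8 * A ^ 2 * T * L := by positivity
    refine ⟨ε / (8 * A ^ 2 * T * L + 1), by positivity, ?_⟩
    rw [mul_div_assoc', div_le_iff₀ (by positivity)]
    nlinarith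
  have hwl : ∀ k, w k ≤ A / L := fun k => by
    rw [le_div_iff₀ hL, mul_comm]; exact h.weight_upper k
  have hpair : ∀ k l, w k * (cond M SW k).real {x | gs x = k ∧ g x = l} -
        w l * (cond M SW l).real {x | gs x = k ∧ g x = l} ≤
      A ^ 2 / L * (32 * A ^ 2 * (1 + 2 * T) * (S k + S l) + 8 * ν * T) +
        w k * Real.exp (-(2 * T)) := by
    intro k l
    have hrhs : 0 ≤ A ^ 2 / L * (32 * A ^ 2 * (1 + 2 * T) * (S k + S l) + 8 * ν * T) := by
      have := hS0 k
      have := hS0 l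
      positivity
    have hwk := h.weight_nonneg k
    rcases eq_or_ne k l with rfl | hkl
    · rw [sub_self]; positivity
    have hs : MeasurableSet {x | gs x = k ∧ g x = l} :=
      (hgs.1 (measurableSet_singleton k)).inter (hg (measurableSet_singleton l))
    set v := (-2 : ℝ) • (Z.col k - Z.col l) with hv
    set c := α k - α l with hc
    have hl2 : l2 v ^ 2 ≤ 8 * (l2 (Z.col k) ^ 2 + l2 (Z.col l) ^ 2) := by
      have h1 := l2_sub_le (Z.col k) (Z.col l)
      have h2 := pow_le_pow_left₀ (l2_nonneg _) h1 2
      rw [hv, l2_smul, mul_pow, abs_neg, abs_two]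
      nlinarith [sq_nonneg (l2 (Z.col k) - l2 (Z.col l))]
    set z := l2 (Z.col k) ^ 2 + l2 (Z.col l) ^ 2 with hz
    have hz0 : 0 ≤ z := by positivity
    have hvar : v ⬝ᵥ SW *ᵥ v ≤ 8 * A * z + ν := by
      have := h.quad_upper v
      nlinarith
    have hmean : (c + M.col k ⬝ᵥ v) ^ 2 ≤ 16 * A ^ 2 * (S k + S l) := by
      have h1 : (M.col k ⬝ᵥ v) ^ 2 ≤ A ^ 2 * (8 * z) := by
        rw [← sq_abs]
        have h2 := (abs_dotProduct_le (M.col k) v).trans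
          (mul_le_mul_of_nonneg_right (h.l2_col_le k) (l2_nonneg v))
        refine (pow_le_pow_left₀ (abs_nonneg _) h2 2).trans ?_
        rw [mul_pow]; gcongr
      have h2 : (c + M.col k ⬝ᵥ v) ^ 2 ≤ 2 * c ^ 2 + 2 * (M.col k ⬝ᵥ v) ^ 2 := by
        nlinarith [sq_nonneg (c - M.col k ⬝ᵥ v)]
      have h3 : c ^ 2 ≤ 2 * (α k ^ 2 + α l ^ 2) := by
        nlinarith [sq_nonneg (α k + α l)]
      have h4 : S k + S l = (α k ^ 2 + α l ^ 2) + z := by simp only [hSdef, hz]; ring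
      have hA2 : 1 ≤ A ^ 2 := one_le_pow₀ hA
      have h5 : 0 ≤ α k ^ 2 + α l ^ 2 := by positivity
      rw [h4]
      nlinarith [mul_le_mul_of_nonneg_right hA2 h5]
    have h1 := h.pair_le hkl hs c v
      (by
        rintro x ⟨hxk, hxl⟩
        have := hgs.2 x l
        rwa [hxk] at this)
      (by
        rintro x ⟨hxk, hxl⟩
        have := hmin x k
        rw [hxl] at this
        rw [hv, hc, dotProduct_smul, dotProduct_sub, smul_eq_mul]
        linarith)
      (ρ := 8 * A * z + ν) (T := T) (by positivity) hT hvar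
    refine h1.trans ?_
    rw [mul_add]
    refine add_le_add ?_ le_rfl
    have ht : (|c + M.col k ⬝ᵥ v| + 2 * √((8 * A * z + ν) * T)) ^ 2 ≤
        32 * A ^ 2 * (1 + 2 * T) * (S k + S l) + 8 * ν * T := by
      have e1 : √((8 * A * z + ν) * T) ^ 2 = (8 * A * z + ν) * T := Real.sq_sqrt (by positivity)
      have h2 : (|c + M.col k ⬝ᵥ v| + 2 * √((8 * A * z + ν) * T)) ^ 2 ≤
          2 * (c + M.col k ⬝ᵥ v) ^ 2 + 8 * ((8 * A * z + ν) * T) := by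
        have h3 := add_sq_le_two (|c + M.col k ⬝ᵥ v|) (√((8 * A * z + ν) * T))
        rwa [sq_abs, e1] at h3
      have h3 : A * z * T ≤ A ^ 2 * (S k + S l) * T := by
        have : z ≤ S k + S l := by simp only [hSdef, hz]; nlinarith [sq_nonneg (α k), sq_nonneg (α l)]
        have hAA : A ≤ A ^ 2 := le_self_pow₀ hA (by norm_num)
        gcongr
      linarith
    calc w k * (A * (|c + M.col k ⬝ᵥ v| + 2 * √((8 * A * z + ν) * T)) ^ 2)
        ≤ A / L * (A * (32 * A ^ 2 * (1 + 2 * T) * (S k + S l) + 8 * ν * T)) := by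
          have := hwl k
          gcongr
      _ = _ := by ring
  rw [excessRisk_eq_sum h.weight_nonneg hgs.1 hg]
  calc _ ≤ ∑ k, ∑ l, (A ^ 2 / L * (32 * A ^ 2 * (1 + 2 * T) * (S k + S l) + 8 * ν * T) +
        w k * Real.exp (-(2 * T))) :=
        Finset.sum_le_sum fun k _ => Finset.sum_le_sum fun l _ => hpair k l
    _ = 64 * A ^ 4 * (1 + 2 * T) * ∑ l, S l + 8 * A ^ 2 * T * L * ν + L * Real.exp (-(2 * T)) := by
        simp only [Finset.sum_add_distrib, ← Finset.mul_sum, Finset.sum_const, Finset.card_univ,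
          Fintype.card_fin, nsmul_eq_mul, ← Finset.sum_mul, h.sum_one]
        field_simp
        ring
    _ ≤ _ := by
        have h1 : 0 ≤ A ^ 4 * ∑ l, S l := mul_nonneg (by positivity) (Finset.sum_nonneg fun l _ => hS0 l)
        nlinarith

end Risk

/-! ### Exponential moments -/

section ExponentialMoments

variable {n p L : ℕ} {A : ℝ} {w : Fin L → ℝ} {M : Matrix (Fin p) (Fin L) ℝ}
  {SW : Matrix (Fin p) (Fin p) ℝ}

/-! ### First and second moments of linear functionals. -/

section Moments

variable {m : EuclideanSpace ℝ (Fin p)}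

theorem memLp_dotProduct (u : Fin p → ℝ) :
    MemLp (fun x : EuclideanSpace ℝ (Fin p) => x.ofLp ⬝ᵥ u) 2 (multivariateGaussian m SW) := by
  unfold dotProduct
  exact memLp_finsetSum _ fun i _ => (memLp_coord m i).mul_const _

theorem integral_dotProduct (u : Fin p → ℝ) :
    ∫ x, x.ofLp ⬝ᵥ u ∂(multivariateGaussian m SW) = m.ofLp ⬝ᵥ u := by
  unfold dotProduct
  rw [integral_finsetSum _ fun i _ => ((memLp_coord m i).integrable (by norm_num)).mul_const _]
  simp only [integral_mul_const, integral_coord]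

theorem integral_dotProduct_mul (hS : SW.PosSemidef) (u v : Fin p → ℝ) :
    ∫ x, (x.ofLp ⬝ᵥ u) * (x.ofLp ⬝ᵥ v) ∂(multivariateGaussian m SW) =
      u ⬝ᵥ SW *ᵥ v + (m.ofLp ⬝ᵥ u) * (m.ofLp ⬝ᵥ v) := by
  have e : ∀ x : EuclideanSpace ℝ (Fin p), (x.ofLp ⬝ᵥ u) * (x.ofLp ⬝ᵥ v) =
      ∑ i, ∑ j, (x i * x j) * (u i * v j) := by
    intro x
    simp only [dotProduct, Finset.sum_mul_sum]
    exact Finset.sum_congr rfl fun i _ => Finset.sum_congr rfl fun j _ => by ring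
  have hint : ∀ i j, Integrable (fun x : EuclideanSpace ℝ (Fin p) => (x i * x j) * (u i * v j))
      (multivariateGaussian m SW) := fun i j =>
    ((memLp_coord m i).integrable_mul (memLp_coord m j)).mul_const _
  simp only [e]
  rw [integral_finsetSum _ fun i _ => integrable_finsetSum _ fun j _ => hint i j]
  have e2 : ∀ i, ∫ x : EuclideanSpace ℝ (Fin p), ∑ j, (x i * x j) * (u i * v j)
      ∂(multivariateGaussian m SW) = ∑ j, (SW i j + m i * m j) * (u i * v j) := by
    intro i
    rw [integral_finsetSum _ fun j _ => hint i j]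
    simp only [integral_mul_const, integral_coord_mul hS]
  simp only [e2, dotProduct, mulVec, Finset.mul_sum, ← Finset.sum_add_distrib]
  exact Finset.sum_congr rfl fun i _ => Finset.sum_congr rfl fun j _ => by ring

end Moments

/-- The quadratic factor is absorbed by doubling the exponent, since z²/2 ≤ exp z for z ≥ 0. -/
theorem sq_mul_exp_le {s y : ℝ} (hs : 0 < s) :
    y ^ 2 * Real.exp (s * |y|) ≤ 2 / s ^ 2 * Real.exp (2 * s * |y|) := by
  have h1 := Real.quadratic_le_exp_of_nonneg (x := s * |y|) (by positivity)
  have h2 : y ^ 2 ≤ 2 / s ^ 2 * Real.exp (s * |y|) := by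
    rw [div_mul_eq_mul_div, le_div_iff₀ (by positivity), ← sq_abs]
    nlinarith [abs_nonneg y, mul_nonneg hs.le (abs_nonneg y)]
  calc y ^ 2 * Real.exp (s * |y|) ≤ 2 / s ^ 2 * Real.exp (s * |y|) * Real.exp (s * |y|) := by gcongr
    _ = _ := by rw [mul_assoc, ← Real.exp_add]; congr 2; ring

/-- Exponential square moments of unit directions under the class-conditional laws. -/
theorem Regular.exp_sq_le (h : Regular A w M SW) (l : Fin L) {u : Fin p → ℝ} (hu : l2 u ≤ 1)
    {s : ℝ} (hs : 0 ≤ s) (hsA : 8 * s * A ^ 2 ≤ 1) :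
    Integrable (fun x => Real.exp (s * (x.ofLp ⬝ᵥ u) ^ 2)) (cond M SW l) ∧
      ∫ x, Real.exp (s * (x.ofLp ⬝ᵥ u) ^ 2) ∂(cond M SW l) ≤ 6 := by
  have hA := h.one_le
  have hu2 : l2 u ^ 2 ≤ 1 := pow_le_one₀ (l2_nonneg u) hu
  refine exp_sq_dotProduct h.posDef.posSemidef hs ?_ ?_
  · have h1 : (M.col l ⬝ᵥ u) ^ 2 ≤ A ^ 2 := by
      rw [← sq_abs]
      have := (abs_dotProduct_le (M.col l) u).trans
        (mul_le_mul (h.l2_col_le l) hu (l2_nonneg u) (by linarith))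
      rw [mul_one] at this
      gcongr
    have h2 := mul_le_mul_of_nonneg_left h1 hs
    have h3 : 0 ≤ s * A ^ 2 := by positivity
    change 2 * s * (M.col l ⬝ᵥ u) ^ 2 ≤ 1
    nlinarith
  · have h1 : u ⬝ᵥ SW *ᵥ u ≤ A ^ 2 := by
      have := h.quad_upper u
      have : A ≤ A ^ 2 := le_self_pow₀ hA (by norm_num)
      nlinarith
    have h2 := mul_le_mul_of_nonneg_left h1 hs
    nlinarith

/-- The scale of the exponential moments. -/
def momentScale (A : ℝ) : ℝ := 1 / (16 * A ^ 2)

/-- The variance proxy in Bernstein's inequality. -/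
def varianceProxy (A : ℝ) : ℝ := 36 * A / momentScale A ^ 2

theorem momentScale_pos (hA : 1 ≤ A) : 0 < momentScale A := by unfold momentScale; positivity

theorem momentScale_le (hA : 1 ≤ A) : momentScale A ≤ 1 / 16 := by
  unfold momentScale
  have : 1 ≤ A ^ 2 := one_le_pow₀ hA
  gcongr
  linarith

/-- By 2|ab| ≤ a² + b² the exponential of a product reduces to exponentials of squares at scale 2 ·
`momentScale A`, where the condition of `Regular.exp_sq_le` holds with equality. -/
theorem Regular.moment_mul (h : Regular A w M SW) {u v : Fin p → ℝ} (hu : l2 u ≤ 1)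
    (hv : l2 v ≤ 1) :
    Integrable (fun z : EuclideanSpace ℝ (Fin p) × Fin L =>
      ((z.1.ofLp ⬝ᵥ u) * (z.1.ofLp ⬝ᵥ v)) ^ 2 *
        Real.exp (momentScale A * |(z.1.ofLp ⬝ᵥ u) * (z.1.ofLp ⬝ᵥ v)|)) (law w M SW) ∧
    ∫ z, ((z.1.ofLp ⬝ᵥ u) * (z.1.ofLp ⬝ᵥ v)) ^ 2 *
        Real.exp (momentScale A * |(z.1.ofLp ⬝ᵥ u) * (z.1.ofLp ⬝ᵥ v)|) ∂(law w M SW) ≤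
      varianceProxy A := by
  have hA := h.one_le
  set s := momentScale A with hs
  have hs0 : 0 < s := momentScale_pos hA
  have hsA : 8 * (2 * s) * A ^ 2 ≤ 1 := by
    rw [hs, momentScale]; apply le_of_eq; field_simp; norm_num
  set F : EuclideanSpace ℝ (Fin p) → ℝ := fun x => ((x.ofLp ⬝ᵥ u) * (x.ofLp ⬝ᵥ v)) ^ 2 *
        Real.exp (s * |(x.ofLp ⬝ᵥ u) * (x.ofLp ⬝ᵥ v)|) with hF
  have hFm : Measurable F := by
    have := measurable_dotProduct (p := p) u
    have := measurable_dotProduct (p := p) v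
    fun_prop
  have hle : ∀ x, F x ≤ 1 / s ^ 2 * (Real.exp (2 * s * (x.ofLp ⬝ᵥ u) ^ 2) +
      Real.exp (2 * s * (x.ofLp ⬝ᵥ v) ^ 2)) := by
    intro x
    refine (sq_mul_exp_le hs0).trans ?_
    set a := x.ofLp ⬝ᵥ u
    set b := x.ofLp ⬝ᵥ v
    have h1 : Real.exp (2 * s * |a * b|) ≤ Real.exp (s * a ^ 2) * Real.exp (s * b ^ 2) := by
      rw [← Real.exp_add, Real.exp_le_exp, abs_mul]
      have : 2 * (|a| * |b|) ≤ a ^ 2 + b ^ 2 := by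
        rw [← sq_abs a, ← sq_abs b]; nlinarith [sq_nonneg (|a| - |b|)]
      nlinarith
    have e : ∀ y : ℝ, Real.exp (2 * s * y ^ 2) = Real.exp (s * y ^ 2) ^ 2 := by
      intro y; rw [← Real.exp_nat_mul]; congr 1; push_cast; ring
    rw [e, e]
    have h2 : 2 * (Real.exp (s * a ^ 2) * Real.exp (s * b ^ 2)) ≤
        Real.exp (s * a ^ 2) ^ 2 + Real.exp (s * b ^ 2) ^ 2 := by
      nlinarith [sq_nonneg (Real.exp (s * a ^ 2) - Real.exp (s * b ^ 2))]
    calc 2 / s ^ 2 * Real.exp (2 * s * |a * b|)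
        = 1 / s ^ 2 * (2 * Real.exp (2 * s * |a * b|)) := by ring
      _ ≤ _ := by
          gcongr
          linarith
  have hi : ∀ l, Integrable F (cond M SW l) ∧ ∫ x, F x ∂(cond M SW l) ≤ 12 / s ^ 2 := by
    intro l
    obtain ⟨i1, b1⟩ := h.exp_sq_le l hu (by positivity) hsA
    obtain ⟨i2, b2⟩ := h.exp_sq_le l hv (by positivity) hsA
    have hI : Integrable F (cond M SW l) := by
      refine ((i1.add i2).const_mul (1 / s ^ 2)).mono' hFm.aestronglyMeasurable
        (.of_forall fun x => ?_)
      rw [Real.norm_eq_abs, abs_of_nonneg (by positivity)]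
      exact hle x
    refine ⟨hI, (integral_mono hI ((i1.add i2).const_mul (1 / s ^ 2)) hle).trans ?_⟩
    rw [integral_const_mul]
    have e := integral_add i1 i2
    simp only [Pi.add_apply] at e ⊢
    rw [e]
    calc _ ≤ 1 / s ^ 2 * (6 + 6) := by gcongr
      _ = _ := by ring
  have hm : Measurable fun z : EuclideanSpace ℝ (Fin p) × Fin L => F z.1 := hFm.comp measurable_fst
  refine ⟨integrable_law hm fun l => (hi l).1, ?_⟩
  refine (integral_law h.weight_nonneg hm fun l => (hi l).1).trans_le ?_
  calc ∑ l, w l * ∫ x, F x ∂(cond M SW l) ≤ ∑ l, w l * (12 / s ^ 2) := by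
        refine Finset.sum_le_sum fun l _ => mul_le_mul_of_nonneg_left (hi l).2 (h.weight_nonneg l)
    _ = 12 / s ^ 2 := by rw [← Finset.sum_mul, h.sum_one, one_mul]
    _ ≤ varianceProxy A := by
        unfold varianceProxy
        gcongr
        linarith

/-- Class l contributes its weight, at most A/L, times v_l², and ∑ v_l² ≤ 1. This gain of 1/L in
variance is the source of the 1/√L in all deviations that involve labels. Both linear forms and the
constant 1 are used for φ. -/
theorem Regular.moment_label (h : Regular A w M SW) {φ : EuclideanSpace ℝ (Fin p) → ℝ}
    (hφ : Measurable φ)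
    (hφi : ∀ l, Integrable (fun x => Real.exp (2 * momentScale A * |φ x|)) (cond M SW l) ∧
      ∫ x, Real.exp (2 * momentScale A * |φ x|) ∂(cond M SW l) ≤ 18)
    {v : Fin L → ℝ} (hv : l2 v ≤ 1) :
    Integrable (fun z : EuclideanSpace ℝ (Fin p) × Fin L =>
      (φ z.1 * v z.2) ^ 2 * Real.exp (momentScale A * |φ z.1 * v z.2|)) (law w M SW) ∧
    ∫ z, (φ z.1 * v z.2) ^ 2 * Real.exp (momentScale A * |φ z.1 * v z.2|) ∂(law w M SW) ≤
      varianceProxy A / L := by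
  have hA := h.one_le
  have hL := h.card_pos
  set s := momentScale A with hs
  have hs0 : 0 < s := momentScale_pos hA
  have hv2 : ∑ l, v l ^ 2 ≤ 1 := by rw [← l2_sq]; exact pow_le_one₀ (l2_nonneg v) hv
  have hvl : ∀ l, |v l| ≤ 1 := fun l => by
    have h1 := Finset.single_le_sum (f := fun i => v i ^ 2) (fun i _ => sq_nonneg _)
      (Finset.mem_univ l)
    rw [← sq_le_one_iff_abs_le_one]
    exact h1.trans hv2
  have hle : ∀ l x, (φ x * v l) ^ 2 * Real.exp (s * |φ x * v l|) ≤
      v l ^ 2 * (2 / s ^ 2 * Real.exp (2 * s * |φ x|)) := by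
    intro l x
    calc (φ x * v l) ^ 2 * Real.exp (s * |φ x * v l|)
        ≤ (φ x * v l) ^ 2 * Real.exp (s * |φ x|) := by
          refine mul_le_mul_of_nonneg_left (Real.exp_le_exp.mpr ?_) (sq_nonneg _)
          rw [abs_mul]
          exact mul_le_mul_of_nonneg_left (mul_le_of_le_one_right (abs_nonneg _) (hvl l)) hs0.le
      _ = v l ^ 2 * (φ x ^ 2 * Real.exp (s * |φ x|)) := by ring
      _ ≤ _ := mul_le_mul_of_nonneg_left (sq_mul_exp_le hs0) (sq_nonneg _)
  have hi : ∀ l, Integrable (fun x => (φ x * v l) ^ 2 * Real.exp (s * |φ x * v l|)) (cond M SW l) ∧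
      ∫ x, (φ x * v l) ^ 2 * Real.exp (s * |φ x * v l|) ∂(cond M SW l) ≤
        v l ^ 2 * (36 / s ^ 2) := by
    intro l
    have i1 := ((hφi l).1.const_mul (2 / s ^ 2)).const_mul (v l ^ 2)
    have hI : Integrable (fun x => (φ x * v l) ^ 2 * Real.exp (s * |φ x * v l|)) (cond M SW l) := by
      refine i1.mono' (by fun_prop) (.of_forall fun x => ?_)
      rw [Real.norm_eq_abs, abs_of_nonneg (by positivity)]
      exact hle l x
    refine ⟨hI, (integral_mono hI i1 (hle l)).trans ?_⟩
    rw [integral_const_mul, integral_const_mul]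
    have := (hφi l).2
    calc _ ≤ v l ^ 2 * (2 / s ^ 2 * 18) := by gcongr
      _ = _ := by ring
  have hvm : Measurable fun z : EuclideanSpace ℝ (Fin p) × Fin L => v z.2 :=
    (measurable_of_finite v).comp measurable_snd
  have hφm : Measurable fun z : EuclideanSpace ℝ (Fin p) × Fin L => φ z.1 := hφ.comp measurable_fst
  have hm : Measurable fun z : EuclideanSpace ℝ (Fin p) × Fin L =>
      (φ z.1 * v z.2) ^ 2 * Real.exp (s * |φ z.1 * v z.2|) := by fun_prop
  refine ⟨integrable_law hm fun l => (hi l).1, ?_⟩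
  refine (integral_law h.weight_nonneg hm fun l => (hi l).1).trans_le ?_
  calc _ ≤ ∑ l, A / L * (v l ^ 2 * (36 / s ^ 2)) := by
        refine Finset.sum_le_sum fun l _ => mul_le_mul ?_ (hi l).2 ?_ (by positivity)
        · rw [le_div_iff₀ hL, mul_comm]; exact h.weight_upper l
        · exact integral_nonneg_of_ae (.of_forall fun x => by positivity)
    _ = A / L * (36 / s ^ 2) * ∑ l, v l ^ 2 := by
        rw [Finset.mul_sum]
        exact Finset.sum_congr rfl fun l _ => by ring
    _ ≤ A / L * (36 / s ^ 2) * 1 := by gcongr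
    _ = varianceProxy A / L := by unfold varianceProxy; ring

/-- From 2|y| ≤ 1 + y² and exp 1 ≤ 3; the constant is 18 = 3 · 6. -/
theorem Regular.exp_abs_le (h : Regular A w M SW) (l : Fin L) {u : Fin p → ℝ} (hu : l2 u ≤ 1) :
    Integrable (fun x => Real.exp (2 * momentScale A * |x.ofLp ⬝ᵥ u|)) (cond M SW l) ∧
      ∫ x, Real.exp (2 * momentScale A * |x.ofLp ⬝ᵥ u|) ∂(cond M SW l) ≤ 18 := by
  have hA := h.one_le
  set s := momentScale A with hs
  have hs0 : 0 < s := momentScale_pos hA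
  have hs1 : s ≤ 1 := (momentScale_le hA).trans (by norm_num)
  have hsA : 8 * s * A ^ 2 ≤ 1 := by
    rw [hs, momentScale]
    have : 8 * (1 / (16 * A ^ 2)) * A ^ 2 = 1 / 2 := by field_simp; norm_num
    rw [this]; norm_num
  obtain ⟨i1, b1⟩ := h.exp_sq_le l hu hs0.le hsA
  have hle : ∀ x : EuclideanSpace ℝ (Fin p), Real.exp (2 * s * |x.ofLp ⬝ᵥ u|) ≤
      3 * Real.exp (s * (x.ofLp ⬝ᵥ u) ^ 2) := by
    intro x
    have h3 : Real.exp 1 ≤ 3 := by linarith [Real.exp_one_lt_d9]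
    calc Real.exp (2 * s * |x.ofLp ⬝ᵥ u|) ≤ Real.exp (1 + s * (x.ofLp ⬝ᵥ u) ^ 2) := by
          rw [Real.exp_le_exp, ← sq_abs (x.ofLp ⬝ᵥ u)]
          nlinarith [mul_nonneg hs0.le (sq_nonneg (|x.ofLp ⬝ᵥ u| - 1))]
      _ = Real.exp 1 * Real.exp (s * (x.ofLp ⬝ᵥ u) ^ 2) := Real.exp_add _ _
      _ ≤ _ := by gcongr
  have hm := measurable_dotProduct (p := p) u
  have hI : Integrable (fun x => Real.exp (2 * s * |x.ofLp ⬝ᵥ u|)) (cond M SW l) := by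
    refine (i1.const_mul 3).mono' (by fun_prop) (.of_forall fun x => ?_)
    rw [Real.norm_eq_abs, Real.abs_exp]
    exact hle x
  refine ⟨hI, (integral_mono hI (i1.const_mul 3) hle).trans ?_⟩
  rw [integral_const_mul]
  linarith

theorem Regular.integral_mul (h : Regular A w M SW) (u v : Fin p → ℝ) :
    ∫ z, (z.1.ofLp ⬝ᵥ u) * (z.1.ofLp ⬝ᵥ v) ∂(law w M SW) =
      u ⬝ᵥ (SW + M * diagonal w * Mᵀ) *ᵥ v := by
  have hu := measurable_dotProduct (p := p) u
  have hv := measurable_dotProduct (p := p) v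
  have hm : Measurable fun z : EuclideanSpace ℝ (Fin p) × Fin L =>
      (z.1.ofLp ⬝ᵥ u) * (z.1.ofLp ⬝ᵥ v) :=
    (hu.comp measurable_fst).mul (hv.comp measurable_fst)
  refine (integral_law h.weight_nonneg hm fun l =>
    (memLp_dotProduct u).integrable_mul (memLp_dotProduct v)).trans ?_
  simp only [integral_dotProduct_mul h.posDef.posSemidef, mul_add, Finset.sum_add_distrib,
    ← Finset.sum_mul, h.sum_one, one_mul]
  rw [add_mulVec, dotProduct_add, ← mulVec_mulVec, ← mulVec_mulVec, dotProduct_mulVec u M,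
    ← mulVec_transpose]
  congr 1
  refine Finset.sum_congr rfl fun l _ => ?_
  rw [mulVec_diagonal]
  change w l * ((M.col l ⬝ᵥ u) * (M.col l ⬝ᵥ v)) = (M.col l ⬝ᵥ u) * (w l * (M.col l ⬝ᵥ v))
  ring

theorem Regular.integral_mul_label (h : Regular A w M SW) (u : Fin p → ℝ) (v : Fin L → ℝ) :
    ∫ z, (z.1.ofLp ⬝ᵥ u) * v z.2 ∂(law w M SW) = u ⬝ᵥ (M * diagonal w) *ᵥ v := by
  have hu := measurable_dotProduct (p := p) u
  have hm : Measurable fun z : EuclideanSpace ℝ (Fin p) × Fin L => (z.1.ofLp ⬝ᵥ u) * v z.2 :=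
    (hu.comp measurable_fst).mul ((measurable_of_finite v).comp measurable_snd)
  refine (integral_law h.weight_nonneg hm fun l =>
    ((memLp_dotProduct u).integrable (by norm_num)).mul_const (v l)).trans ?_
  simp only [integral_mul_const, integral_dotProduct]
  rw [← mulVec_mulVec, dotProduct_mulVec u M, ← mulVec_transpose]
  refine Finset.sum_congr rfl fun l _ => ?_
  rw [mulVec_diagonal]
  change w l * ((M.col l ⬝ᵥ u) * v l) = (M.col l ⬝ᵥ u) * (w l * v l)
  ring

theorem Regular.integral_label (h : Regular A w M SW) (l : Fin L) :
    ∫ z, 1 * (Pi.single l 1 : Fin L → ℝ) z.2 ∂(law w M SW) = w l := by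
  have hm : Measurable fun z : EuclideanSpace ℝ (Fin p) × Fin L =>
      1 * (Pi.single l 1 : Fin L → ℝ) z.2 :=
    ((measurable_of_finite _).comp measurable_snd).const_mul 1
  refine (integral_law h.weight_nonneg hm fun k =>
    integrable_const (1 * (Pi.single l 1 : Fin L → ℝ) k)).trans ?_
  simp [Pi.single_apply]

theorem sampleCov_bilin (D : Fin n → EuclideanSpace ℝ (Fin p) × Fin L) (u v : Fin p → ℝ) :
    u ⬝ᵥ sampleCov D *ᵥ v = 1 / n * ∑ i, ((D i).1.ofLp ⬝ᵥ u) * ((D i).1.ofLp ⬝ᵥ v) := by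
  rw [sampleCov, smul_mulVec, dotProduct_smul, smul_eq_mul, ← mulVec_mulVec, dotProduct_mulVec,
    ← mulVec_transpose, transpose_transpose]
  rfl

theorem sampleCross_bilin (D : Fin n → EuclideanSpace ℝ (Fin p) × Fin L) (u : Fin p → ℝ)
    (v : Fin L → ℝ) :
    u ⬝ᵥ sampleCross D *ᵥ v = 1 / n * ∑ i, ((D i).1.ofLp ⬝ᵥ u) * v (D i).2 := by
  rw [sampleCross, smul_mulVec, dotProduct_smul, smul_eq_mul, ← mulVec_mulVec, dotProduct_mulVec,
    ← mulVec_transpose, transpose_transpose]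
  congr 1
  refine Finset.sum_congr rfl fun i _ => ?_
  have : (dataY D *ᵥ v) i = v (D i).2 := by
    simp [mulVec, dotProduct, dataY]
  rw [this]
  rfl

end ExponentialMoments

/-! ### Concentration of the sample moments -/

section SampleMoments

variable {n p L : ℕ} {A : ℝ} {w : Fin L → ℝ} {M : Matrix (Fin p) (Fin L) ℝ}
  {SW : Matrix (Fin p) (Fin p) ℝ}

/-- The deviation constant for unit test directions. -/
def unitDeviation (A : ℝ) : ℝ := (12 + momentScale A ^ 2 * varianceProxy A) / momentScale A

/-- The deviation constant of the high-probability event. -/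
def deviation (A : ℝ) : ℝ := 2 * A ^ 2 * unitDeviation A

theorem unitDeviation_nonneg (hA : 1 ≤ A) : 0 ≤ unitDeviation A := by
  have := momentScale_pos hA
  unfold unitDeviation varianceProxy
  positivity

theorem deviation_nonneg (hA : 1 ≤ A) : 0 ≤ deviation A := by
  have := unitDeviation_nonneg hA
  unfold deviation
  positivity

/-- The samples for which the average of `f` is at distance more than `t` from `m`. -/
def deviant {Ω : Type*} (n : ℕ) (f : Ω → ℝ) (m t : ℝ) : Set (Fin n → Ω) :=
  {D | t < |(1 / n) * ∑ i, f (D i) - m|}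

/-- Bernstein with s = `momentScale A` · ε√ℓ, admissible because ε√ℓ ≤ 1. `unitDeviation` is chosen
so that the exponent is exactly 12nε². The variance factor is ℓ = 1 for products of features and ℓ =
L when a label is involved. -/
theorem measureReal_deviant_le {P : Measure (EuclideanSpace ℝ (Fin p) × Fin L)}
    [IsProbabilityMeasure P] (hA : 1 ≤ A) (hn : 0 < n)
    {f : EuclideanSpace ℝ (Fin p) × Fin L → ℝ} (hf : Measurable f) {ℓ ε m : ℝ} (hℓ : 0 < ℓ)
    (hε : 0 ≤ ε) (hεℓ : ε * √ℓ ≤ 1)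
    (hi : Integrable (fun z => f z ^ 2 * Real.exp (momentScale A * |f z|)) P ∧
      ∫ z, f z ^ 2 * Real.exp (momentScale A * |f z|) ∂P ≤ varianceProxy A / ℓ)
    (hm : ∫ z, f z ∂P = m) :
    (dataLaw n P).real (deviant n f m (unitDeviation A * ε / √ℓ)) ≤
      2 * Real.exp (-(12 * (n * ε ^ 2))) := by
  have hs := momentScale_pos hA
  have h := tail_avg_le n hn hf hi.1 hi.2 (s := momentScale A * (ε * √ℓ)) (by positivity)
    (mul_le_of_le_one_right hs.le hεℓ) (unitDeviation A * ε / √ℓ)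
  have : IsProbabilityMeasure (dataLaw n P) := by unfold dataLaw; infer_instance
  refine (measureReal_mono (fun D hD => ?_)).trans (h.trans (le_of_eq ?_))
  · simp only [deviant, Set.mem_ofPred_eq, hm] at hD ⊢
    exact hD.le
  · congr 2
    have hsq : √ℓ ^ 2 = ℓ := Real.sq_sqrt hℓ.le
    have hsp : 0 < √ℓ := Real.sqrt_pos.mpr hℓ
    have e1 : momentScale A * (ε * √ℓ) * (unitDeviation A * ε / √ℓ) =
        ε ^ 2 * (12 + momentScale A ^ 2 * varianceProxy A) := by
      unfold unitDeviation
      field_simp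
    have e2 : (momentScale A * (ε * √ℓ)) ^ 2 * (varianceProxy A / ℓ) =
        ε ^ 2 * (momentScale A ^ 2 * varianceProxy A) := by
      rw [mul_pow, mul_pow, hsq]
      field_simp
    rw [e1, e2]
    ring

/-- Union bound: the 12 in the exponent pays for up to exp(10x) events and still leaves exp(-2x),
which is at most 1/n. -/
theorem measureReal_exists_le {Ω ι : Type*} [MeasurableSpace Ω] {μ : Measure Ω}
    [IsProbabilityMeasure μ] (hn : 0 < n) (s : Finset ι) (E : ι → Set Ω) {x : ℝ}
    (hE : ∀ i ∈ s, μ.real (E i) ≤ 2 * Real.exp (-(12 * x)))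
    (hs : (s.card : ℝ) ≤ Real.exp (10 * x)) (hx : Real.log n ≤ x) :
    μ.real (⋃ i ∈ s, E i) ≤ 2 / n := by
  have hn' : (0 : ℝ) < n := by exact_mod_cast hn
  have hlog : 0 ≤ Real.log n := Real.log_natCast_nonneg n
  calc μ.real (⋃ i ∈ s, E i) ≤ ∑ i ∈ s, μ.real (E i) := measureReal_biUnion_finset_le s E
    _ ≤ ∑ _i ∈ s, 2 * Real.exp (-(12 * x)) := Finset.sum_le_sum hE
    _ = s.card * (2 * Real.exp (-(12 * x))) := by rw [Finset.sum_const, nsmul_eq_mul]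
    _ ≤ Real.exp (10 * x) * (2 * Real.exp (-(12 * x))) := by gcongr
    _ = 2 * Real.exp (-(2 * x)) := by
        rw [mul_left_comm, ← Real.exp_add]; ring_nf
    _ ≤ 2 * Real.exp (-Real.log n) := by
        have : -(2 * x) ≤ -Real.log n := by linarith
        gcongr
    _ = 2 / n := by rw [Real.exp_neg, Real.exp_log hn']; rfl

/-- For n ≥ 2, 8n + 1 ≤ 16n ≤ n⁵. Two such nets together have at most exp(10(p + L) log n) pairs of
points. -/
theorem card_net_le (hn : 2 ≤ n) (d : ℕ) :
    (((8 * n + 1) ^ d : ℕ) : ℝ) ≤ Real.exp (5 * d * Real.log n) := by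
  have hn' : (2 : ℝ) ≤ n := by exact_mod_cast hn
  have h1 : (8 * n + 1 : ℝ) ≤ (n : ℝ) ^ 5 := by
    have : (2 : ℝ) ^ 4 ≤ (n : ℝ) ^ 4 := by gcongr
    calc (8 * n + 1 : ℝ) ≤ 2 ^ 4 * n := by linarith
      _ ≤ (n : ℝ) ^ 4 * n := by gcongr
      _ = _ := by ring
  have h2 : Real.exp (5 * d * Real.log n) = ((n : ℝ) ^ 5) ^ d := by
    rw [← pow_mul, show (5 * d * Real.log n : ℝ) = ((5 * d : ℕ) : ℝ) * Real.log n by push_cast; ring,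
      Real.exp_nat_mul, Real.exp_log (by linarith)]
  rw [h2]
  push_cast
  gcongr

theorem l2_single (l : Fin L) : l2 (Pi.single l 1 : Fin L → ℝ) = 1 := by
  rw [← sq_eq_sq₀ (l2_nonneg _) zero_le_one, l2_sq]
  simp [Pi.single_apply, ite_pow]

/-- The sample moments are close to the population moments with high probability. -/
theorem Regular.measureReal_not_goodData_le (h : Regular A w M SW) (hn : 2 ≤ n) (hp : p ≤ n)
    (hL : L ≤ n) {e f : ℝ} (he : 0 ≤ e) (hf : 0 ≤ f) (he2 : n * e ^ 2 = (p + L) * Real.log n)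
    (hf2 : n * f ^ 2 = Real.log n) (heL : e * √L ≤ 1) (hfL : f * √L ≤ 1) :
    (dataLaw n (law w M SW)).real {D | ¬ GoodData (deviation A) e f w M SW D} ≤ 8 / n := by
  have hA := h.one_le
  have hA2 : 1 ≤ A ^ 2 := one_le_pow₀ hA
  have := h.prob
  have hprob : IsProbabilityMeasure (dataLaw n (law w M SW)) := by unfold dataLaw; infer_instance
  have hn0 : 0 < n := by omega
  have hL0 := h.card_pos
  have hL1 : (1 : ℝ) ≤ L := by exact_mod_cast (by have := h.two_le; omega : 1 ≤ L)
  have hκ := unitDeviation_nonneg hA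
  set κ := unitDeviation A with hκd
  have hlog : 0 ≤ Real.log n := Real.log_natCast_nonneg n
  have hsL1 : 1 ≤ √(L : ℝ) := Real.one_le_sqrt.mpr hL1
  have he1 : e * √(1 : ℝ) ≤ 1 := by
    rw [Real.sqrt_one, mul_one]
    nlinarith
  have hlogx : Real.log n ≤ n * e ^ 2 := by
    rw [he2]
    have : (0 : ℝ) ≤ p := Nat.cast_nonneg p
    nlinarith
  obtain ⟨Np, hNpc, hNp1, hNp⟩ := exists_net n p (by omega) hp
  obtain ⟨NL, hNLc, hNL1, hNL⟩ := exists_net n L (by omega) hL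
  have hNpc' : (Np.card : ℝ) ≤ Real.exp (5 * p * Real.log n) :=
    le_trans (by exact_mod_cast hNpc) (card_net_le hn p)
  have hNLc' : (NL.card : ℝ) ≤ Real.exp (5 * L * Real.log n) :=
    le_trans (by exact_mod_cast hNLc) (card_net_le hn L)
  have hdm := measurable_dotProduct (p := p)
  have hm1 : ∀ u : Fin p → ℝ, Measurable fun z : EuclideanSpace ℝ (Fin p) × Fin L =>
      z.1.ofLp ⬝ᵥ u := fun u => (hdm u).comp measurable_fst
  have hm2 : ∀ v : Fin L → ℝ, Measurable fun z : EuclideanSpace ℝ (Fin p) × Fin L => v z.2 :=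
    fun v => (measurable_of_finite v).comp measurable_snd
  have hpL : (0 : ℝ) ≤ p * Real.log n := by positivity
  have hLL : (0 : ℝ) ≤ L * Real.log n := by positivity
  set E₁ : (Fin p → ℝ) × (Fin p → ℝ) → Set (Fin n → EuclideanSpace ℝ (Fin p) × Fin L) :=
    fun q => deviant n (fun z => (z.1.ofLp ⬝ᵥ q.1) * (z.1.ofLp ⬝ᵥ q.2))
      (q.1 ⬝ᵥ (SW + M * diagonal w * Mᵀ) *ᵥ q.2) (κ * e / √(1 : ℝ)) with hE₁
  have b1 : (dataLaw n (law w M SW)).real (⋃ q ∈ Np ×ˢ Np, E₁ q) ≤ 2 / n := by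
    refine measureReal_exists_le hn0 _ _ (x := n * e ^ 2) (fun q hq => ?_) ?_ hlogx
    · rw [Finset.mem_product] at hq
      refine measureReal_deviant_le hA hn0 ((hm1 _).mul (hm1 _)) one_pos he he1 ?_
        (h.integral_mul _ _)
      rw [div_one]
      exact h.moment_mul (hNp1 _ hq.1) (hNp1 _ hq.2)
    · rw [Finset.card_product, Nat.cast_mul]
      calc _ ≤ Real.exp (5 * p * Real.log n) * Real.exp (5 * p * Real.log n) := by gcongr
        _ ≤ _ := by
          rw [← Real.exp_add, Real.exp_le_exp, he2]
          linarith
  set E₂ : (Fin p → ℝ) × (Fin L → ℝ) → Set (Fin n → EuclideanSpace ℝ (Fin p) × Fin L) :=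
    fun q => deviant n (fun z => (z.1.ofLp ⬝ᵥ q.1) * q.2 z.2)
      (q.1 ⬝ᵥ (M * diagonal w) *ᵥ q.2) (κ * e / √L) with hE₂
  have b2 : (dataLaw n (law w M SW)).real (⋃ q ∈ Np ×ˢ NL, E₂ q) ≤ 2 / n := by
    refine measureReal_exists_le hn0 _ _ (x := n * e ^ 2) (fun q hq => ?_) ?_ hlogx
    · rw [Finset.mem_product] at hq
      exact measureReal_deviant_le hA hn0 ((hm1 _).mul (hm2 _)) hL0 he heL
        (h.moment_label (hdm q.1) (fun l => h.exp_abs_le l (hNp1 _ hq.1)) (hNL1 _ hq.2))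
        (h.integral_mul_label _ _)
    · rw [Finset.card_product, Nat.cast_mul]
      calc _ ≤ Real.exp (5 * p * Real.log n) * Real.exp (5 * L * Real.log n) := by gcongr
        _ ≤ _ := by
          rw [← Real.exp_add, Real.exp_le_exp, he2]
          linarith
  have hcard : ((Finset.univ : Finset (Fin L)).card : ℝ) ≤ Real.exp (10 * (n * f ^ 2)) := by
    rw [Finset.card_univ, Fintype.card_fin, hf2]
    calc (L : ℝ) ≤ n := by exact_mod_cast hL
      _ = Real.exp (Real.log n) := (Real.exp_log (by exact_mod_cast hn0)).symm
      _ ≤ _ := by rw [Real.exp_le_exp]; linarith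
  have hone : ∀ l, Integrable (fun _ => Real.exp (2 * momentScale A * |(1 : ℝ)|)) (cond M SW l) ∧
      ∫ _x, Real.exp (2 * momentScale A * |(1 : ℝ)|) ∂(cond M SW l) ≤ 18 := by
    intro l
    refine ⟨integrable_const _, ?_⟩
    rw [integral_const, probReal_univ, one_smul, abs_one, mul_one]
    calc Real.exp (2 * momentScale A) ≤ Real.exp 1 := by
          rw [Real.exp_le_exp]; linarith [momentScale_le hA]
      _ ≤ 18 := by linarith [Real.exp_one_lt_d9]
  set E₃ : Fin L → Set (Fin n → EuclideanSpace ℝ (Fin p) × Fin L) :=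
    fun l => deviant n (fun z => 1 * (Pi.single l 1 : Fin L → ℝ) z.2) (w l) (κ * f / √L) with hE₃
  have b3 : (dataLaw n (law w M SW)).real (⋃ l ∈ (Finset.univ : Finset (Fin L)), E₃ l) ≤
      2 / n := by
    refine measureReal_exists_le hn0 _ _ (x := n * f ^ 2) (fun l _ => ?_) hcard hf2.ge
    exact measureReal_deviant_le hA hn0 ((hm2 _).const_mul 1) hL0 hf hfL
      (h.moment_label measurable_const hone (l2_single l).le) (h.integral_label l)
  -- The directions Σ_W⁻¹μ_l are rescaled into the unit ball. The factor A² in `deviation` undoes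
  -- this, and the factor 2 is the price of passing from nets to the ball.
  set d : Fin L → Fin p → ℝ := fun l => (A ^ 2)⁻¹ • (SW⁻¹ * M).col l with hd
  have hd1 : ∀ l, l2 (d l) ≤ 1 := by
    intro l
    rw [hd, l2_smul, abs_of_nonneg (by positivity), inv_mul_le_iff₀ (by positivity), mul_one]
    exact h.l2_direction_le l
  set E₄ : Fin L → Set (Fin n → EuclideanSpace ℝ (Fin p) × Fin L) :=
    fun l => deviant n (fun z => (z.1.ofLp ⬝ᵥ d l) * (Pi.single l 1 : Fin L → ℝ) z.2)
      (d l ⬝ᵥ (M * diagonal w) *ᵥ Pi.single l 1) (κ * f / √L) with hE₄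
  have b4 : (dataLaw n (law w M SW)).real (⋃ l ∈ (Finset.univ : Finset (Fin L)), E₄ l) ≤
      2 / n := by
    refine measureReal_exists_le hn0 _ _ (x := n * f ^ 2) (fun l _ => ?_) hcard hf2.ge
    exact measureReal_deviant_le hA hn0 ((hm1 _).mul (hm2 _)) hL0 hf hfL
      (h.moment_label (hdm _) (fun k => h.exp_abs_le k (hd1 l)) (l2_single l).le)
      (h.integral_mul_label _ _)
  have hsub : {D | ¬ GoodData (deviation A) e f w M SW D} ⊆
      (((⋃ q ∈ Np ×ˢ Np, E₁ q) ∪ ⋃ q ∈ Np ×ˢ NL, E₂ q) ∪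
        ⋃ l ∈ (Finset.univ : Finset (Fin L)), E₃ l) ∪
        ⋃ l ∈ (Finset.univ : Finset (Fin L)), E₄ l := by
    intro D hD
    by_contra hN
    apply hD
    simp only [Set.mem_union, Set.mem_iUnion, Finset.mem_product, not_or, not_exists, hE₁, hE₂,
      hE₃, hE₄, deviant, Set.mem_ofPred_eq, not_lt, Finset.mem_univ, forall_const, Prod.forall] at hN
    obtain ⟨⟨⟨g1, g2⟩, g3⟩, g4⟩ := hN
    refine ⟨?_, ?_, fun l => ?_, fun l => ?_⟩
    · rw [show deviation A * e = 2 * (A ^ 2 * κ * e) by unfold deviation; ring]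
      refine OpBound.of_net (by positivity) (Np : Set _) (Np : Set _) (fun u hu => hNp1 u hu)
        hNp hNp fun u hu v hv => ?_
      rw [sub_mulVec, dotProduct_sub, sampleCov_bilin]
      refine (g1 u v ⟨hu, hv⟩).trans ?_
      rw [Real.sqrt_one, div_one, mul_assoc]
      exact le_mul_of_one_le_left (by positivity) hA2
    · rw [show deviation A * e / √L = 2 * (A ^ 2 * (κ * e / √L)) by unfold deviation; ring]
      refine OpBound.of_net (by positivity) (Np : Set _) (NL : Set _) (fun u hu => hNp1 u hu)
        hNp hNL fun u hu v hv => ?_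
      rw [sub_mulVec, dotProduct_sub, sampleCross_bilin]
      refine (g2 u v ⟨hu, hv⟩).trans ?_
      exact le_mul_of_one_le_left (by positivity) hA2
    · rw [show deviation A * f / √L = 2 * A ^ 2 * (κ * f / √L) by unfold deviation; ring, pihat_eq]
      have := g3 l
      simp only [one_mul, Pi.single_apply] at this
      refine this.trans (le_mul_of_one_le_left (by positivity) (by linarith))
    · rw [show deviation A * f / √L = A ^ 2 * (2 * (κ * f / √L)) by unfold deviation; ring]
      have h4 := g4 l
      rw [← sampleCross_bilin, ← dotProduct_sub, ← sub_mulVec, mulVec_single_one, hd,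
        smul_dotProduct, smul_eq_mul, abs_mul, abs_of_nonneg (by positivity),
        inv_mul_le_iff₀ (by positivity), dotProduct_comm] at h4
      refine h4.trans ?_
      have : 0 ≤ κ * f / √L := by positivity
      gcongr
      linarith
  refine (measureReal_mono hsub).trans ?_
  have u1 := measureReal_union_le (μ := dataLaw n (law w M SW))
    (((⋃ q ∈ Np ×ˢ Np, E₁ q) ∪ ⋃ q ∈ Np ×ˢ NL, E₂ q) ∪
        ⋃ l ∈ (Finset.univ : Finset (Fin L)), E₃ l) (⋃ l ∈ (Finset.univ : Finset (Fin L)), E₄ l)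
  have u2 := measureReal_union_le (μ := dataLaw n (law w M SW))
    ((⋃ q ∈ Np ×ˢ Np, E₁ q) ∪ ⋃ q ∈ Np ×ˢ NL, E₂ q)
    (⋃ l ∈ (Finset.univ : Finset (Fin L)), E₃ l)
  have u3 := measureReal_union_le (μ := dataLaw n (law w M SW))
    (⋃ q ∈ Np ×ˢ Np, E₁ q) (⋃ q ∈ Np ×ˢ NL, E₂ q)
  have : (8 : ℝ) / n = 2 / n + 2 / n + 2 / n + 2 / n := by ring
  linarith

end SampleMoments

/-! ### The risk bound -/

section RiskBound

variable {n p L : ℕ} {A : ℝ} {w : Fin L → ℝ} {M : Matrix (Fin p) (Fin L) ℝ}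
  {SW : Matrix (Fin p) (Fin p) ℝ}

/-- Bounds on the eigenvalues bound the quadratic form. -/
theorem quad_bounds (hS : SW.IsHermitian) {c C : ℝ}
    (h : ∀ i, c ≤ hS.eigenvalues i ∧ hS.eigenvalues i ≤ C) (v : Fin p → ℝ) :
    c * l2 v ^ 2 ≤ v ⬝ᵥ SW *ᵥ v ∧ v ⬝ᵥ SW *ᵥ v ≤ C * l2 v ^ 2 := by
  set U : Matrix (Fin p) (Fin p) ℝ := hS.eigenvectorUnitary.1
  have hUU : U * Uᵀ = 1 := by
    have := Unitary.coe_mul_star_self hS.eigenvectorUnitary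
    rwa [Unitary.coe_star, star_eq_conjTranspose, conjTranspose_eq_transpose_of_trivial] at this
  have hspec : SW = U * diagonal hS.eigenvalues * Uᵀ := by
    have := hS.spectral_theorem
    rw [Unitary.conjStarAlgAut_apply, star_eq_conjTranspose,
      conjTranspose_eq_transpose_of_trivial] at this
    simpa using this
  have e1 : v ⬝ᵥ SW *ᵥ v = ∑ i, hS.eigenvalues i * (Uᵀ *ᵥ v) i ^ 2 := by
    conv_lhs => rw [hspec]
    rw [← mulVec_mulVec, ← mulVec_mulVec, dotProduct_mulVec, ← mulVec_transpose]
    refine Finset.sum_congr rfl fun i _ => ?_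
    rw [mulVec_diagonal]
    ring
  have e2 : l2 v ^ 2 = ∑ i, (Uᵀ *ᵥ v) i ^ 2 := by
    rw [← l2_sq, l2_sq_eq_dotProduct, l2_sq_eq_dotProduct, dotProduct_mulVec, vecMul_transpose,
      mulVec_mulVec, hUU, one_mulVec]
  rw [e1, e2, Finset.mul_sum, Finset.mul_sum]
  exact ⟨Finset.sum_le_sum fun i _ => mul_le_mul_of_nonneg_right (h i).1 (sq_nonneg _),
    Finset.sum_le_sum fun i _ => mul_le_mul_of_nonneg_right (h i).2 (sq_nonneg _)⟩

/-- A constant that controls all the standing assumptions. -/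
def regularityConstant (c C : ℝ) : ℝ := 1 + 1 / c + C + 1 / c ^ 2 + C ^ 2

/-- As Δ lies in [c, C], the Mahalanobis distances lie in [c², C²], which explains the terms 1/c²
and C² of the constant. -/
theorem regular_of_bounds {c C Δ : ℝ} (hc : 0 < c) (hcC : c ≤ C) (hL : 2 ≤ L) (hSW : SW.PosDef)
    (h1 : ∑ l, w l = 1) (hw : ∀ l, c / L ≤ w l ∧ w l ≤ C / L) (h0 : ∑ l, w l • M.col l = 0)
    (hM : ∀ k l, k ≠ l → c * Δ ≤ mahal M SW k l ∧ mahal M SW k l ≤ C * Δ) (hcΔ : c ≤ Δ)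
    (hΔC : Δ ≤ C)
    (hE : ∀ i, c ≤ hSW.isHermitian.eigenvalues i ∧ hSW.isHermitian.eigenvalues i ≤ C) :
    Regular (regularityConstant c C) w M SW := by
  have hC : 0 < C := hc.trans_le hcC
  have hL' : (0 : ℝ) < L := by exact_mod_cast (by omega : 0 < L)
  have p1 : 0 < 1 / c := by positivity
  have p2 : 0 < 1 / c ^ 2 := by positivity
  have p3 : 0 < C ^ 2 := by positivity
  set A := regularityConstant c C with hA
  have a1 : 1 ≤ A := by rw [hA, regularityConstant]; linarith
  have a2 : 1 / c ≤ A := by rw [hA, regularityConstant]; linarith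
  have a3 : C ≤ A := by rw [hA, regularityConstant]; linarith
  have a4 : 1 / c ^ 2 ≤ A := by rw [hA, regularityConstant]; linarith
  have a5 : C ^ 2 ≤ A := by rw [hA, regularityConstant]; linarith
  rw [div_le_iff₀ hc] at a2
  rw [div_le_iff₀ (by positivity)] at a4
  have hA0 : 0 ≤ A := by linarith
  refine ⟨a1, hL, hSW, h1, fun l => ?_, fun l => ?_, h0, fun k l hkl => ?_, fun k l => ?_,
    fun v => ?_, fun v => ?_⟩
  · have := (hw l).1
    rw [div_le_iff₀ hL'] at this
    nlinarith
  · have := (hw l).2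
    rw [le_div_iff₀ hL'] at this
    linarith
  · have := (hM k l hkl).1
    nlinarith
  · by_cases hkl : k = l
    · rw [hkl, mahal, sub_self, zero_dotProduct]
      exact hA0
    · have := (hM k l hkl).2
      nlinarith
  · have := (quad_bounds hSW.isHermitian hE v).1
    have h2 := mul_le_mul_of_nonneg_left this hA0
    have h3 := mul_le_mul_of_nonneg_right a2 (sq_nonneg (l2 v))
    linarith
  · have := (quad_bounds hSW.isHermitian hE v).2
    have h3 := mul_le_mul_of_nonneg_right a3 (sq_nonneg (l2 v))
    linarith

section ExcessRisk

variable {P : Measure (EuclideanSpace ℝ (Fin p) × Fin L)} [IsProbabilityMeasure P]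
  {gs : EuclideanSpace ℝ (Fin p) → Fin L}

theorem abs_excessRisk_le (g : EuclideanSpace ℝ (Fin p) → Fin L) : |excessRisk P gs g| ≤ 1 := by
  have h1 : P.real {z | z.2 ≠ g z.1} ≤ 1 := measureReal_le_one
  have h2 : P.real {z | z.2 ≠ gs z.1} ≤ 1 := measureReal_le_one
  have h3 : 0 ≤ P.real {z | z.2 ≠ g z.1} := measureReal_nonneg
  have h4 : 0 ≤ P.real {z | z.2 ≠ gs z.1} := measureReal_nonneg
  rw [excessRisk, abs_le]
  constructor <;> linarith

theorem measurable_excessRisk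
    {gh : (Fin n → EuclideanSpace ℝ (Fin p) × Fin L) → EuclideanSpace ℝ (Fin p) → Fin L}
    (hgh : Measurable (Function.uncurry gh)) : Measurable fun D => excessRisk P gs (gh D) := by
  have hS : MeasurableSet {q : (Fin n → EuclideanSpace ℝ (Fin p) × Fin L) ×
      (EuclideanSpace ℝ (Fin p) × Fin L) | q.2.2 ≠ Function.uncurry gh (q.1, q.2.1)} := by
    refine (measurableSet_eq_fun ?_ ?_).compl
    · exact measurable_snd.comp measurable_snd
    · exact hgh.comp (measurable_fst.prodMk (measurable_fst.comp measurable_snd))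
  exact (measurable_measure_prodMk_left (ν := P) hS).ennreal_toReal.sub_const _

end ExcessRisk

/-- The expectation of a variable bounded by `1` that is at most `b` off a set `S`. -/
theorem integral_le_add_measureReal {Ω : Type*} [MeasurableSpace Ω] {μ : Measure Ω}
    [IsProbabilityMeasure μ] {f : Ω → ℝ} (hf : Integrable f μ) {b : ℝ} (hb : 0 ≤ b) (S : Set Ω)
    (h1 : ∀ x, f x ≤ 1) (h2 : ∀ x ∉ S, f x ≤ b) : ∫ x, f x ∂μ ≤ b + μ.real S := by
  -- The measurable hull has the same measure, so measurability of the bad event is not needed.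
  set T := toMeasurable μ S
  have hT : MeasurableSet T := measurableSet_toMeasurable μ S
  have hi : Integrable (T.indicator fun _ => (1 : ℝ)) μ := (integrable_const 1).indicator hT
  have hle : ∀ x, f x ≤ b + T.indicator (fun _ => (1 : ℝ)) x := by
    intro x
    by_cases hx : x ∈ T
    · rw [Set.indicator_of_mem hx]
      linarith [h1 x]
    · rw [Set.indicator_of_notMem hx, add_zero]
      exact h2 x fun hS => hx (subset_toMeasurable μ S hS)
  refine (integral_mono hf ((integrable_const b).add hi) hle).trans (le_of_eq ?_)
  have e := integral_add (integrable_const b) hi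
  simp only [Pi.add_apply] at e ⊢
  rw [e, integral_const, integral_indicator_const _ hT]
  simp [T, measureReal_def, measure_toMeasurable]

/-- The smallest admissible tuning parameter, relative to `(p + L) log n / (n L)`. -/
def tuningConstant (A : ℝ) : ℝ := 4 * A * (deviation A * (1 + A ^ 3)) ^ 2

theorem tuningConstant_pos (hA : 1 ≤ A) : 0 < tuningConstant A := by
  have := momentScale_pos hA
  unfold tuningConstant deviation unitDeviation varianceProxy
  positivity

set_option maxHeartbeats 1000000 in
/-- Bound on the expected excess risk under the standing assumptions. -/
theorem exists_risk_bound (A K₁ : ℝ) (hA : 1 ≤ A) (hK : 0 ≤ K₁) :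
    ∃ C' : ℝ, 0 < C' ∧ ∀ (n p L : ℕ) (w : Fin L → ℝ) (M : Matrix (Fin p) (Fin L) ℝ)
      (SW : Matrix (Fin p) (Fin p) ℝ) (lam : ℝ) (gs : EuclideanSpace ℝ (Fin p) → Fin L)
      (gh : (Fin n → EuclideanSpace ℝ (Fin p) × Fin L) → EuclideanSpace ℝ (Fin p) → Fin L),
      2 ≤ n → Regular A w M SW →
      tuningConstant A * (((p : ℝ) + L) * Real.log n / (n * L)) ≤ lam →
      lam ≤ K₁ * (((p : ℝ) + L) * Real.log n / (n * L)) →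
      IsBayesRule w M SW gs → IsRRClassifier lam gh →
      Integrable (fun D => excessRisk (law w M SW) gs (gh D)) (dataLaw n (law w M SW)) ∧
      ∫ D, excessRisk (law w M SW) gs (gh D) ∂(dataLaw n (law w M SW)) ≤
        C' * min (((p : ℝ) + L) * ((regMatrix (law w M SW)).rank : ℝ) * L
          * Real.log n ^ 2 / n) 1 := by
  obtain ⟨ε, Q, hε, hQ, key⟩ :=
    exists_discriminant_error_bound A (deviation A) K₁ hA (deviation_nonneg hA) hK
  -- Since log n ≥ log 2 > 1/2, a rate R ≤ δ gives t² = R / log n ≤ 2R, hence both t ≤ ε and t ≤ 1.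
  set δ := min (ε ^ 2 / 2) (1 / 2) with hδ
  have hδ0 : 0 < δ := by positivity
  have hδ1 : δ ≤ ε ^ 2 / 2 := min_le_left _ _
  have hδ2 : δ ≤ 1 / 2 := min_le_right _ _
  -- 384 = 128 · 3 comes from 1 + log n ≤ 3 log n. Of the 9, 1 covers the Gaussian tails L/n² and 8
  -- the bad event. The term 1/δ makes the bound trivial for rates above δ.
  refine ⟨384 * A ^ 4 * Q + 9 + 1 / δ, by positivity, ?_⟩
  intro n p L w M SW lam gs gh hn h hl1 hl2 hgs hgh
  have hprob := h.prob
  have hprob' : IsProbabilityMeasure (dataLaw n (law w M SW)) := by unfold dataLaw; infer_instance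
  have hint : Integrable (fun D => excessRisk (law w M SW) gs (gh D)) (dataLaw n (law w M SW)) :=
    Integrable.of_bound (measurable_excessRisk hgh.1).aestronglyMeasurable 1
      (.of_forall fun D => abs_excessRisk_le _)
  refine ⟨hint, ?_⟩
  have hone : ∀ D, excessRisk (law w M SW) gs (gh D) ≤ 1 := fun D =>
    (le_abs_self _).trans (abs_excessRisk_le _)
  set r : ℝ := ((regMatrix (law w M SW)).rank : ℝ) with hr
  have hr1 : 1 ≤ r := by rw [hr]; exact_mod_cast h.one_le_rank
  set R : ℝ := ((p : ℝ) + L) * r * L * Real.log n ^ 2 / n with hR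
  have hn' : (2 : ℝ) ≤ n := by exact_mod_cast hn
  have hn0 : (0 : ℝ) < n := by linarith
  have hL' : (2 : ℝ) ≤ L := by exact_mod_cast h.two_le
  have hp0 : (0 : ℝ) ≤ p := Nat.cast_nonneg p
  have hlog : 0.69 ≤ Real.log n :=
    (by linarith [Real.log_two_gt_d9] : 0.69 ≤ Real.log 2).trans
      (Real.log_le_log (by norm_num) hn')
  set g := Real.log n with hg
  have hg0 : 0 < g := by linarith
  rcases lt_or_ge δ R with hRδ | hRδ
  · have h1 : ∫ D, excessRisk (law w M SW) gs (gh D) ∂(dataLaw n (law w M SW)) ≤ 1 := by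
      simpa using integral_mono hint (integrable_const (1 : ℝ)) hone
    have h2 : δ ≤ min R 1 := le_min hRδ.le (by linarith)
    refine h1.trans ?_
    calc (1 : ℝ) = 1 / δ * δ := by field_simp
      _ ≤ (384 * A ^ 4 * Q + 9 + 1 / δ) * min R 1 := by
        gcongr
        have : 0 ≤ A ^ 4 * Q := by positivity
        linarith
  rw [min_eq_left (by linarith : R ≤ 1)]
  have hR0 : 0 < R := by positivity
  set e := √(((p : ℝ) + L) * g / n) with he
  set f := √(g / n) with hf
  have he2 : e ^ 2 = ((p : ℝ) + L) * g / n := Real.sq_sqrt (by positivity)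
  have hf2 : f ^ 2 = g / n := Real.sq_sqrt (by positivity)
  have he0 : 0 ≤ e := Real.sqrt_nonneg _
  have hf0 : 0 ≤ f := Real.sqrt_nonneg _
  have hsL : √(L : ℝ) ^ 2 = L := Real.sq_sqrt (by linarith)
  have hsL0 : 0 ≤ √(L : ℝ) := Real.sqrt_nonneg _
  have hsr : √r ^ 2 = r := Real.sq_sqrt (by linarith)
  set t := e * √r * √L with ht
  have ht0 : 0 ≤ t := by positivity
  have ht2 : t ^ 2 * g = R := by
    rw [ht, mul_pow, mul_pow, he2, hsL, hsr, hR]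
    ring
  have ht2R : t ^ 2 ≤ 2 * R := by
    rw [← ht2]
    nlinarith [sq_nonneg t]
  have htε : t ≤ ε := by
    rw [← sq_le_sq₀ ht0 hε.le]
    linarith
  have heL2 : (e * √L) ^ 2 ≤ t ^ 2 := by
    rw [ht, mul_pow, mul_pow, mul_pow, hsr, hsL]
    have : 0 ≤ e ^ 2 * L := by positivity
    nlinarith
  have heL : e * √L ≤ 1 := by
    rw [← sq_le_one_iff₀ (by positivity)]
    linarith
  have hfe : f * √L ≤ e := by
    rw [← sq_le_sq₀ (by positivity) he0, mul_pow, hf2, he2, hsL, div_mul_eq_mul_div, mul_comm g]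
    gcongr
    linarith
  -- The nets require p ≤ n and L ≤ n. Both follow from (e√L)² ≤ 1, as L log n ≥ 1.
  have hsum : (p : ℝ) + L ≤ n := by
    have h1 : (e * √L) ^ 2 ≤ 1 := pow_le_one₀ (by positivity) heL
    rw [mul_pow, he2, hsL, div_mul_eq_mul_div, div_le_one hn0] at h1
    have h2 : 1 ≤ g * L := by
      calc (1 : ℝ) ≤ 0.69 * 2 := by norm_num
        _ ≤ g * L := by gcongr
    calc (p : ℝ) + L ≤ ((p : ℝ) + L) * (g * L) := le_mul_of_one_le_right (by positivity) h2
      _ ≤ n := by rwa [← mul_assoc]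
  have hpn : p ≤ n := by
    have : (p : ℝ) ≤ n := by linarith
    exact_mod_cast this
  have hLn : L ≤ n := by
    have : (L : ℝ) ≤ n := by linarith
    exact_mod_cast this
  have he1 : e ≤ 1 :=
    (le_mul_of_one_le_right he0 (Real.one_le_sqrt.mpr (by linarith))).trans heL
  have hbad := h.measureReal_not_goodData_le hn hpn hLn he0 hf0
    (by rw [he2, mul_div_cancel₀ _ hn0.ne']) (by rw [hf2, mul_div_cancel₀ _ hn0.ne']) heL (hfe.trans he1)
  have hconv : ((p : ℝ) + L) * g / (n * L) = e ^ 2 / L := by rw [he2, div_div]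
  rw [hconv] at hl1 hl2
  -- The risk bound is used with T = log n, which leaves a tail term of L/n².
  have hbase : ∀ D, GoodData (deviation A) e f w M SW D →
      excessRisk (law w M SW) gs (gh D) ≤ 128 * A ^ 4 * (1 + g) * (Q * t ^ 2) +
        L * Real.exp (-(2 * g)) := by
    intro D hD
    obtain ⟨hpos, hBnd⟩ := key n p L w M SW D lam e f t (by omega) h he0 hf0 hfe ht htε hl1 hl2 hD
    -- Positive class frequencies mean that every class occurs, which is the case in which the
    -- classifier is specified.
    obtain ⟨Bh, hBh, hmin⟩ := hgh.2 D fun l => exists_label_of_pihat_pos _ (hpos l)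
    have hgD : Measurable (gh D) := hgh.1.comp measurable_prodMk_left
    refine (h.excessRisk_le hgs hgD (interceptError w M SW D Bh) (dirError M SW D Bh)
      (fun x l => ?_) hg0.le).trans ?_
    · rw [← discrHat_sub_discr, ← discrHat_sub_discr, add_sub_cancel, add_sub_cancel]
      exact hmin x l
    · gcongr
      exact hBnd Bh hBh
  have hexp : Real.exp (-(2 * g)) = 1 / (n : ℝ) ^ 2 := by
    rw [Real.exp_neg, two_mul, Real.exp_add, hg, Real.exp_log hn0, one_div, sq]
  have hRn : (L : ℝ) / n ≤ 2 * R := by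
    have h1 : 1 ≤ 2 * (((p : ℝ) + L) * r * g ^ 2) := by
      calc (1 : ℝ) ≤ 2 * ((0 + 2) * 1 * 0.69 ^ 2) := by norm_num
        _ ≤ _ := by gcongr
    calc (L : ℝ) / n ≤ 2 * (((p : ℝ) + L) * r * g ^ 2) * (L / n) :=
          le_mul_of_one_le_left (by positivity) h1
      _ = 2 * R := by rw [hR]; ring
  have hLn2 : (L : ℝ) * (1 / (n : ℝ) ^ 2) ≤ R := by
    have h1 : 2 * (L * (1 / (n : ℝ) ^ 2)) ≤ L / n := by
      rw [mul_one_div, sq, ← div_div, ← mul_div_assoc, div_le_iff₀ hn0, mul_comm]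
      gcongr
    linarith
  have h8 : (8 : ℝ) / n ≤ 8 * R := by
    have h1 : (8 : ℝ) / n ≤ 4 * (L / n) := by
      rw [← mul_div_assoc]
      gcongr
      linarith
    linarith
  have hfin := integral_le_add_measureReal hint (b := (384 * A ^ 4 * Q + 1) * R) (by positivity)
    {D | ¬ GoodData (deviation A) e f w M SW D} hone (fun D hD => by
      refine (hbase D (by simpa using hD)).trans ?_
      rw [hexp]
      have h1 : 128 * A ^ 4 * (1 + g) * (Q * t ^ 2) ≤ 128 * A ^ 4 * (3 * g) * (Q * t ^ 2) := by
        gcongr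
        linarith
      have h2 : 128 * A ^ 4 * (3 * g) * (Q * t ^ 2) = 384 * A ^ 4 * Q * R := by
        rw [← ht2]; ring
      linarith)
  have h9 : 0 ≤ 1 / δ * R := by positivity
  linarith

end RiskBound

end LDA

end

/-! ### The risk bound in terms of c, C and K₁. -/

theorem corollary9 :
    ∀ c C : ℝ, 0 < c → c ≤ C →
    ∃ c₀ K₀ : ℝ, 0 < c₀ ∧ 0 < K₀ ∧ ∀ K₁ : ℝ, K₀ ≤ K₁ →
    ∃ C' : ℝ, 0 < C' ∧
    ∀ (n p L : ℕ), 2 ≤ n → 2 ≤ L →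
    ∀ (w : Fin L → ℝ) (M : Matrix (Fin p) (Fin L) ℝ) (SW : Matrix (Fin p) (Fin p) ℝ)
      (hSW : SW.PosDef) (Δ lam : ℝ)
      (gstar : EuclideanSpace ℝ (Fin p) → Fin L)
      (ghat : (Fin n → EuclideanSpace ℝ (Fin p) × Fin L) → EuclideanSpace ℝ (Fin p) → Fin L),
    -- class probabilities, all of order `1 / L`
    (∑ l, w l = 1) → (∀ l, c / L ≤ w l ∧ w l ≤ C / L) →
    -- the features are centred
    (∑ l, w l • M.col l = 0) →
    -- pairwise separation of order `Δ`, and `Δ` of constant order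
    (∀ k l, k ≠ l → c * Δ ≤ LDA.mahal M SW k l ∧ LDA.mahal M SW k l ≤ C * Δ) →
    c ≤ Δ → Δ ≤ C →
    -- bounded eigenvalues of `Σ_W`
    (∀ i, c ≤ hSW.isHermitian.eigenvalues i ∧ hSW.isHermitian.eigenvalues i ≤ C) →
    -- sample size
    ((p : ℝ) + L) * Real.log n ≤ c₀ * n →
    -- tuning parameter
    K₀ * (((p : ℝ) + L) * Real.log n / (n * L)) ≤ lam →
    lam ≤ K₁ * (((p : ℝ) + L) * Real.log n / (n * L)) →
    -- the Bayes rule and the classifier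
    LDA.IsBayesRule w M SW gstar →
    LDA.IsRRClassifier lam ghat →
    MeasureTheory.Integrable
        (fun D => LDA.excessRisk (LDA.law w M SW) gstar (ghat D))
        (LDA.dataLaw n (LDA.law w M SW)) ∧
      ∫ D, LDA.excessRisk (LDA.law w M SW) gstar (ghat D) ∂(LDA.dataLaw n (LDA.law w M SW)) ≤
        C' * min (((p : ℝ) + L) * ((LDA.regMatrix (LDA.law w M SW)).rank : ℝ) * L
          * Real.log n ^ 2 / n) 1 := by
  intro c C hc hcC
  have hC : 0 < C := hc.trans_le hcC
  have hA : 1 ≤ LDA.regularityConstant c C := by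
    have p1 : 0 < 1 / c := by positivity
    have p2 : 0 < 1 / c ^ 2 := by positivity
    have p3 : 0 < C ^ 2 := by positivity
    rw [LDA.regularityConstant]
    linarith
  have hK₀ := LDA.tuningConstant_pos hA
  -- K₀ is the constant for which the penalty dominates the squared regression noise on the good
  -- event. K₁ enters only afterwards, through C'.
  refine ⟨1, LDA.tuningConstant (LDA.regularityConstant c C), one_pos, hK₀, fun K₁ hK₁ => ?_⟩
  obtain ⟨C', hC', H⟩ := LDA.exists_risk_bound (LDA.regularityConstant c C) K₁ hA
    (hK₀.le.trans hK₁)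
  refine ⟨C', hC', ?_⟩
  intro n p L hn hL w M SW hSW Δ lam gstar ghat h1 hw h0 hM hcΔ hΔC hE _ hl hu hg hgh
  exact H n p L w M SW lam gstar ghat hn
    (LDA.regular_of_bounds hc hcC hL hSW h1 hw h0 hM hcΔ hΔC hE) hl hu hg hgh
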